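/- All polytopes are full-dimensional convex polytopes in Euclidean space $\mathbb{R}^4$. Two polytopes are combinatorially equivalent if their face lattices are isomorphic; an orthoplex (resp. hypercube, 24-cell) is a 4-polytope combinatorially equivalent to the regular one, i.e. to the convex hull of $\{\pm e_i\}$ (resp. of $\{\pm1\}^4$, of $\{\pm e_i\pm e_j : i\neq j\}$). A polytope is edge-scribable if it is combinatorially equivalent to a polytope all of whose edges are tangent to the unit sphere $\mathbb{S}^3$ (each edge, as a closed segment, touches the sphere and lies in the tangent hyperplane at the point of contact). If $P,P'$ are 4-polytopes with a common facet $f$, then a 4-polytope $Q$ is their connected sum $P\#_f P'$ along $f$ if $P\cap P'=f$, $P\cup P'=Q$, and the proper faces of $Q$ are exactly the proper faces of $P$ and the proper faces of $P'$, except $f$. Proposition. The following 4-polytopes are not edge-scribable. 1. Every connected sum $P\#_f P'$ of two orthoplexes $P,P'$. 2. Every consecutive connected sum $(P_1\#_{f_1}P_2)\#_{f_2}P_3$ of three hypercubes $P_1,P_2,P_3$ that share a ridge, i.e. for which some set $r$ is a 2-dimensional face of each of $P_1,P_2,P_3$. 3. Every consecutive connected sum $(P_1\#_{f_1}P_2)\#_{f_2}P_3$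 of three 24-cells $P_1,P_2,P_3$ that share a ridge, in the same sense. -/

import Mathlib

namespace EdgeScribe

/-- A (full-dimensional) convex `n`-polytope in Euclidean `n`-space: the convex hull of finitely
many points which affinely span the space. -/
def IsPolytope {n : ℕ} (P : Set (EuclideanSpace ℝ (Fin n))) : Prop :=
  (∃ s : Set (EuclideanSpace ℝ (Fin n)), s.Finite ∧ P = convexHull ℝ s) ∧
    affineSpan ℝ P = ⊤

/-- The face lattice of `P`: all faces, including `∅` and `P` itself, ordered by inclusion.
Nonempty faces are the sets of maximizers of linear functionals on `P`. -/
abbrev FaceLattice {n : ℕ} (P : Set (EuclideanSpace ℝ (Fin n))) : Type :=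
  {F : Set (EuclideanSpace ℝ (Fin n)) // IsExposed ℝ P F}

/-- Two polytopes are combinatorially equivalent (realizations of the same combinatorial
polytope) if their face lattices are isomorphic. -/
def CombEquiv {n : ℕ} (P Q : Set (EuclideanSpace ℝ (Fin n))) : Prop :=
  Nonempty (FaceLattice P ≃o FaceLattice Q)

/-- `F` is a `k`-dimensional face of `P`. -/
def IsFaceOfDim {n : ℕ} (k : ℕ) (P F : Set (EuclideanSpace ℝ (Fin n))) : Prop :=
  IsExposed ℝ P F ∧ F.Nonempty ∧ Module.finrank ℝ (vectorSpan ℝ F) = k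

/-- `F` is a proper face of `P` (the empty face is allowed). -/
def IsProperFace {n : ℕ} (P F : Set (EuclideanSpace ℝ (Fin n))) : Prop :=
  IsExposed ℝ P F ∧ F ≠ P

/-- The segment `e` is tangent to the unit sphere: it touches the sphere at a point `z` of `e`
and lies in the tangent hyperplane at `z`. -/
def IsTangentToSphere {n : ℕ} (e : Set (EuclideanSpace ℝ (Fin n))) : Prop :=
  ∃ z ∈ e, ‖z‖ = 1 ∧ ∀ y ∈ e, inner ℝ z y = 1

/-- A polytope is edge-scribed if every edge is tangent to the unit sphere. -/
def IsEdgeScribed {n : ℕ} (P : Set (EuclideanSpace ℝ (Fin n))) : Prop :=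
  IsPolytope P ∧ ∀ e, IsFaceOfDim 1 P e → IsTangentToSphere e

/-- A polytope is edge-scribable if it has an edge-scribed realization. -/
def IsEdgeScribable {n : ℕ} (P : Set (EuclideanSpace ℝ (Fin n))) : Prop :=
  ∃ P' : Set (EuclideanSpace ℝ (Fin n)), IsEdgeScribed P' ∧ CombEquiv P P'

/-- `Q` is the connected sum of the `4`-polytopes `P` and `P'` along the facet `f`: they are glued
along their common facet `f`, and the (proper) faces of `Q` are the (proper) faces of `P` and
those of `P'`, minus `f`. -/
structure IsConnectedSum (P P' f Q : Set (EuclideanSpace ℝ (Fin 4))) : Prop where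
  polytope_left : IsPolytope P
  polytope_right : IsPolytope P'
  polytope_sum : IsPolytope Q
  facet_left : IsFaceOfDim 3 P f
  facet_right : IsFaceOfDim 3 P' f
  inter_eq : P ∩ P' = f
  union_eq : P ∪ P' = Q
  faces_iff : ∀ G, IsProperFace Q G ↔ (IsProperFace P G ∨ IsProperFace P' G) ∧ G ≠ f

/-- `Q` is a consecutive connected sum `(P₁ # P₂) # P₃` in which `P₁`, `P₂` and `P₃` share a
ridge `r`, that is, a common `2`-face. -/
def IsTripleSumSharingRidge (P₁ P₂ P₃ Q : Set (EuclideanSpace ℝ (Fin 4))) : Prop :=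
  ∃ f₁ f₂ r R : Set (EuclideanSpace ℝ (Fin 4)),
    IsConnectedSum P₁ P₂ f₁ R ∧ IsConnectedSum R P₃ f₂ Q ∧
      IsFaceOfDim 2 P₁ r ∧ IsFaceOfDim 2 P₂ r ∧ IsFaceOfDim 2 P₃ r

/-- The regular orthoplex, with vertices `± eᵢ`. -/
def regularOrthoplex : Set (EuclideanSpace ℝ (Fin 4)) :=
  convexHull ℝ {x | ∃ (i : Fin 4) (a : ℝ), (a = 1 ∨ a = -1) ∧ x = EuclideanSpace.single i a}

/-- The regular hypercube, with vertices `(±1, ±1, ±1, ±1)`. -/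
def regularHypercube : Set (EuclideanSpace ℝ (Fin 4)) :=
  convexHull ℝ {x | ∀ i : Fin 4, x i = 1 ∨ x i = -1}

/-- The regular 24-cell, with the 24 vertices `± eᵢ ± eⱼ`, `i ≠ j`. -/
def regular24Cell : Set (EuclideanSpace ℝ (Fin 4)) :=
  convexHull ℝ {x | ∃ (i j : Fin 4) (a b : ℝ), i ≠ j ∧ (a = 1 ∨ a = -1) ∧ (b = 1 ∨ b = -1) ∧
    x = EuclideanSpace.single i a + EuclideanSpace.single j b}

/-- An orthoplex: any realization of the combinatorial type of the regular one. -/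
def IsOrthoplex (P : Set (EuclideanSpace ℝ (Fin 4))) : Prop :=
  IsPolytope P ∧ CombEquiv P regularOrthoplex

/-- A hypercube: any realization of the combinatorial type of the regular one. -/
def IsHypercube (P : Set (EuclideanSpace ℝ (Fin 4))) : Prop :=
  IsPolytope P ∧ CombEquiv P regularHypercube

/-- A 24-cell: any realization of the combinatorial type of the regular one. -/
def Is24Cell (P : Set (EuclideanSpace ℝ (Fin 4))) : Prop :=
  IsPolytope P ∧ CombEquiv P regular24Cell

end EdgeScribe

open EdgeScribe

/-! Lift a point `v` of `ℝ⁴` to the vector `(v, 1)` of Lorentz space of signature `(4, 1)`, rescaled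
to norm one when `v` lies outside the sphere. An edge tangent to the sphere, with endpoints off the
sphere, then has endpoints with product exactly `-1`, and a nonempty face of the polytope is cut out
by a linear functional that is nonnegative on the lifted vertices (`Scribing`). An edge-scribed
realization of a connected sum therefore restricts to each summand as a system of vectors with
prescribed products along the edges and with flat faces. The exceptions are the facets used for
gluing: they are no longer faces of the sum, so nothing says that they stay flat.

Each of the three regular polytopes is rigid enough to survive this loss. Let `r` be a ridge. The
lifts of its vertices span a nondegenerate subspace containing a null vector, whose complement is a
Euclidean plane. All vertices of a facet `f` at `r` that are off `r` have the same projection to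
this plane, the normal of `f` at `r` (`IsNormal`). The products of the normals of the two facets at
`r` are forced (`IsHinge`): the angle is `π / 2` for the orthoplex, and `π / 3` for the hypercube
and the 24-cell. The rigidity comes from `orthoplex_rigid` (opposite vertices have product `-3`),
from `IsTangentCube.parallelogram` (the squares of a flat tangent cube are parallelograms), and from
`octahedron_rigid` together with `cell_star` (the diagonals of an octahedral facet have equal sums,
even in the ignored facets).

Now go around `r`. Adjacent summands share the normal of their common facet (`IsNormal.unique`), and
consecutive normals have equal norms and equal products, so each is either equal to the one two
steps before or its mirror image (`planar_reflection`). Equality would put two different facets of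
the glued body into one hyperplane. With the mirror images, two angles `π / 2`, or three angles `π /
3`, add up to a straight angle: the first and the last normal are opposite. But `r` is a face of the
sum, and the functional that cuts it out cannot be positive on both of two opposite normals
(`IsNormal.not_neg`).

Arbitrary realizations and arbitrary flags reduce to a single flag of the regular polytope, because
the hypotheses on a scribing are combinatorial and the regular polytopes are flag-transitive at the
level of facet and ridge (`IsModel`). -/

open EdgeScribe
namespace EdgeScribe

/-! ### Faces, vertices and face lattices of polytopes -/

section Polytopes

variable {n m : ℕ}

/-- The convex hull of finitely many points, of any dimension. -/
def IsFiniteHull (P : Set (EuclideanSpace ℝ (Fin n))) : Prop :=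
  ∃ s : Set (EuclideanSpace ℝ (Fin n)), s.Finite ∧ P = convexHull ℝ s

/-- The vertices of a polytope. -/
abbrev vertices (P : Set (EuclideanSpace ℝ (Fin n))) : Set (EuclideanSpace ℝ (Fin n)) :=
  P.extremePoints ℝ

lemma IsPolytope.isFiniteHull {P : Set (EuclideanSpace ℝ (Fin n))} (h : IsPolytope P) :
    IsFiniteHull P := h.1

lemma IsFiniteHull.isCompact {P : Set (EuclideanSpace ℝ (Fin n))} (h : IsFiniteHull P) :
    IsCompact P := by
  obtain ⟨s, hs, rfl⟩ := h
  exact hs.isCompact_convexHull ℝ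

lemma IsFiniteHull.convex {P : Set (EuclideanSpace ℝ (Fin n))} (h : IsFiniteHull P) :
    Convex ℝ P := by
  obtain ⟨s, hs, rfl⟩ := h
  exact convex_convexHull ℝ s

lemma IsFiniteHull.finite_vertices {P : Set (EuclideanSpace ℝ (Fin n))} (h : IsFiniteHull P) :
    (vertices P).Finite := by
  obtain ⟨s, hs, rfl⟩ := h
  exact hs.subset extremePoints_convexHull_subset

/-- A vertex of a polytope is a `0`-dimensional face. -/
lemma IsFiniteHull.isExposed_singleton_iff {P : Set (EuclideanSpace ℝ (Fin n))}
    (h : IsFiniteHull P) {x : EuclideanSpace ℝ (Fin n)} :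
    IsExposed ℝ P {x} ↔ x ∈ vertices P := by
  refine ⟨fun hx => isExtreme_singleton.1 hx.isExtreme, fun hx _ => ?_⟩
  obtain ⟨s, hs, rfl⟩ := h
  have hfin : (s \ {x}).Finite := hs.subset Set.sdiff_subset
  have hxn : x ∉ convexHull ℝ (s \ {x}) := by
    have h1 := ((convex_convexHull ℝ s).mem_extremePoints_iff_mem_sdiff_convexHull_sdiff).1 hx
    refine fun hc => h1.2 (convexHull_mono ?_ hc)
    exact Set.sdiff_subset_sdiff_left (subset_convexHull ℝ s)
  -- A functional separating `x` strictly from the hull of the other generators has `x` as its only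
  -- maximizer.
  obtain ⟨l, u, hl, hu⟩ := geometric_hahn_banach_closed_point (convex_convexHull ℝ _)
    (hfin.isClosed_convexHull ℝ) hxn
  have hle : ∀ y ∈ s, l y ≤ l x := by
    intro y hy
    by_cases hyx : y = x
    · rw [hyx]
    · exact ((hl y (subset_convexHull ℝ _ ⟨hy, hyx⟩)).trans hu).le
  have hle' : ∀ y ∈ convexHull ℝ s, l y ≤ l x := by
    intro y hy
    have : convexHull ℝ s ⊆ {z | l z ≤ l x} :=
      convexHull_min hle (convex_halfSpace_le l.toLinearMap.isLinear _)
    exact this hy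
  refine ⟨l, Set.Subset.antisymm ?_ ?_⟩
  · rintro _ rfl
    exact ⟨hx.1, hle'⟩
  · rintro y ⟨hy, hmax⟩
    have hxs : x ∈ s := extremePoints_convexHull_subset hx
    rw [Set.mem_singleton_iff]
    by_contra hne
    have hs' : s = insert x (s \ {x}) := by simp [Set.insert_eq_of_mem hxs]
    have hnon : (s \ {x}).Nonempty := by
      by_contra hemp
      rw [Set.not_nonempty_iff_eq_empty] at hemp
      rw [hs', hemp] at hy
      simp at hy
      exact hne hy
    rw [hs', convexHull_insert hnon, mem_convexJoin] at hy
    obtain ⟨x', hx', z, hz, hyz⟩ := hy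
    rw [Set.mem_singleton_iff] at hx'
    subst hx'
    obtain ⟨a, b, ha, hb, hab, rfl⟩ := hyz
    have hb0 : b ≠ 0 := by
      rintro rfl
      apply hne
      have : a = 1 := by linarith
      simp [this]
    have hbpos : 0 < b := lt_of_le_of_ne hb (Ne.symm hb0)
    have h1 := hmax x' hx.1
    have h2 := (hl z hz).trans hu
    have ha' : a = 1 - b := by linarith
    simp only [map_add, map_smul, smul_eq_mul, ha'] at h1
    nlinarith

/-- A face of a polytope is the convex hull of the vertices it contains. -/
lemma IsFiniteHull.face_eq {P F : Set (EuclideanSpace ℝ (Fin n))} (h : IsFiniteHull P)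
    (hF : IsExposed ℝ P F) : F = convexHull ℝ (F ∩ vertices P) := by
  have hc : IsCompact F := hF.isCompact h.isCompact
  have hv : Convex ℝ F := hF.convex h.convex
  have h1 := closure_convexHull_extremePoints hc hv
  rw [hF.isExtreme.extremePoints_eq] at h1
  have hfin : (F ∩ vertices P).Finite := h.finite_vertices.subset Set.inter_subset_right
  rw [(hfin.isClosed_convexHull ℝ).closure_eq] at h1
  exact h1.symm

lemma IsFiniteHull.face_subset {P F G : Set (EuclideanSpace ℝ (Fin n))} (h : IsFiniteHull P)
    (hF : IsExposed ℝ P F) (hG : IsExposed ℝ P G) (hs : ∀ x ∈ vertices P, x ∈ F → x ∈ G) :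
    F ⊆ G := by
  rw [h.face_eq hF, h.face_eq hG]
  exact convexHull_mono fun x hx => ⟨hs x hx.2 hx.1, hx.2⟩

lemma IsFiniteHull.face_ext {P F G : Set (EuclideanSpace ℝ (Fin n))} (h : IsFiniteHull P)
    (hF : IsExposed ℝ P F) (hG : IsExposed ℝ P G) (hs : ∀ x ∈ vertices P, x ∈ F ↔ x ∈ G) :
    F = G :=
  (h.face_subset hF hG fun x hx => (hs x hx).1).antisymm
    (h.face_subset hG hF fun x hx => (hs x hx).2)

lemma IsFiniteHull.exists_vertex {P F : Set (EuclideanSpace ℝ (Fin n))} (h : IsFiniteHull P)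
    (hF : IsExposed ℝ P F) (hne : F.Nonempty) : ∃ x ∈ vertices P, x ∈ F := by
  rw [h.face_eq hF, convexHull_nonempty_iff] at hne
  obtain ⟨x, hx⟩ := hne
  exact ⟨x, hx.2, hx.1⟩

lemma orderIso_empty {P : Set (EuclideanSpace ℝ (Fin n))} {P' : Set (EuclideanSpace ℝ (Fin m))}
    (Φ : FaceLattice P ≃o FaceLattice P') (F : FaceLattice P) :
    (Φ F).1 = ∅ ↔ F.1 = ∅ := by
  have key : ∀ {k l : ℕ} {A : Set (EuclideanSpace ℝ (Fin k))}
      {B : Set (EuclideanSpace ℝ (Fin l))} (Θ : FaceLattice A ≃o FaceLattice B)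
      (F : FaceLattice A), F.1 = ∅ → (Θ F).1 = ∅ := by
    intro k l A B Θ F hF
    have h1 : F ≤ Θ.symm ⟨∅, isExposed_empty⟩ := by
      change F.1 ⊆ _
      rw [hF]
      exact Set.empty_subset _
    have h2 : Θ F ≤ ⟨∅, isExposed_empty⟩ := by simpa using Θ.monotone h1
    exact Set.subset_empty_iff.1 h2
  refine ⟨fun h => ?_, key Φ F⟩
  simpa using key Φ.symm (Φ F) h

lemma orderIso_nonempty {P : Set (EuclideanSpace ℝ (Fin n))}
    {P' : Set (EuclideanSpace ℝ (Fin m))}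
    (Φ : FaceLattice P ≃o FaceLattice P') (F : FaceLattice P) :
    (Φ F).1.Nonempty ↔ F.1.Nonempty := by
  rw [Set.nonempty_iff_ne_empty, Set.nonempty_iff_ne_empty, Ne, Ne, orderIso_empty]

/-- An isomorphism of face lattices sends vertices to vertices. -/
lemma orderIso_singleton {P : Set (EuclideanSpace ℝ (Fin n))}
    {P' : Set (EuclideanSpace ℝ (Fin m))} (hP' : IsFiniteHull P')
    (Φ : FaceLattice P ≃o FaceLattice P') (F : FaceLattice P) (x : EuclideanSpace ℝ (Fin n))
    (hx : F.1 = {x}) : ∃ y ∈ vertices P', (Φ F).1 = {y} := by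
  have hne : (Φ F).1.Nonempty := (orderIso_nonempty Φ F).2 (by simp [hx])
  obtain ⟨y, hy, hyF⟩ := hP'.exists_vertex (Φ F).2 hne
  let Y : FaceLattice P' := ⟨{y}, hP'.isExposed_singleton_iff.2 hy⟩
  have h1 : Y ≤ Φ F := Set.singleton_subset_iff.2 hyF
  have h2 : (Φ.symm Y).1 ⊆ {x} := hx ▸ (Φ.symm_apply_le.2 h1 : Φ.symm Y ≤ F)
  have h3 : (Φ.symm Y).1.Nonempty := (orderIso_nonempty Φ.symm Y).2 (by simp [Y])
  have h4 : Φ.symm Y = F := Subtype.ext ((h3.subset_singleton_iff.1 h2).trans hx.symm)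
  refine ⟨y, hy, ?_⟩
  rw [← h4]
  simp [Y]

/-- The map on vertices induced by an isomorphism of face lattices. -/
lemma exists_vertexMap {P : Set (EuclideanSpace ℝ (Fin n))}
    {P' : Set (EuclideanSpace ℝ (Fin m))} (hP : IsFiniteHull P) (hP' : IsFiniteHull P')
    (Φ : FaceLattice P ≃o FaceLattice P') :
    ∃ ν : EuclideanSpace ℝ (Fin n) → EuclideanSpace ℝ (Fin m),
      (∀ x ∈ vertices P, ν x ∈ vertices P') ∧
      (∀ x ∈ vertices P, ∀ F : FaceLattice P, ν x ∈ (Φ F).1 ↔ x ∈ F.1) ∧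
      (∀ y ∈ vertices P', ∃ x ∈ vertices P, ν x = y) := by
  have h1 : ∀ x : EuclideanSpace ℝ (Fin n), ∃ y, ∀ hx : x ∈ vertices P,
      y ∈ vertices P' ∧ (Φ ⟨{x}, hP.isExposed_singleton_iff.2 hx⟩).1 = {y} := by
    intro x
    by_cases hx : x ∈ vertices P
    · obtain ⟨y, hy, hyx⟩ := orderIso_singleton hP' Φ ⟨{x}, hP.isExposed_singleton_iff.2 hx⟩ x rfl
      exact ⟨y, fun _ => ⟨hy, hyx⟩⟩
    · exact ⟨0, fun h => absurd h hx⟩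
  choose ν hν using h1
  refine ⟨ν, fun x hx => (hν x hx).1, fun x hx F => ?_, fun y hy => ?_⟩
  · have h2 := (hν x hx).2
    rw [← Set.singleton_subset_iff, ← h2, ← Set.singleton_subset_iff (s := F.1)]
    exact Φ.le_iff_le
  · let Y : FaceLattice P' := ⟨{y}, hP'.isExposed_singleton_iff.2 hy⟩
    obtain ⟨x, hx, hxy⟩ := orderIso_singleton hP Φ.symm Y y rfl
    refine ⟨x, hx, ?_⟩
    have h2 : (⟨{x}, hP.isExposed_singleton_iff.2 hx⟩ : FaceLattice P) = Φ.symm Y :=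
      Subtype.ext hxy.symm
    have h3 := (hν x hx).2
    rw [h2] at h3
    simpa [Y] using h3.symm

/-- Dimension is strictly monotone on faces. -/
lemma finrank_vectorSpan_lt {P F G : Set (EuclideanSpace ℝ (Fin n))} (hF : IsExposed ℝ P F)
    (hG : IsExposed ℝ P G) (hne : F.Nonempty) (hFG : F ⊆ G) (hn : F ≠ G) :
    Module.finrank ℝ (vectorSpan ℝ F) < Module.finrank ℝ (vectorSpan ℝ G) := by
  obtain ⟨x, hx⟩ := hne
  obtain ⟨l, hl⟩ := hF ⟨x, hx⟩
  obtain ⟨y, hyG, hyF⟩ := Set.exists_of_ssubset (hFG.ssubset_of_ne hn)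
  have hle : vectorSpan ℝ F ≤ LinearMap.ker l.toLinearMap := by
    rw [vectorSpan_def, Submodule.span_le]
    rintro _ ⟨a, ha, b, hb, rfl⟩
    rw [hl] at ha hb
    have := le_antisymm (ha.2 b hb.1) (hb.2 a ha.1)
    simp [this]
  -- If the direction spaces were equal, `l`, which is constant on `F`, would be constant on `G`,
  -- and `y` would be a maximizer of `l` as well.
  refine Submodule.finrank_lt_finrank_of_lt (lt_of_le_of_ne (vectorSpan_mono ℝ hFG) fun heq => ?_)
  have hmem : y -ᵥ x ∈ vectorSpan ℝ F := heq ▸ vsub_mem_vectorSpan ℝ hyG (hFG hx)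
  have h0 := hle hmem
  simp only [vsub_eq_sub, LinearMap.mem_ker, ContinuousLinearMap.coe_coe, map_sub] at h0
  apply hyF
  have hx' := hx
  rw [hl] at hx' ⊢
  refine ⟨hG.subset hyG, fun z hz => ?_⟩
  have := hx'.2 z hz
  linarith

lemma IsPolytope.finrank_eq {P : Set (EuclideanSpace ℝ (Fin n))} (h : IsPolytope P) :
    Module.finrank ℝ (vectorSpan ℝ P) = n := by
  rw [← direction_affineSpan, h.2, AffineSubspace.direction_top]
  simp

/-- A face `F` is a facet (coatom) in the face lattice of `P`. -/
def IsFacet (P F : Set (EuclideanSpace ℝ (Fin n))) : Prop :=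
  IsExposed ℝ P F ∧ F.Nonempty ∧ F ≠ P ∧ ∀ G, IsExposed ℝ P G → F ⊆ G → G = F ∨ G = P

/-- `r` is a ridge of `P` inside the facet `F`: a nonempty face covered by `F`. -/
def IsRidgeOf (P F r : Set (EuclideanSpace ℝ (Fin n))) : Prop :=
  IsExposed ℝ P r ∧ r.Nonempty ∧ r ⊆ F ∧ r ≠ F ∧
    ∀ G, IsExposed ℝ P G → r ⊆ G → G ⊆ F → G = r ∨ G = F

lemma IsFaceOfDim.isFacet {P F : Set (EuclideanSpace ℝ (Fin (n + 1)))} (hP : IsPolytope P)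
    (h : IsFaceOfDim n P F) : IsFacet P F := by
  obtain ⟨hF, hne, hd⟩ := h
  refine ⟨hF, hne, ?_, fun G hG hFG => ?_⟩
  · rintro rfl
    have := hP.finrank_eq
    omega
  · by_contra! hc
    have h1 := finrank_vectorSpan_lt hF hG hne hFG (Ne.symm hc.1)
    have h2 := finrank_vectorSpan_lt hG (IsExposed.refl P) (hne.mono hFG) hG.subset hc.2
    have := hP.finrank_eq
    omega

lemma IsFaceOfDim.isRidgeOf {k : ℕ} {P F r : Set (EuclideanSpace ℝ (Fin n))}
    (hF : IsFaceOfDim (k + 1) P F) (hr : IsFaceOfDim k P r) (hrF : r ⊆ F) :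
    IsRidgeOf P F r := by
  obtain ⟨hF, hne, hd⟩ := hF
  obtain ⟨hr, hrne, hrd⟩ := hr
  refine ⟨hr, hrne, hrF, ?_, fun G hG hrG hGF => ?_⟩
  · rintro rfl
    omega
  · by_contra! hc
    have h1 := finrank_vectorSpan_lt hr hG hrne hrG (Ne.symm hc.1)
    have h2 := finrank_vectorSpan_lt hG hF (hrne.mono hrG) hGF hc.2
    omega

end Polytopes

/-! ### Lorentzian lifts of edge-scribed polytopes -/

/-- Euclidean `4`-space. -/
abbrev E4 : Type := EuclideanSpace ℝ (Fin 4)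

/-- Lorentzian space of signature `(4, 1)`. -/
abbrev M5 : Type := E4 × ℝ

/-- The Lorentz form. -/
noncomputable def lor : M5 →ₗ[ℝ] M5 →ₗ[ℝ] ℝ :=
  LinearMap.mk₂ ℝ (fun x y => inner ℝ x.1 y.1 - x.2 * y.2)
    (fun x y z => by simp only [Prod.fst_add, Prod.snd_add, inner_add_left]; ring)
    (fun c x y => by simp only [Prod.smul_fst, Prod.smul_snd, real_inner_smul_left, smul_eq_mul]; ring)
    (fun x y z => by simp only [Prod.fst_add, Prod.snd_add, inner_add_right]; ring)
    (fun c x y => by simp only [Prod.smul_fst, Prod.smul_snd, real_inner_smul_right, smul_eq_mul]; ring)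

lemma lor_apply (x y : M5) : lor x y = inner ℝ x.1 y.1 - x.2 * y.2 := rfl

lemma lor_comm (x y : M5) : lor x y = lor y x := by
  rw [lor_apply, lor_apply, real_inner_comm, mul_comm]

/-- `W` assigns to the vertices of the polytope `Q` normalized Lorentzian lifts of the vertices of
an edge-scribed polytope, whose faces correspond to those faces of `Q` not in `bad`. -/
structure Scribing (Q : Set E4) (bad : Set (Set E4)) (W : E4 → M5) : Prop where
  pos : ∀ x ∈ vertices Q, 0 < (W x).2
  face : ∀ S, IsExposed ℝ Q S → S.Nonempty → S ∉ bad →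
    ∃ L : M5 →ₗ[ℝ] ℝ, ∀ x ∈ vertices Q, 0 ≤ L (W x) ∧ (L (W x) = 0 ↔ x ∈ S)
  edge : ∀ S, IsExposed ℝ Q S → S ∉ bad → ∀ x ∈ vertices Q, ∀ y ∈ vertices Q, x ≠ y →
    (∀ z ∈ vertices Q, z ∈ S ↔ z = x ∨ z = y) →
    (lor (W x) (W x) = 0 ∨ lor (W x) (W x) = 1) ∧
      lor (W x) (W y) = -(lor (W x) (W x) * lor (W y) (W y))

/-- The Lorentzian lift of a point, normalized if it is spacelike. -/
noncomputable def lift (v : E4) : M5 :=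
  if 1 < ‖v‖ then (Real.sqrt (‖v‖ ^ 2 - 1))⁻¹ • (v, 1) else (v, 1)

lemma lift_eq (v : E4) : ∃ c : ℝ, 0 < c ∧ lift v = c • (v, 1) := by
  unfold lift
  split_ifs with h
  · refine ⟨_, inv_pos.2 (Real.sqrt_pos.2 ?_), rfl⟩
    nlinarith
  · exact ⟨1, one_pos, (one_smul _ _).symm⟩

lemma lor_lift_of_lt {v w : E4} (hv : 1 < ‖v‖) (hw : 1 < ‖w‖) :
    lor (lift v) (lift w) =
      (inner ℝ v w - 1) / (Real.sqrt (‖v‖ ^ 2 - 1) * Real.sqrt (‖w‖ ^ 2 - 1)) := by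
  simp only [lift, hv, hw, if_true, map_smul, LinearMap.smul_apply, smul_eq_mul]
  rw [lor_apply, div_eq_mul_inv, mul_inv]
  ring

lemma lor_lift_self {v : E4} (hv : 1 < ‖v‖) : lor (lift v) (lift v) = 1 := by
  rw [lor_lift_of_lt hv hv, real_inner_self_eq_norm_sq, Real.mul_self_sqrt (by nlinarith)]
  exact div_self (by nlinarith)

/-- The endpoints of a tangent segment lie outside the ball, and the product of their lifts
measures the tangency. -/
lemma tangent_segment {v w z : E4} (hz : z ∈ segment ℝ v w) (hz1 : ‖z‖ = 1)
    (hv : inner ℝ z v = 1) (hw : inner ℝ z w = 1) :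
    1 ≤ ‖v‖ ∧ 1 ≤ ‖w‖ ∧
      inner ℝ v w - 1 = -(Real.sqrt (‖v‖ ^ 2 - 1) * Real.sqrt (‖w‖ ^ 2 - 1)) := by
  obtain ⟨a, b, ha, hb, hab, rfl⟩ := hz
  have h1 : 1 ≤ ‖v‖ := by
    have := real_inner_le_norm (a • v + b • w) v
    rwa [hz1, hv, one_mul] at this
  have h2 : 1 ≤ ‖w‖ := by
    have := real_inner_le_norm (a • v + b • w) w
    rwa [hz1, hw, one_mul] at this
  refine ⟨h1, h2, ?_⟩
  set p := ‖v‖ ^ 2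
  set q := ‖w‖ ^ 2
  set c : ℝ := inner ℝ v w
  have hv' : a * p + b * c = 1 := by
    rw [← hv, inner_add_left, real_inner_smul_left, real_inner_smul_left,
      real_inner_self_eq_norm_sq, real_inner_comm]
  have hw' : a * c + b * q = 1 := by
    rw [← hw, inner_add_left, real_inner_smul_left, real_inner_smul_left,
      real_inner_self_eq_norm_sq]
  have hp : 0 ≤ p - 1 := by simp only [p]; nlinarith
  have hq : 0 ≤ q - 1 := by simp only [q]; nlinarith
  have e1 : a * (p - 1) = b * (1 - c) := by linear_combination hv' - hab
  have e2 : b * (q - 1) = a * (1 - c) := by linear_combination hw' - hab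
  -- This selects the sign of the square root: adding `e1` and `e2` exhibits `1 - c` as a sum of
  -- nonnegative terms.
  have hc : 0 ≤ 1 - c := by
    by_contra! hneg
    have h3 : b * (1 - c) ≤ 0 := mul_nonpos_of_nonneg_of_nonpos hb hneg.le
    have h4 : a * (1 - c) ≤ 0 := mul_nonpos_of_nonneg_of_nonpos ha hneg.le
    have h5 := mul_nonneg ha hp
    have h6 := mul_nonneg hb hq
    have h7 : a * (1 - c) + b * (1 - c) = 1 - c := by rw [← add_mul, hab, one_mul]
    linarith
  -- The equations `e1` and `e2` give this identity up to the factor `a * b`, so tangency at an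
  -- endpoint needs its own argument.
  have hsq : (1 - c) ^ 2 = (p - 1) * (q - 1) := by
    by_cases hb0 : b = 0
    · have ha1 : a = 1 := by linarith
      subst hb0; subst ha1
      have : p - 1 = 0 := by linarith
      have h0 : 1 - c = 0 := by linarith
      rw [this, h0]; ring
    · by_cases ha0 : a = 0
      · have hb1 : b = 1 := by linarith
        subst ha0; subst hb1
        have : q - 1 = 0 := by linarith
        have h0 : 1 - c = 0 := by linarith
        rw [this, h0]; ring
      · have : a * b * ((1 - c) ^ 2 - (p - 1) * (q - 1)) = 0 := by
          linear_combination (-(b * (q - 1))) * e1 - b * (1 - c) * e2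
        rcases mul_eq_zero.1 this with h | h
        · rcases mul_eq_zero.1 h with h | h <;> contradiction
        · linarith
  rw [← Real.sqrt_mul hp, ← hsq, Real.sqrt_sq hc]
  ring

/-- An endpoint on the sphere has a null lift and makes the product zero; two endpoints off the
sphere have unit lifts with product `-1`. Writing the product as minus the product of the two norms
covers all cases without division. -/
lemma lor_lift_tangent {v w z : E4} (hz : z ∈ segment ℝ v w) (hz1 : ‖z‖ = 1)
    (hv : inner ℝ z v = 1) (hw : inner ℝ z w = 1) :
    (lor (lift v) (lift v) = 0 ∨ lor (lift v) (lift v) = 1) ∧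
      lor (lift v) (lift w) = -(lor (lift v) (lift v) * lor (lift w) (lift w)) := by
  obtain ⟨h1, h2, h3⟩ := tangent_segment hz hz1 hv hw
  have null : ∀ u : E4, ‖u‖ = 1 → lor (lift u) (lift u) = 0 := by
    intro u hu
    simp [lift, hu, lor_apply]
  have ne : ∀ u : E4, 1 < ‖u‖ → Real.sqrt (‖u‖ ^ 2 - 1) ≠ 0 := fun u hu =>
    (Real.sqrt_pos.2 (by nlinarith)).ne'
  have null' : ‖v‖ = 1 ∨ ‖w‖ = 1 → lor (lift v) (lift w) = 0 := by
    intro h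
    obtain ⟨c, -, hc⟩ := lift_eq v
    obtain ⟨d, -, hd⟩ := lift_eq w
    have h0 : inner ℝ v w - 1 = 0 := by
      rw [h3]
      rcases h with h | h <;> simp [h]
    rw [hc, hd]
    simp only [map_smul, LinearMap.smul_apply, smul_eq_mul, lor_apply, mul_one, h0, mul_zero]
  refine ⟨h1.eq_or_lt.imp (fun h => null v h.symm) lor_lift_self, ?_⟩
  rcases h1.eq_or_lt with hv1 | hv1
  · rw [null v hv1.symm, null' (Or.inl hv1.symm)]; ring
  rcases h2.eq_or_lt with hw1 | hw1
  · rw [null w hw1.symm, null' (Or.inr hw1.symm)]; ring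
  rw [lor_lift_self hv1, lor_lift_self hw1, lor_lift_of_lt hv1 hw1, h3]
  have := ne v hv1
  have := ne w hw1
  field_simp

/-- Two vertices of an edge-scribed polytope that span a face span a tangent edge. -/
lemma IsEdgeScribed.lor_edge {Q : Set E4} (h : IsEdgeScribed Q) {G : Set E4}
    (hG : IsExposed ℝ Q G) {x y : E4} (hx : x ∈ vertices Q) (hy : y ∈ vertices Q) (hxy : x ≠ y)
    (hv : ∀ z ∈ vertices Q, z ∈ G ↔ z = x ∨ z = y) :
    (lor (lift x) (lift x) = 0 ∨ lor (lift x) (lift x) = 1) ∧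
      lor (lift x) (lift y) = -(lor (lift x) (lift x) * lor (lift y) (lift y)) := by
  have hGe : G = segment ℝ x y := by
    rw [h.1.isFiniteHull.face_eq hG, ← convexHull_pair]
    congr 1
    ext z
    constructor
    · rintro ⟨hz, hzv⟩
      exact (hv z hzv).1 hz
    · rintro (rfl | rfl)
      · exact ⟨(hv _ hx).2 (Or.inl rfl), hx⟩
      · exact ⟨(hv _ hy).2 (Or.inr rfl), hy⟩
  have hdim : Module.finrank ℝ (vectorSpan ℝ G) = 1 := by
    rw [hGe, ← convexHull_pair, ← direction_affineSpan, affineSpan_convexHull,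
      direction_affineSpan, vectorSpan_pair, finrank_span_singleton]
    exact vsub_ne_zero.2 hxy
  have hxG : x ∈ G := (hv x hx).2 (Or.inl rfl)
  have hyG : y ∈ G := (hv y hy).2 (Or.inr rfl)
  obtain ⟨z, hz, hz1, hzi⟩ := h.2 G ⟨hG, ⟨x, hxG⟩, hdim⟩
  exact lor_lift_tangent (hGe ▸ hz) hz1 (hzi x hxG) (hzi y hyG)

/-- A nonempty exposed face is cut out by a linear functional on Lorentzian lifts. -/
lemma exists_functional {Q G : Set E4} (hG : IsExposed ℝ Q G) (hne : G.Nonempty) :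
    ∃ L : M5 →ₗ[ℝ] ℝ, ∀ v ∈ Q, 0 ≤ L (lift v) ∧ (L (lift v) = 0 ↔ v ∈ G) := by
  obtain ⟨w, hw⟩ := hne
  obtain ⟨l, hl⟩ := hG ⟨w, hw⟩
  have hw' := hw
  rw [hl] at hw'
  refine ⟨(l w) • LinearMap.snd ℝ E4 ℝ - l.toLinearMap ∘ₗ LinearMap.fst ℝ E4 ℝ, fun v hv => ?_⟩
  obtain ⟨c, hc, hcv⟩ := lift_eq v
  have hval : ((l w) • LinearMap.snd ℝ E4 ℝ - l.toLinearMap ∘ₗ LinearMap.fst ℝ E4 ℝ) (lift v) =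
      c * (l w - l v) := by
    rw [hcv]
    simp
    ring
  rw [hval]
  have hle := hw'.2 v hv
  refine ⟨mul_nonneg hc.le (by linarith), ?_⟩
  rw [mul_eq_zero, or_iff_right hc.ne', hl]
  constructor
  · intro h
    exact ⟨hv, fun y hy => by have := hw'.2 y hy; linarith⟩
  · intro h
    have := h.2 w hw'.1
    linarith

/-- An isomorphism of face lattices induces a bijection of vertices; composing it with `lift`
carries the metric data of the edge-scribed realization back to `Q`. From here on only `Scribing` is
used. -/
lemma IsEdgeScribable.exists_scribing {Q : Set E4} (hQ : IsFiniteHull Q) (h : IsEdgeScribable Q) :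
    ∃ W, Scribing Q ∅ W := by
  obtain ⟨Q', hQ', ⟨Φ⟩⟩ := h
  have hfin := hQ'.1.isFiniteHull
  obtain ⟨ν, hν, hνF, hνs⟩ := exists_vertexMap hQ hfin Φ
  have hmem : ∀ x ∈ vertices Q, ∀ S (hS : IsExposed ℝ Q S), ν x ∈ (Φ ⟨S, hS⟩).1 ↔ x ∈ S :=
    fun x hx S hS => hνF x hx ⟨S, hS⟩
  have hinj : ∀ x ∈ vertices Q, ∀ y ∈ vertices Q, ν x = ν y → x = y := by
    intro x hx y hy hxy
    have h1 := (hmem y hy {y} (hQ.isExposed_singleton_iff.2 hy)).2 rfl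
    rw [← hxy, hmem x hx] at h1
    exact h1
  refine ⟨fun x => lift (ν x), ⟨fun x _ => ?_, fun S hS hne _ => ?_, ?_⟩⟩
  · obtain ⟨c, hc, hcv⟩ := lift_eq (ν x)
    simpa [hcv] using hc
  · obtain ⟨L, hL⟩ := exists_functional (Φ ⟨S, hS⟩).2 ((orderIso_nonempty Φ ⟨S, hS⟩).2 hne)
    refine ⟨L, fun x hx => ?_⟩
    rw [← hmem x hx S hS]
    exact hL _ (hν x hx).1
  · intro S hS _ x hx y hy hxy hz
    refine hQ'.lor_edge (Φ ⟨S, hS⟩).2 (hν x hx) (hν y hy) (fun h => hxy (hinj x hx y hy h)) ?_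
    intro z' hz'
    obtain ⟨z, hzv, rfl⟩ := hνs z' hz'
    rw [hmem z hzv, hz z hzv]
    exact ⟨fun h => h.imp (congrArg ν) (congrArg ν),
      fun h => h.imp (hinj z hzv x hx) (hinj z hzv y hy)⟩

/-! ### Rigidity of tangent configurations in Lorentz space -/

/-- The vector `u.2 • d - d.2 • u` has no time component, and its squared length is `u.2 ^ 2 * lor d
d`. So the form is semidefinite on the complement of a null vector, with only the multiples of that
vector in its radical. -/
lemma lor_null_perp {u d : M5} (hu : lor u u = 0) (hpos : 0 < u.2) (hd : lor d u = 0) :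
    0 ≤ lor d d ∧ (lor d d = 0 → u.2 • d = d.2 • u) := by
  simp only [lor_apply, real_inner_self_eq_norm_sq] at *
  have key : ‖u.2 • d.1 - d.2 • u.1‖ ^ 2 = u.2 ^ 2 * (‖d.1‖ ^ 2 - d.2 * d.2) := by
    rw [norm_sub_sq_real, norm_smul, norm_smul, real_inner_smul_left, real_inner_smul_right,
      mul_pow, mul_pow, Real.norm_eq_abs, Real.norm_eq_abs, sq_abs, sq_abs]
    linear_combination d.2 ^ 2 * hu - 2 * u.2 * d.2 * hd
  constructor
  · have h1 : 0 ≤ u.2 ^ 2 * (‖d.1‖ ^ 2 - d.2 * d.2) := key ▸ sq_nonneg _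
    exact nonneg_of_mul_nonneg_right h1 (by positivity)
  · intro h
    rw [h, mul_zero, sq_eq_zero_iff, norm_eq_zero, sub_eq_zero] at key
    exact Prod.ext key (by simp [mul_comm])

/-- In the orthogonal complement of a null vector `u` and a vector not orthogonal to `u`, the
Lorentz form is definite. -/
lemma eq_zero_of_perp {u c d : M5} (hu : lor u u = 0) (hpos : 0 < u.2) (hc : lor u c ≠ 0)
    (hdu : lor d u = 0) (hdc : lor d c = 0) (hd : lor d d = 0) : d = 0 := by
  have h := (lor_null_perp hu hpos hdu).2 hd
  have h1 : d.2 * lor u c = 0 := by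
    have := congrArg (fun t => lor t c) h
    simp only [map_smul, LinearMap.smul_apply, smul_eq_mul, hdc, mul_zero] at this
    exact this.symm
  have h2 : d.2 = 0 := (mul_eq_zero.1 h1).resolve_right hc
  rw [h2, zero_smul] at h
  exact (smul_eq_zero.1 h).resolve_left hpos.ne'

/-- Two null vectors in the same nappe of the cone are parallel if they are orthogonal. -/
lemma eq_smul_of_null {u d : M5} (hu : lor u u = 0) (hpos : 0 < u.2) (hd0 : 0 < d.2)
    (hdu : lor d u = 0) (hd : lor d d = 0) : ∃ s : ℝ, 0 < s ∧ d = s • u := by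
  have h := (lor_null_perp hu hpos hdu).2 hd
  refine ⟨d.2 / u.2, by positivity, ?_⟩
  rw [div_eq_inv_mul, mul_smul, ← h, smul_smul, inv_mul_cancel₀ hpos.ne', one_smul]

/-- Three vectors with unit norm whose first and last pair are tangent. -/
structure IsTangentPath (a b c : M5) : Prop where
  aa : lor a a = 1
  bb : lor b b = 1
  cc : lor c c = 1
  ab : lor a b = -1
  bc : lor b c = -1
  ac : lor a c ≤ -1
  posa : 0 < a.2
  posb : 0 < b.2

namespace IsTangentPath

variable {a b c : M5} (h : IsTangentPath a b c)
include h

/-- The sum of two tangent unit vectors points to the place where the edge touches the sphere. -/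
lemma null : lor (a + b) (a + b) = 0 := by
  simp only [map_add, LinearMap.add_apply, h.aa, h.bb, h.ab, lor_comm b a]
  norm_num

lemma pos : 0 < (a + b).2 := add_pos h.posa h.posb

/-- The outer product is only required to be at most `-1` so that paths in triangular ridges, where
it equals `-1`, and in square ridges, where the ends are opposite corners, are treated alike. -/
lemma ne : lor (a + b) c ≠ 0 := by
  simp only [map_add, LinearMap.add_apply, h.bc]
  have := h.ac
  linarith

/-- The span of the path contains the null vector `a + b` and a vector `c` not orthogonal to it, so
its complement is definite. -/
lemma eq_zero {d : M5} (ha : lor d a = 0) (hb : lor d b = 0) (hc : lor d c = 0)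
    (hd : lor d d = 0) : d = 0 :=
  eq_zero_of_perp h.null h.pos h.ne (by simp [ha, hb]) hc hd

end IsTangentPath

/-- Lorentz space has dimension five. The rigidity arguments below take a relation of this kind
among six well-chosen vectors and pair it with vectors or functionals until most coefficients
vanish. -/
lemma exists_relation (a b c d e f : M5) : ∃ x₁ x₂ x₃ x₄ x₅ x₆ : ℝ,
    x₁ • a + x₂ • b + x₃ • c + x₄ • d + x₅ • e + x₆ • f = 0 ∧
      ¬(x₁ = 0 ∧ x₂ = 0 ∧ x₃ = 0 ∧ x₄ = 0 ∧ x₅ = 0 ∧ x₆ = 0) := by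
  have hnot : ¬ LinearIndependent ℝ ![a, b, c, d, e, f] := by
    intro h
    have := h.fintype_card_le_finrank
    simp at this
  obtain ⟨g, hg, i, hi⟩ := Fintype.not_linearIndependent_iff.1 hnot
  refine ⟨g 0, g 1, g 2, g 3, g 4, g 5, ?_, ?_⟩
  · simpa [Fin.sum_univ_succ, add_assoc] using hg
  · rintro ⟨h0, h1, h2, h3, h4, h5⟩
    fin_cases i <;> contradiction

/-- Three vectors in the plane orthogonal to a tangent path, with equal norms and equal
consecutive products. -/
lemma planar_reflection {a b c k₀ k₁ k₂ : M5} {κ κ' : ℝ} (h : IsTangentPath a b c)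
    (h0a : lor k₀ a = 0) (h0b : lor k₀ b = 0) (h0c : lor k₀ c = 0)
    (h1a : lor k₁ a = 0) (h1b : lor k₁ b = 0) (h1c : lor k₁ c = 0)
    (h2a : lor k₂ a = 0) (h2b : lor k₂ b = 0) (h2c : lor k₂ c = 0)
    (h00 : lor k₀ k₀ = κ) (h11 : lor k₁ k₁ = κ) (h22 : lor k₂ k₂ = κ)
    (h01 : lor k₀ k₁ = κ') (h12 : lor k₁ k₂ = κ') (hκ : 0 < κ) (hκ' : κ' ^ 2 < κ ^ 2) :
    k₂ = k₀ ∨ k₂ = (2 * κ' / κ) • k₁ - k₀ := by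
  obtain ⟨α, β, γ, x, y, z, hrel, hnz⟩ := exists_relation a b c k₀ k₁ k₂
  -- By the relation, `d` lies both in the span of the path and in its complement, hence it is null
  -- and vanishes. It remains to see that the relation involves the `k`'s alone.
  set d := x • k₀ + y • k₁ + z • k₂ with hd
  have hd' : d = -(α • a + β • b + γ • c) := by
    rw [eq_neg_iff_add_eq_zero, ← hrel, hd]; abel
  have hda : lor d a = 0 := by simp [hd, h0a, h1a, h2a]
  have hdb : lor d b = 0 := by simp [hd, h0b, h1b, h2b]
  have hdc : lor d c = 0 := by simp [hd, h0c, h1c, h2c]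
  have hdd : lor d d = 0 := by
    have : lor d d = lor d (-(α • a + β • b + γ • c)) := by rw [← hd']
    rw [this, map_neg, map_add, map_add, map_smul, map_smul, map_smul, hda, hdb, hdc]
    simp
  have hd0 := h.eq_zero hda hdb hdc hdd
  have hk : ∀ u : M5, lor u k₀ * x + lor u k₁ * y + lor u k₂ * z = 0 := by
    intro u
    have := congrArg (lor u) hd0
    simp only [hd, map_add, map_smul, smul_eq_mul, map_zero] at this
    linarith
  have habc : α • a + β • b + γ • c = 0 := by
    rw [hd0] at hd'
    exact neg_eq_zero.1 hd'.symm
  have hg : ∀ u : M5, lor u a * α + lor u b * β + lor u c * γ = 0 := by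
    intro u
    have := congrArg (lor u) habc
    simp only [map_add, map_smul, smul_eq_mul, map_zero] at this
    linarith
  have ga := hg a
  have gb := hg b
  have gc := hg c
  rw [lor_comm b a] at gb
  rw [lor_comm c a, lor_comm c b] at gc
  rw [h.aa, h.ab] at ga
  rw [h.ab, h.bb, h.bc] at gb
  rw [h.bc, h.cc] at gc
  set t := lor a c
  have ht : t ≤ -1 := h.ac
  -- The Gram matrix of the path is nondegenerate because `t ≠ 1`, so `α`, `β` and `γ` vanish.
  have hβ : β = α + γ := by linarith
  have hγ : γ = 0 := by
    have : (t - 1) * γ = 0 := by rw [hβ] at ga; linarith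
    exact (mul_eq_zero.1 this).resolve_left (by linarith)
  have hα : α = 0 := by
    have : (t - 1) * α = 0 := by rw [hβ] at gc; linarith
    exact (mul_eq_zero.1 this).resolve_left (by linarith)
  have hβ0 : β = 0 := by rw [hβ, hα, hγ, add_zero]
  have e0 := hk k₀
  have e1 := hk k₁
  have e2 := hk k₂
  rw [lor_comm k₁ k₀] at e1
  rw [lor_comm k₂ k₀, lor_comm k₂ k₁] at e2
  rw [h00, h01] at e0
  rw [h01, h11, h12] at e1
  rw [h12, h22] at e2
  -- The vectors `k₀` and `k₁` are independent, their Gram determinant being `κ ^ 2 - κ' ^ 2`.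
  have hz : z ≠ 0 := by
    rintro rfl
    have hx : (κ ^ 2 - κ' ^ 2) * x = 0 := by linear_combination κ * e0 - κ' * e1
    have hy : (κ ^ 2 - κ' ^ 2) * y = 0 := by linear_combination κ * e1 - κ' * e0
    have hne : κ ^ 2 - κ' ^ 2 ≠ 0 := by linarith
    exact hnz ⟨hα, hβ0, hγ, (mul_eq_zero.1 hx).resolve_left hne,
      (mul_eq_zero.1 hy).resolve_left hne, rfl⟩
  have hk2 : k₂ = (-(x / z)) • k₀ + (-(y / z)) • k₁ := by
    have : z • k₂ = -(x • k₀ + y • k₁) := by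
      rw [eq_neg_iff_add_eq_zero, ← hd0, hd]; abel
    rw [← inv_smul_smul₀ hz k₂, this, smul_neg, smul_add, smul_smul, smul_smul, neg_smul,
      neg_smul, div_eq_inv_mul, div_eq_inv_mul, neg_add]
  set X := -(x / z)
  set Y := -(y / z)
  have f1 : X * κ' + Y * κ = κ' := by
    have := h12
    rw [hk2] at this
    simpa only [map_add, map_smul, smul_eq_mul, lor_comm k₁ k₀, h01, h11] using this
  have f2 : X ^ 2 * κ + 2 * X * Y * κ' + Y ^ 2 * κ = κ := by
    have := h22
    rw [hk2] at this
    simp only [map_add, map_smul, smul_eq_mul, lor_comm k₁ k₀, h01, h11, h00,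
      LinearMap.add_apply, LinearMap.smul_apply] at this
    linarith
  -- This eliminates `Y`. The root `X = 1` gives `k₀` itself and `X = -1` its mirror image in the
  -- line of `k₁`.
  have f3 : (X - 1) * (X + 1) * (κ ^ 2 - κ' ^ 2) = 0 := by
    linear_combination κ * f2 - (Y * κ + X * κ' + κ') * f1
  have hne : κ ^ 2 - κ' ^ 2 ≠ 0 := by linarith
  rcases mul_eq_zero.1 ((mul_eq_zero.1 f3).resolve_right hne) with hX | hX
  · left
    have hX : X = 1 := by linarith
    have hY : Y = 0 := by
      have : Y * κ = 0 := by rw [hX] at f1; linarith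
      exact (mul_eq_zero.1 this).resolve_right hκ.ne'
    rw [hk2, hX, hY]; simp
  · right
    have hX : X = -1 := by linarith
    have hY : Y = 2 * κ' / κ := by
      rw [eq_div_iff hκ.ne']
      rw [hX] at f1; linarith
    rw [hk2, hX, hY, neg_one_smul]; abel

/-- Opposite vertices of a tangent cross-polytope are not both tangent to the same null
direction. -/
lemma antipode_ne {a a' b c : M5} (ha : lor a a = 1) (hb : lor b b = 1)
    (hc : lor c c = 1) (ha' : lor a' a' = 1) (hab : lor a b = -1) (hac : lor a c = -1)
    (hbc : lor b c = -1) (hab' : lor a' b = -1) (hac' : lor a' c = -1) (hpa : 0 < a.2)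
    (hpb : 0 < b.2) (hne : a ≠ a') : lor a a' ≠ 1 := by
  intro h
  apply hne
  rw [← sub_eq_zero]
  -- If the product were `1`, then `a - a'` would be null and orthogonal to the path `a`, `b`, `c`.
  have hT : IsTangentPath a b c := ⟨ha, hb, hc, hab, hbc, hac.le, hpa, hpb⟩
  apply hT.eq_zero <;>
  simp only [map_sub, LinearMap.sub_apply, ha, ha', hab, hac, hab', hac', h, lor_comm a' a] <;>
  norm_num

/-- The vertices of a flat tangent octahedron form a regular octahedron. -/
lemma octahedron_rigid {a a' b b' c c' y : M5} {L : M5 →ₗ[ℝ] ℝ}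
    (ha : lor a a = 1) (ha' : lor a' a' = 1) (hb : lor b b = 1) (hb' : lor b' b' = 1)
    (hc : lor c c = 1) (hc' : lor c' c' = 1)
    (hab : lor a b = -1) (hab' : lor a b' = -1) (ha'b : lor a' b = -1) (ha'b' : lor a' b' = -1)
    (hac : lor a c = -1) (hac' : lor a c' = -1) (ha'c : lor a' c = -1) (ha'c' : lor a' c' = -1)
    (hbc : lor b c = -1) (hbc' : lor b c' = -1) (hb'c : lor b' c = -1) (hb'c' : lor b' c' = -1)
    (hpa : 0 < a.2) (hpb : 0 < b.2) (hpc : 0 < c.2)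
    (hna : a ≠ a') (hnb : b ≠ b') (hnc : c ≠ c')
    (hLa : L a = 0) (hLa' : L a' = 0) (hLb : L b = 0) (hLb' : L b' = 0) (hLc : L c = 0)
    (hLc' : L c' = 0) (hLy : L y ≠ 0) : a + a' = b + b' := by
  have ba := lor_comm b a
  have ba' := lor_comm b a'
  have b'a := lor_comm b' a
  have b'a' := lor_comm b' a'
  have ca := lor_comm c a
  have ca' := lor_comm c a'
  have c'a := lor_comm c' a
  have c'a' := lor_comm c' a'
  have cb := lor_comm c b
  have cb' := lor_comm c b'
  have c'b := lor_comm c' b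
  have c'b' := lor_comm c' b'
  have na := antipode_ne ha hb hc ha' hab hac hbc ha'b ha'c hpa hpb hna
  have nb := antipode_ne hb ha hc hb' (ba.trans hab) hbc hac (b'a.trans hab') hb'c hpb hpa hnb
  have nc := antipode_ne hc ha hb hc' (ca.trans hac) (cb.trans hbc) hab (c'a.trans hac')
    (c'b.trans hbc') hpc hpa hnc
  -- Flatness is used only to remove the coefficient of `y`, which lies off the hyperplane of the
  -- octahedron. The differences are mutually orthogonal, orthogonal to the sums and not null, so
  -- the relation is between the two sums; pairing it with `c` shows that its coefficients are
  -- opposite.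
  obtain ⟨x, y', z, s, t, v, hrel, hnz⟩ :=
    exists_relation (a - a') (b - b') (c - c') (a + a') (b + b') y
  have hv : v = 0 := by
    have := congrArg L hrel
    simp only [map_add, map_smul, map_sub, hLa, hLa', hLb, hLb', hLc, hLc', smul_eq_mul,
      map_zero] at this
    ring_nf at this
    exact (mul_eq_zero.1 this).resolve_right hLy
  rw [hv, zero_smul, add_zero] at hrel
  have key : ∀ u, x * lor u (a - a') + y' * lor u (b - b') + z * lor u (c - c') +
      s * lor u (a + a') + t * lor u (b + b') = 0 := by
    intro u
    have := congrArg (lor u) hrel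
    simpa only [map_add, map_smul, smul_eq_mul, map_zero] using this
  have hx : x = 0 := by
    have := key (a - a')
    simp only [map_sub, map_add, LinearMap.sub_apply, lor_comm a' a, ha, ha', hab, hab', ha'b,
      ha'b', hac, hac', ha'c, ha'c'] at this
    have h2 : x * (1 - lor a a') = 0 := by linarith
    exact (mul_eq_zero.1 h2).resolve_right (sub_ne_zero.2 (Ne.symm na))
  have hy : y' = 0 := by
    have := key (b - b')
    simp only [map_sub, map_add, LinearMap.sub_apply, lor_comm b' b, hb, hb', ba, ba', b'a, b'a',
      hab, hab', ha'b, ha'b', hbc, hbc', hb'c, hb'c'] at this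
    have h2 : y' * (1 - lor b b') = 0 := by linarith
    exact (mul_eq_zero.1 h2).resolve_right (sub_ne_zero.2 (Ne.symm nb))
  have hz : z = 0 := by
    have := key (c - c')
    simp only [map_sub, map_add, LinearMap.sub_apply, lor_comm c' c, hc, hc', ca, ca', c'a, c'a',
      cb, cb', c'b, c'b', hac, hac', ha'c, ha'c', hbc, hbc', hb'c, hb'c'] at this
    have h2 : z * (1 - lor c c') = 0 := by linarith
    exact (mul_eq_zero.1 h2).resolve_right (sub_ne_zero.2 (Ne.symm nc))
  have hst : s + t = 0 := by
    have := key c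
    simp only [hx, hy, hz, map_add, ca, ca', cb, cb', hac, ha'c, hbc, hb'c] at this
    linarith
  have hs : s ≠ 0 := by
    rintro rfl
    exact hnz ⟨hx, hy, hz, rfl, by linarith, hv⟩
  have ht : t = -s := by linarith
  rw [hx, hy, hz, ht] at hrel
  have : s • ((a + a') - (b + b')) = 0 := by
    rw [smul_sub, ← hrel, neg_smul]; simp [sub_eq_add_neg]
  exact sub_eq_zero.1 ((smul_eq_zero.1 this).resolve_left hs)

/-- The vertices of a tangent orthoplex form a regular orthoplex. -/
lemma orthoplex_rigid (v v' : Fin 4 → M5) (hv : ∀ i, lor (v i) (v i) = 1)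
    (hv' : ∀ i, lor (v' i) (v' i) = 1) (h : ∀ i j, i ≠ j → lor (v i) (v j) = -1)
    (h' : ∀ i j, i ≠ j → lor (v' i) (v' j) = -1) (hvv' : ∀ i j, i ≠ j → lor (v i) (v' j) = -1)
    (hpos : ∀ i, 0 < (v i).2) (hne : ∀ i, v i ≠ v' i) (i : Fin 4) : lor (v i) (v' i) = -3 := by
  have hv'v : ∀ i j, i ≠ j → lor (v' i) (v j) = -1 := fun i j hij => by
    rw [lor_comm]; exact hvv' j i hij.symm
  have hother : ∀ i : Fin 4, ∃ j k : Fin 4, i ≠ j ∧ i ≠ k ∧ j ≠ k := by decide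
  have hn : ∀ i, lor (v i) (v' i) ≠ 1 := by
    intro i
    obtain ⟨j, k, hij, hik, hjk⟩ := hother i
    exact antipode_ne (hv i) (hv j) (hv k) (hv' i) (h i j hij) (h i k hik) (h j k hjk)
      (hv'v i j hij) (hv'v i k hik) (hpos i) (hpos j) (hne i)
  obtain ⟨j, k, hij, hik, hjk⟩ := hother i
  -- Four diagonal differences and two diagonal sums make six vectors, so no flat facet is needed.
  -- As for the octahedron, the relation forces two diagonals to have the same sum, and pairing with
  -- `v i` gives the value `-3`.
  obtain ⟨x₀, x₁, x₂, x₃, s, t, hrel, hnz⟩ :=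
    exists_relation (v 0 - v' 0) (v 1 - v' 1) (v 2 - v' 2) (v 3 - v' 3) (v i + v' i) (v j + v' j)
  let x : Fin 4 → ℝ := ![x₀, x₁, x₂, x₃]
  have hrel' : ∑ m, x m • (v m - v' m) + s • (v i + v' i) + t • (v j + v' j) = 0 := by
    rw [← hrel]
    simp [Fin.sum_univ_four, x]
  have key : ∀ u, ∑ m, x m * lor u (v m - v' m) + s * lor u (v i + v' i) +
      t * lor u (v j + v' j) = 0 := by
    intro u
    have := congrArg (lor u) hrel'
    simpa only [map_add, map_smul, smul_eq_mul, map_zero, map_sum] using this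
  have hds : ∀ m l, lor (v m - v' m) (v l + v' l) = 0 := by
    intro m l
    simp only [map_sub, map_add, LinearMap.sub_apply]
    by_cases hml : m = l
    · subst hml
      rw [hv, hv', lor_comm (v' m)]; ring
    · rw [h m l hml, hvv' m l hml, hv'v m l hml, h' m l hml]; ring
  have hdd : ∀ m l, m ≠ l → lor (v m - v' m) (v l - v' l) = 0 := by
    intro m l hml
    simp only [map_sub, LinearMap.sub_apply]
    rw [h m l hml, hvv' m l hml, hv'v m l hml, h' m l hml]; ring
  have hx : ∀ m, x m = 0 := by
    intro m
    have := key (v m - v' m)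
    rw [hds, hds, mul_zero, mul_zero, add_zero, add_zero, Finset.sum_eq_single m] at this
    · simp only [map_sub, LinearMap.sub_apply, hv, hv', lor_comm (v' m) (v m)] at this
      have h2 : x m * (1 - lor (v m) (v' m)) = 0 := by linarith
      exact (mul_eq_zero.1 h2).resolve_right (sub_ne_zero.2 (Ne.symm (hn m)))
    · intro l _ hlm
      rw [hdd m l hlm.symm, mul_zero]
    · simp
  simp only [hx, zero_smul, zero_mul, Finset.sum_const_zero, zero_add] at hrel' key
  have hst : s + t = 0 := by
    have := key (v k)
    simp only [map_add, h k i hik.symm, h k j hjk.symm, hvv' k i hik.symm,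
      hvv' k j hjk.symm] at this
    linarith
  have hs : s ≠ 0 := by
    rintro rfl
    exact hnz ⟨hx 0, hx 1, hx 2, hx 3, rfl, by linarith⟩
  have := key (v i)
  simp only [map_add, hv, h i j hij, hvv' i j hij] at this
  have ht : t = -s := by linarith
  rw [ht] at this
  have h3 : s * (lor (v i) (v' i) + 3) = 0 := by linarith
  have := (mul_eq_zero.1 h3).resolve_left hs
  linarith

/-! ### Flat quadrilaterals and flat cubes -/

/-- The diagonals of a convex quadrilateral cross. -/
lemma square_relation {e₁ e₂ o₁ o₂ x y : M5} {L G L₁₁ L₁₂ L₂₁ : M5 →ₗ[ℝ] ℝ}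
    (hLe₁ : L e₁ = 0) (hLe₂ : L e₂ = 0) (hLo₁ : L o₁ = 0) (hLo₂ : L o₂ = 0) (hLx : L x ≠ 0)
    (hGe₁ : G e₁ = 0) (hGe₂ : G e₂ = 0) (hGo₁ : G o₁ = 0) (hGo₂ : G o₂ = 0) (hGx : G x = 0)
    (hGy : G y ≠ 0)
    (h₁₁ : L₁₁ e₁ = 0 ∧ L₁₁ o₁ = 0 ∧ 0 < L₁₁ e₂ ∧ 0 < L₁₁ o₂)
    (h₁₂ : L₁₂ e₁ = 0 ∧ L₁₂ o₂ = 0 ∧ 0 < L₁₂ e₂ ∧ 0 < L₁₂ o₁)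
    (h₂₁ : L₂₁ e₂ = 0 ∧ L₂₁ o₁ = 0 ∧ 0 < L₂₁ e₁ ∧ 0 < L₂₁ o₂) :
    ∃ p q r s : ℝ, 0 < p ∧ 0 < q ∧ 0 < r ∧ 0 < s ∧ p • e₁ + q • e₂ = r • o₁ + s • o₂ := by
  -- Here `x` is in the facet but off the square, and `y` is off the facet. `G` removes `y` and then
  -- `L` removes `x`, leaving a relation among the four corners.
  obtain ⟨a, b, c, d, f, g, hrel, hnz⟩ := exists_relation e₁ e₂ o₁ o₂ x y
  have app : ∀ T : M5 →ₗ[ℝ] ℝ,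
      a * T e₁ + b * T e₂ + c * T o₁ + d * T o₂ + f * T x + g * T y = 0 := by
    intro T
    have := congrArg T hrel
    simpa only [map_add, map_smul, smul_eq_mul, map_zero] using this
  have hg : g = 0 := by
    have := app G
    simp only [hGe₁, hGe₂, hGo₁, hGo₂, hGx, mul_zero, zero_add] at this
    exact (mul_eq_zero.1 this).resolve_right hGy
  subst hg
  have hf : f = 0 := by
    have := app L
    simp only [hLe₁, hLe₂, hLo₁, hLo₂, zero_mul, mul_zero, zero_add, add_zero] at this
    exact (mul_eq_zero.1 this).resolve_right hLx
  subst hf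
  have r₁₁ := app L₁₁
  have r₁₂ := app L₁₂
  have r₂₁ := app L₂₁
  rw [h₁₁.1, h₁₁.2.1] at r₁₁
  rw [h₁₂.1, h₁₂.2.1] at r₁₂
  rw [h₂₁.1, h₂₁.2.1] at r₂₁
  have sgn : ∀ {u v p q : ℝ}, 0 < p → 0 < q → u * p + v * q = 0 → (0 < u → v < 0) ∧
      (u < 0 → 0 < v) ∧ (u = 0 → v = 0) := by
    intro u v p q hp hq h
    refine ⟨fun hu => ?_, fun hu => ?_, fun hu => ?_⟩
    · by_contra! hv
      have := mul_pos hu hp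
      have := mul_nonneg hv hq.le
      linarith
    · by_contra! hv
      have := mul_neg_of_neg_of_pos hu hp
      have := mul_nonpos_of_nonpos_of_nonneg hv hq.le
      linarith
    · rw [hu, zero_mul, zero_add] at h
      exact (mul_eq_zero.1 h).resolve_right hq.ne'
  -- An edge functional vanishes at two adjacent corners and is positive at the other two, so these
  -- other two have coefficients of opposite sign, or both zero.
  have bd := sgn h₁₁.2.2.1 h₁₁.2.2.2 (by linarith : b * L₁₁ e₂ + d * L₁₁ o₂ = 0)
  have bc := sgn h₁₂.2.2.1 h₁₂.2.2.2 (by linarith : b * L₁₂ e₂ + c * L₁₂ o₁ = 0)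
  have da := sgn h₂₁.2.2.2 h₂₁.2.2.1 (by linarith : d * L₂₁ o₂ + a * L₂₁ e₁ = 0)
  have hrel' : a • e₁ + b • e₂ = (-c) • o₁ + (-d) • o₂ := by
    rw [← sub_eq_zero, ← hrel]
    module
  rcases lt_trichotomy b 0 with hb | hb | hb
  · refine ⟨-a, -b, c, d, ?_, by linarith, bc.2.1 hb, bd.2.1 hb, ?_⟩
    · have := da.1 (bd.2.1 hb)
      linarith
    · rw [neg_smul, neg_smul, ← neg_add, hrel']
      module
  · exact absurd ⟨da.2.2 (bd.2.2 hb), hb, bc.2.2 hb, bd.2.2 hb, rfl, rfl⟩ hnz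
  · have h1 := bc.1 hb
    have h2 := bd.1 hb
    exact ⟨a, b, -c, -d, da.2.1 h2, hb, by linarith, by linarith, hrel'⟩

/-- A null vector is not orthogonal to two tangent unit vectors if it is a vertex. -/
lemma false_of_null_perp {v b c : M5} {L : M5 →ₗ[ℝ] ℝ} (hv : lor v v = 0) (hvb : lor v b = 0)
    (hvc : lor v c = 0) (hb : lor b b = 1) (hc : lor c c = 1) (hbc : lor b c = -1)
    (hpv : 0 < v.2) (hpb : 0 < b.2) (hpc : 0 < c.2) (hLv : L v = 0) (hLb : 0 < L b)
    (hLc : 0 < L c) : False := by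
  have hn : lor (b + c) (b + c) = 0 := by
    simp only [map_add, LinearMap.add_apply, hb, hc, hbc, lor_comm c b]
    norm_num
  -- Being null and orthogonal to the null vector `b + c`, the vector `v` is parallel to it; but `L`
  -- vanishes on `v` and is positive on `b + c`.
  have h := (lor_null_perp hn (add_pos hpb hpc) (by simp [hvb, hvc])).2 hv
  have h2 := congrArg L h
  simp only [map_smul, hLv, map_add, smul_eq_mul, mul_zero] at h2
  have := mul_pos hpv (add_pos hLb hLc)
  linarith

/-- Orthogonal null vectors of the same nappe are positive multiples of each other, which a
functional vanishing on only one of them excludes. Geometrically, an edge cannot touch the sphere at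
both of its ends. -/
lemma ne_null_of_tangent {v w : M5} {L : M5 →ₗ[ℝ] ℝ} (hv : lor v v = 0) (hvw : lor v w = 0)
    (hpv : 0 < v.2) (hpw : 0 < w.2) (hLv : L v = 0) (hLw : 0 < L w) : lor w w ≠ 0 := by
  intro hw
  obtain ⟨s, -, hs⟩ := eq_smul_of_null hv hpv hpw (by rw [lor_comm, hvw]) hw
  rw [hs, map_smul, hLv, smul_zero] at hLw
  exact lt_irrefl _ hLw

/-- A vertex of a tangent triangle is not on the sphere. -/
lemma nonnull_of_triangle {v b c : M5} {L : M5 →ₗ[ℝ] ℝ}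
    (hv : lor v v = 0 ∨ lor v v = 1) (hb : lor b b = 0 ∨ lor b b = 1)
    (hc : lor c c = 0 ∨ lor c c = 1) (hvb : lor v b = -(lor v v * lor b b))
    (hvc : lor v c = -(lor v v * lor c c)) (hbc : lor b c = -(lor b b * lor c c))
    (hpv : 0 < v.2) (hpb : 0 < b.2) (hpc : 0 < c.2) (hLv : L v = 0) (hLb : 0 < L b)
    (hLc : 0 < L c) : lor v v = 1 := by
  refine hv.resolve_left fun h0 => ?_
  rw [h0, zero_mul, neg_zero] at hvb hvc
  have hb1 := hb.resolve_left (ne_null_of_tangent h0 hvb hpv hpb hLv hLb)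
  have hc1 := hc.resolve_left (ne_null_of_tangent h0 hvc hpv hpc hLv hLc)
  rw [hb1, hc1, mul_one] at hbc
  exact false_of_null_perp h0 hvb hvc hb1 hc1 hbc hpv hpb hpc hLv hLb hLc

/-- A vertex of a flat tangent quadrilateral is not on the sphere. -/
lemma nonnull_of_square {v u w₁ w₂ : M5} {L : M5 →ₗ[ℝ] ℝ} {p q r s : ℝ}
    (hq : 0 < q)
    (hrel : p • v + q • u = r • w₁ + s • w₂)
    (hv : lor v v = 0 ∨ lor v v = 1) (hu : lor u u = 0 ∨ lor u u = 1)
    (hw₁ : lor w₁ w₁ = 0 ∨ lor w₁ w₁ = 1)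
    (hvw₁ : lor v w₁ = -(lor v v * lor w₁ w₁)) (hvw₂ : lor v w₂ = -(lor v v * lor w₂ w₂))
    (huw₁ : lor u w₁ = -(lor u u * lor w₁ w₁))
    (hpv : 0 < v.2) (hpu : 0 < u.2) (hpw₁ : 0 < w₁.2) (hLv : L v = 0) (hLu : 0 < L u)
    (hLw₁ : 0 < L w₁) : lor v v = 1 := by
  refine hv.resolve_left fun h0 => ?_
  rw [h0, zero_mul, neg_zero] at hvw₁ hvw₂
  have hw1 := hw₁.resolve_left (ne_null_of_tangent h0 hvw₁ hpv hpw₁ hLv hLw₁)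
  have hvu : lor v u = 0 := by
    have := congrArg (lor v) hrel
    simp only [map_add, map_smul, smul_eq_mul, h0, hvw₁, hvw₂, mul_zero, add_zero, zero_add] at this
    exact (mul_eq_zero.1 this).resolve_left hq.ne'
  have hu1 := hu.resolve_left (ne_null_of_tangent h0 hvu hpv hpu hLv hLu)
  rw [hu1, hw1, mul_one] at huw₁
  exact false_of_null_perp h0 hvu hvw₁ hu1 hw1 huw₁ hpv hpu hpw₁ hLv hLu hLw₁

/-- The diagonals of a flat tangent quadrilateral, normalized. -/
lemma square_normalize {e₁ e₂ o₁ o₂ : M5} {p q r s : ℝ} (hp : 0 < p) (hq : 0 < q) (hr : 0 < r)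
    (hs : 0 < s) (hrel : p • e₁ + q • e₂ = r • o₁ + s • o₂)
    (he₁ : lor e₁ e₁ = 1) (he₂ : lor e₂ e₂ = 1) (ho₁ : lor o₁ o₁ = 1) (ho₂ : lor o₂ o₂ = 1)
    (h₁₁ : lor e₁ o₁ = -1) (h₁₂ : lor e₁ o₂ = -1) (h₂₁ : lor e₂ o₁ = -1) (h₂₂ : lor e₂ o₂ = -1) :
    ∃ l : ℝ, 0 < l ∧ e₁ + e₂ = l • (o₁ + o₂) := by
  have app : ∀ u, p * lor u e₁ + q * lor u e₂ = r * lor u o₁ + s * lor u o₂ := by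
    intro u
    have := congrArg (lor u) hrel
    simpa only [map_add, map_smul, smul_eq_mul] using this
  have a1 := app e₁
  have a2 := app e₂
  have a3 := app o₁
  have a4 := app o₂
  rw [lor_comm e₂ e₁] at a2
  rw [lor_comm o₁ e₁, lor_comm o₁ e₂] at a3
  rw [lor_comm o₂ e₁, lor_comm o₂ e₂, lor_comm o₂ o₁] at a4
  rw [he₁, h₁₁, h₁₂] at a1
  rw [he₂, h₂₁, h₂₂] at a2
  rw [h₁₁, h₂₁, ho₁] at a3
  rw [h₁₂, h₂₂, ho₂] at a4
  -- The diagonals do not have product `1`: otherwise `a1` would equate the positive number `p + q`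
  -- with the negative number `-(r + s)`.
  have hpq : p = q := by
    have : (p - q) * (1 - lor e₁ e₂) = 0 := by linarith
    rcases mul_eq_zero.1 this with h | h
    · linarith
    · have h1 : lor e₁ e₂ = 1 := by linarith
      rw [h1] at a1; linarith
  have hrs : r = s := by
    have : (r - s) * (1 - lor o₁ o₂) = 0 := by linarith
    rcases mul_eq_zero.1 this with h | h
    · linarith
    · have h1 : lor o₁ o₂ = 1 := by linarith
      rw [h1] at a3; linarith
  subst hpq; subst hrs
  refine ⟨p⁻¹ * r, by positivity, ?_⟩
  rw [← smul_add, ← smul_add] at hrel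
  rw [mul_smul, ← hrel, smul_smul, inv_mul_cancel₀ hp.ne', one_smul]

/-- A tangent cube with flat faces: `v` is a vertex, `oᵢ` are its neighbors, `eᵢ` is opposite to
`v` in a face that does not contain `oᵢ`, and `w` is antipodal to `v`. -/
structure IsTangentCube (v o₁ o₂ o₃ e₁ e₂ e₃ w : M5) : Prop where
  vv : lor v v = 1
  oo₁ : lor o₁ o₁ = 1
  oo₂ : lor o₂ o₂ = 1
  oo₃ : lor o₃ o₃ = 1
  ee₁ : lor e₁ e₁ = 1
  ee₂ : lor e₂ e₂ = 1
  ee₃ : lor e₃ e₃ = 1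
  vo₁ : lor v o₁ = -1
  vo₂ : lor v o₂ = -1
  vo₃ : lor v o₃ = -1
  eo₁₂ : lor e₁ o₂ = -1
  eo₁₃ : lor e₁ o₃ = -1
  eo₂₁ : lor e₂ o₁ = -1
  eo₂₃ : lor e₂ o₃ = -1
  eo₃₁ : lor e₃ o₁ = -1
  eo₃₂ : lor e₃ o₂ = -1
  ew₁ : lor e₁ w = -1
  ew₂ : lor e₂ w = -1
  ew₃ : lor e₃ w = -1
  r₁ : ∃ p : ℝ, 0 < p ∧ v + e₁ = p • (o₂ + o₃)
  r₂ : ∃ p : ℝ, 0 < p ∧ v + e₂ = p • (o₁ + o₃)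
  r₃ : ∃ p : ℝ, 0 < p ∧ v + e₃ = p • (o₁ + o₂)
  s₁ : ∃ p : ℝ, 0 < p ∧ e₂ + e₃ = p • (o₁ + w)
  s₂ : ∃ p : ℝ, 0 < p ∧ e₁ + e₃ = p • (o₂ + w)
  s₃ : ∃ p : ℝ, 0 < p ∧ e₁ + e₂ = p • (o₃ + w)

/-- The numbers `p`, `q`, `r` are the scale factors of the three squares at `v`, and `y`, `z`, `x`
those of the squares at `w` named `s₁`, `s₂`, `s₃`; `M` stands for `(1 - lor v w) / 2`. Pairing each
square relation with vertices turns the products into these factors. -/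
lemma IsTangentCube.equations {v o₁ o₂ o₃ e₁ e₂ e₃ w : M5}
    (h : IsTangentCube v o₁ o₂ o₃ e₁ e₂ e₃ w) :
    ∃ p q r x y z M : ℝ, 0 < p ∧ 0 < q ∧ 0 < r ∧ 0 < x ∧ 0 < y ∧ 0 < z ∧
      v + e₁ = p • (o₂ + o₃) ∧ lor v e₁ = -(1 + 2 * p) ∧ lor v e₂ = -(1 + 2 * q) ∧
      lor e₁ e₃ = -(1 + 2 * z) ∧ lor e₁ e₂ = -(1 + 2 * x) ∧ lor v e₃ = -(1 + 2 * r) ∧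
      z * M = 1 + p + r ∧ y * M = 1 + q + r ∧ M = p * (1 + 1 / x + 1 / z) ∧
      M = q * (1 + 1 / x + 1 / y) := by
  obtain ⟨p, hp, r₁⟩ := h.r₁
  obtain ⟨q, hq, r₂⟩ := h.r₂
  obtain ⟨r, hr, r₃⟩ := h.r₃
  obtain ⟨y, hy, s₁⟩ := h.s₁
  obtain ⟨z, hz, s₂⟩ := h.s₂
  obtain ⟨x, hx, s₃⟩ := h.s₃
  have app : ∀ {a b c d : M5} {l : ℝ} (u : M5), a + b = l • (c + d) →
      lor a u + lor b u = l * (lor c u + lor d u) := by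
    intro a b c d l u h
    have := congrArg (fun t => lor t u) h
    simpa only [map_add, map_smul, smul_eq_mul, LinearMap.add_apply, LinearMap.smul_apply] using this
  have o₁v := (lor_comm o₁ v).trans h.vo₁
  have o₂v := (lor_comm o₂ v).trans h.vo₂
  have o₃v := (lor_comm o₃ v).trans h.vo₃
  have ve₁ : lor v e₁ = -(1 + 2 * p) := by
    have := app v r₁
    rw [h.vv, o₂v, o₃v, lor_comm e₁ v] at this; linarith
  have ve₂ : lor v e₂ = -(1 + 2 * q) := by
    have := app v r₂
    rw [h.vv, o₁v, o₃v, lor_comm e₂ v] at this; linarith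
  have ve₃ : lor v e₃ = -(1 + 2 * r) := by
    have := app v r₃
    rw [h.vv, o₁v, o₂v, lor_comm e₃ v] at this; linarith
  have e₁₂ : lor e₁ e₂ = -(1 + 2 * x) := by
    have := app e₁ s₃
    rw [h.ee₁, lor_comm e₂ e₁, lor_comm o₃ e₁, lor_comm w e₁, h.eo₁₃, h.ew₁] at this; linarith
  have e₁₃ : lor e₁ e₃ = -(1 + 2 * z) := by
    have := app e₁ s₂
    rw [h.ee₁, lor_comm e₃ e₁, lor_comm o₂ e₁, lor_comm w e₁, h.eo₁₂, h.ew₁] at this; linarith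
  have wo₁ : lor w o₁ = -1 - 2 / y := by
    have := app o₁ s₁
    rw [h.eo₂₁, h.eo₃₁, h.oo₁] at this
    field_simp
    linarith
  have wo₂ : lor w o₂ = -1 - 2 / z := by
    have := app o₂ s₂
    rw [h.eo₁₂, h.eo₃₂, h.oo₂] at this
    field_simp
    linarith
  have wo₃ : lor w o₃ = -1 - 2 / x := by
    have := app o₃ s₃
    rw [h.eo₁₃, h.eo₂₃, h.oo₃] at this
    field_simp
    linarith
  refine ⟨p, q, r, x, y, z, (1 - lor v w) / 2, hp, hq, hr, hx, hy, hz, r₁, ve₁, ve₂, e₁₃, e₁₂,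
    ve₃, ?_, ?_, ?_, ?_⟩
  · have := app v s₂
    rw [lor_comm e₁ v, lor_comm e₃ v, ve₁, ve₃, o₂v, lor_comm w v] at this
    linarith
  · have := app v s₁
    rw [lor_comm e₂ v, lor_comm e₃ v, ve₂, ve₃, o₁v, lor_comm w v] at this
    linarith
  · have := app w r₁
    rw [h.ew₁, lor_comm o₂ w, lor_comm o₃ w, wo₂, wo₃] at this
    linear_combination (-1 / 2) * this
  · have := app w r₂
    rw [h.ew₂, lor_comm o₁ w, lor_comm o₃ w, wo₁, wo₃] at this
    linear_combination (-1 / 2) * this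

/-- Eliminating `y` and `z` gives the same value `M` for `t * (1 + 1 / x + M / (1 + t + r))` at `t =
p` and at `t = q`. This function is increasing in `t > 0`; `key` is its difference in factored form.
-/
lemma IsTangentCube.diagonal_eq {v o₁ o₂ o₃ e₁ e₂ e₃ w : M5}
    (h : IsTangentCube v o₁ o₂ o₃ e₁ e₂ e₃ w) : lor v e₁ = lor v e₂ := by
  obtain ⟨p, q, r, x, y, z, M, hp, hq, hr, hx, hy, hz, -, h1, h2, -, -, -, hzM, hyM, hM, hM'⟩ :=
    h.equations
  rw [h1, h2]
  have hz' : 1 / z = M / (1 + p + r) := by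
    rw [← hzM]
    have : M ≠ 0 := by rintro rfl; linarith
    field_simp
  have hy' : 1 / y = M / (1 + q + r) := by
    rw [← hyM]
    have : M ≠ 0 := by rintro rfl; linarith
    field_simp
  have hMpos : 0 < M := by rw [hM]; positivity
  have key : (p - q) * (1 + 1 / x + M * (1 + r) / ((1 + p + r) * (1 + q + r))) = 0 := by
    rw [hz'] at hM
    rw [hy'] at hM'
    have e : p * (1 + 1 / x + M / (1 + p + r)) - q * (1 + 1 / x + M / (1 + q + r)) = 0 := by
      linarith
    rw [← e]
    field_simp
    ring
  have hpos : 0 < 1 + 1 / x + M * (1 + r) / ((1 + p + r) * (1 + q + r)) := by positivity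
  have := (mul_eq_zero.1 key).resolve_right hpos.ne'
  linarith

/-- When all relevant face diagonals agree, so do the scale factors. With common factor `p` the
equations read `M = p + 2` and `p * M = 1 + 2 * p`, so `p ^ 2 = 1`. -/
lemma IsTangentCube.parallelogram {v o₁ o₂ o₃ e₁ e₂ e₃ w : M5}
    (h : IsTangentCube v o₁ o₂ o₃ e₁ e₂ e₃ w) (h₃ : lor v e₃ = lor v e₁) (h₁₂ : lor e₁ e₂ = lor v e₁) (h₁₃ : lor e₁ e₃ = lor v e₁) :
    v + e₁ = o₂ + o₃ := by
  obtain ⟨p, q, r, x, y, z, M, hp, hq, hr, hx, hy, hz, hrel, a1, a2, a3, a4, a5, hzM, -, hM, -⟩ :=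
    h.equations
  have hxp : x = p := by linarith
  have hzp : z = p := by linarith
  have hrp : r = p := by linarith
  subst hxp; subst hzp; subst hrp
  have hM2 : M = r + 2 := by
    rw [hM]; field_simp; ring
  rw [hM2] at hzM
  have : (r - 1) * (r + 1) = 0 := by linarith
  have hr1 : r = 1 := by
    rcases mul_eq_zero.1 this with h | h <;> linarith
  rw [hrel, hr1, one_smul]

/-! ### Normals of facets at a ridge -/

/-- `k` is the component orthogonal to the ridge `r` of the lifted vertices in `f \ r`. -/
structure IsNormal (U : Set E4) (W : E4 → M5) (r f : Set E4) (κ : ℝ) (k : M5) : Prop where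
  perp : ∀ x ∈ U, x ∈ r → lor k (W x) = 0
  norm : lor k k = κ
  sub_mem : ∀ x ∈ U, x ∈ f → x ∉ r → W x - k ∈ Submodule.span ℝ (W '' (U ∩ r))

/-- The hyperbolic dihedral angle at the ridge `r` between `f` and `g` has cosine `κ' / κ`. -/
structure IsHinge (U : Set E4) (W : E4 → M5) (r f g : Set E4) (κ κ' : ℝ) : Prop where
  path : ∃ a ∈ U, ∃ b ∈ U, ∃ c ∈ U, a ∈ r ∧ b ∈ r ∧ c ∈ r ∧ IsTangentPath (W a) (W b) (W c)
  normals : ∃ kf kg, IsNormal U W r f κ kf ∧ IsNormal U W r g κ kg ∧ lor kf kg = κ'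

lemma IsNormal.superset {U U' : Set E4} {W : E4 → M5} {r f : Set E4} {κ : ℝ} {k : M5}
    (h : IsNormal U W r f κ k) (hU : U ⊆ U') (hf : ∀ x ∈ U', x ∈ f → x ∈ U) (hr : r ⊆ f) :
    IsNormal U' W r f κ k where
  perp x hx hxr := h.perp x (hf x hx (hr hxr)) hxr
  norm := h.norm
  sub_mem x hx hxf hxr :=
    Submodule.span_mono (Set.image_mono (Set.inter_subset_inter_left r hU))
      (h.sub_mem x (hf x hx hxf) hxf hxr)

lemma IsHinge.superset {U U' : Set E4} {W : E4 → M5} {r f g : Set E4} {κ κ' : ℝ}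
    (h : IsHinge U W r f g κ κ') (hU : U ⊆ U') (hf : ∀ x ∈ U', x ∈ f → x ∈ U)
    (hg : ∀ x ∈ U', x ∈ g → x ∈ U) (hrf : r ⊆ f) (hrg : r ⊆ g) :
    IsHinge U' W r f g κ κ' := by
  obtain ⟨⟨a, ha, b, hb, c, hc, hp⟩, kf, kg, hkf, hkg, hk⟩ := h
  exact ⟨⟨a, hU ha, b, hU hb, c, hU hc, hp⟩, kf, kg, hkf.superset hU hf hrf,
    hkg.superset hU hg hrg, hk⟩

lemma eq_zero_on_span {U r : Set E4} {W : E4 → M5} {T : M5 →ₗ[ℝ] ℝ}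
    (hT : ∀ x ∈ U, x ∈ r → T (W x) = 0) {v : M5}
    (hv : v ∈ Submodule.span ℝ (W '' (U ∩ r))) : T v = 0 := by
  have : Submodule.span ℝ (W '' (U ∩ r)) ≤ LinearMap.ker T := by
    rw [Submodule.span_le]
    rintro _ ⟨x, hx, rfl⟩
    exact hT x hx.1 hx.2
  exact this hv

/-- The difference of two normals lies in the span of the ridge and is orthogonal to it, and the
path makes its complement definite. This identifies the normals that two summands assign to their
common facet. -/
lemma IsNormal.unique {U : Set E4} {W : E4 → M5} {r f : Set E4} {κ : ℝ} {k k' : M5}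
    (h : IsNormal U W r f κ k) (h' : IsNormal U W r f κ k')
    (hpath : ∃ a ∈ U, ∃ b ∈ U, ∃ c ∈ U, a ∈ r ∧ b ∈ r ∧ c ∈ r ∧
      IsTangentPath (W a) (W b) (W c)) (hex : ∃ x ∈ U, x ∈ f ∧ x ∉ r) : k = k' := by
  obtain ⟨a, ha, b, hb, c, hc, har, hbr, hcr, hp⟩ := hpath
  obtain ⟨x, hx, hxf, hxr⟩ := hex
  have hperp : ∀ y ∈ U, y ∈ r → lor (k - k') (W y) = 0 := by
    intro y hy hyr
    rw [map_sub, LinearMap.sub_apply, h.perp y hy hyr, h'.perp y hy hyr, sub_zero]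
  have hmem : k - k' ∈ Submodule.span ℝ (W '' (U ∩ r)) := by
    have := Submodule.sub_mem _ (h'.sub_mem x hx hxf hxr) (h.sub_mem x hx hxf hxr)
    rwa [sub_sub_sub_cancel_left] at this
  rw [← sub_eq_zero]
  exact hp.eq_zero (hperp a ha har) (hperp b hb hbr) (hperp c hc hcr)
    (eq_zero_on_span hperp hmem)

/-- Distinct facets at a ridge have distinct normals. -/
lemma IsNormal.mem_of_eq {U : Set E4} {W : E4 → M5} {r g g' : Set E4} {κ : ℝ} {k : M5}
    (h : IsNormal U W r g κ k) (h' : IsNormal U W r g' κ k) (hrg : r ⊆ g)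
    {L : M5 →ₗ[ℝ] ℝ} (hL : ∀ x ∈ U, 0 ≤ L (W x) ∧ (L (W x) = 0 ↔ x ∈ g))
    (hex : ∃ x ∈ U, x ∈ g ∧ x ∉ r) {y : E4} (hy : y ∈ U) (hyg : y ∈ g') (hyr : y ∉ r) :
    y ∈ g := by
  obtain ⟨x, hx, hxg, hxr⟩ := hex
  have hLr : ∀ z ∈ U, z ∈ r → L (W z) = 0 := fun z hz hzr => (hL z hz).2.2 (hrg hzr)
  have h1 := eq_zero_on_span hLr (h.sub_mem x hx hxg hxr)
  have h2 := eq_zero_on_span hLr (h'.sub_mem y hy hyg hyr)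
  rw [map_sub, (hL x hx).2.2 hxg] at h1
  rw [map_sub] at h2
  exact (hL y hy).2.1 (by linarith)

/-- Facets at a ridge of a convex polytope do not have opposite normals. -/
lemma IsNormal.not_neg {U : Set E4} {W : E4 → M5} {r g g' : Set E4} {κ : ℝ} {k k' : M5}
    (h : IsNormal U W r g κ k) (h' : IsNormal U W r g' κ k')
    {L : M5 →ₗ[ℝ] ℝ} (hL : ∀ x ∈ U, 0 ≤ L (W x) ∧ (L (W x) = 0 ↔ x ∈ r))
    (hex : ∃ x ∈ U, x ∈ g ∧ x ∉ r) (hex' : ∃ x ∈ U, x ∈ g' ∧ x ∉ r) : k' ≠ -k := by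
  rintro rfl
  obtain ⟨x, hx, hxg, hxr⟩ := hex
  obtain ⟨y, hy, hyg, hyr⟩ := hex'
  have hLr : ∀ z ∈ U, z ∈ r → L (W z) = 0 := fun z hz hzr => (hL z hz).2.2 hzr
  have h1 := eq_zero_on_span hLr (h.sub_mem x hx hxg hxr)
  have h2 := eq_zero_on_span hLr (h'.sub_mem y hy hyg hyr)
  rw [map_sub] at h1
  rw [map_sub, map_neg] at h2
  have hx0 : L (W x) ≠ 0 := fun h0 => hxr ((hL x hx).2.1 h0)
  have := (hL x hx).1
  have := (hL y hy).1
  apply hx0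
  linarith

/-! ### Regular models and transfer to their realizations -/

/-- Transfer of facets along isomorphisms of face lattices. -/
lemma IsFacet.map {P P' : Set E4} (Φ : FaceLattice P ≃o FaceLattice P') {F : FaceLattice P}
    (h : IsFacet P F.1) : IsFacet P' (Φ F).1 := by
  obtain ⟨_, hne, hn, hmax⟩ := h
  have htop : ∀ G : FaceLattice P', Φ.symm G = ⟨P, IsExposed.refl P⟩ → G.1 = P' := by
    intro G hG
    apply G.2.subset.antisymm
    have h1 : Φ.symm ⟨P', IsExposed.refl P'⟩ ≤ Φ.symm G := by
      rw [hG]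
      exact (Φ.symm _).2.subset
    exact Φ.symm.le_iff_le.1 h1
  refine ⟨(Φ F).2, (orderIso_nonempty Φ F).2 hne, fun h => ?_, fun G hG hFG => ?_⟩
  · apply hn
    apply F.2.subset.antisymm
    have h1 : Φ ⟨P, IsExposed.refl P⟩ ≤ Φ F := by
      change _ ⊆ (Φ F).1
      rw [h]
      exact (Φ _).2.subset
    exact Φ.le_iff_le.1 h1
  · have h1 : F ≤ Φ.symm ⟨G, hG⟩ := (Φ.le_symm_apply).2 hFG
    rcases hmax _ (Φ.symm ⟨G, hG⟩).2 h1 with h | h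
    · left
      have : Φ.symm ⟨G, hG⟩ = F := Subtype.ext h
      rw [← this]; simp
    · exact Or.inr (htop ⟨G, hG⟩ (Subtype.ext h))

lemma IsRidgeOf.map {P P' : Set E4} (Φ : FaceLattice P ≃o FaceLattice P') {F r : FaceLattice P}
    (h : IsRidgeOf P F.1 r.1) : IsRidgeOf P' (Φ F).1 (Φ r).1 := by
  obtain ⟨_, hne, hrF, hn, hmax⟩ := h
  refine ⟨(Φ r).2, (orderIso_nonempty Φ r).2 hne, Φ.le_iff_le.2 hrF, fun h => hn ?_,
    fun G hG hrG hGF => ?_⟩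
  · exact congrArg Subtype.val (Φ.injective (Subtype.ext h))
  · have h1 : r ≤ Φ.symm ⟨G, hG⟩ := (Φ.le_symm_apply).2 hrG
    have h2 : Φ.symm ⟨G, hG⟩ ≤ F := (Φ.symm_apply_le).2 hGF
    rcases hmax _ (Φ.symm ⟨G, hG⟩).2 h1 h2 with h | h
    · left
      have : Φ.symm ⟨G, hG⟩ = r := Subtype.ext h
      rw [← this]; simp
    · right
      have : Φ.symm ⟨G, hG⟩ = F := Subtype.ext h
      rw [← this]; simp

/-- A regular polytope with vertex set `V`, all of whose facet-ridge flags are equivalent to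
`(F, r)`, where `r` is the ridge between `F` and `G`; in every scribing, even one that ignores
`F` and `G`, the dihedral angle at `r` has cosine `κ' / κ`. -/
structure IsModel (V r F G : Set E4) (κ κ' : ℝ) : Prop where
  finite : V.Finite
  vertices_eq : vertices (convexHull ℝ V) = V
  exposed_r : IsExposed ℝ (convexHull ℝ V) r
  exposed_F : IsExposed ℝ (convexHull ℝ V) F
  exposed_G : IsExposed ℝ (convexHull ℝ V) G
  r_subset_F : r ⊆ F
  r_subset_G : r ⊆ G
  inter : ∀ x ∈ V, x ∈ F → x ∈ G → x ∈ r
  exists_F : ∃ x ∈ V, x ∈ F ∧ x ∉ r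
  exists_G : ∃ x ∈ V, x ∈ G ∧ x ∉ r
  flag : ∀ f s : FaceLattice (convexHull ℝ V), IsFacet (convexHull ℝ V) f.1 →
    IsRidgeOf (convexHull ℝ V) f.1 s.1 →
    ∃ Θ : FaceLattice (convexHull ℝ V) ≃o FaceLattice (convexHull ℝ V),
      Θ ⟨r, exposed_r⟩ = s ∧ Θ ⟨F, exposed_F⟩ = f
  other : ∀ f, IsFacet (convexHull ℝ V) f → r ⊆ f → f = F ∨ f = G
  hinge : ∀ W, Scribing (convexHull ℝ V) {convexHull ℝ V, F, G} W → IsHinge V W r F G κ κ'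

/-- Scribings can be pulled back along isomorphisms of face lattices. -/
lemma Scribing.comap {X P : Set E4} (hX : IsFiniteHull X)
    (Ψ : FaceLattice X ≃o FaceLattice P) {bad bad' : Set (Set E4)} {W : E4 → M5}
    (h : Scribing P bad W) (hbad : ∀ S : FaceLattice X, (Ψ S).1 ∈ bad → S.1 ∈ bad')
    {p : E4 → E4} (hp : ∀ x ∈ vertices X, p x ∈ vertices P)
    (hpF : ∀ x ∈ vertices X, ∀ F : FaceLattice X, p x ∈ (Ψ F).1 ↔ x ∈ F.1)
    (hps : ∀ y ∈ vertices P, ∃ x ∈ vertices X, p x = y) : Scribing X bad' (W ∘ p) where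
  pos x hx := h.pos _ (hp x hx)
  face S hS hne hSb := by
    obtain ⟨L, hL⟩ := h.face _ (Ψ ⟨S, hS⟩).2 ((orderIso_nonempty Ψ ⟨S, hS⟩).2 hne)
      (fun hb => hSb (hbad _ hb))
    refine ⟨L, fun x hx => ?_⟩
    rw [← hpF x hx ⟨S, hS⟩]
    exact hL _ (hp x hx)
  edge S hS hSb x hx y hy hxy hz := by
    have hinj : ∀ x ∈ vertices X, ∀ y ∈ vertices X, p x = p y → x = y := by
      intro x hx y hy hxy
      have h1 := (hpF y hy ⟨{y}, hX.isExposed_singleton_iff.2 hy⟩).2 rfl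
      rw [← hxy, hpF x hx] at h1
      exact h1
    refine h.edge _ (Ψ ⟨S, hS⟩).2 (fun hb => hSb (hbad _ hb)) _ (hp x hx) _ (hp y hy)
      (fun he => hxy (hinj x hx y hy he)) fun z' hz' => ?_
    obtain ⟨z, hzv, rfl⟩ := hps z' hz'
    rw [hpF z hzv, hz z hzv]
    exact ⟨fun h => h.imp (congrArg p) (congrArg p),
      fun h => h.imp (hinj z hzv x hx) (hinj z hzv y hy)⟩

/-- Scribings of a polytope restrict to parts of it whose faces are faces of the polytope. -/
lemma Scribing.restrict {P Q : Set E4} {bad : Set (Set E4)} {W : E4 → M5}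
    (h : Scribing Q ∅ W) (hPQ : P ⊆ Q) (hv : vertices P ⊆ vertices Q)
    (hface : ∀ S, IsExposed ℝ P S → S ∉ bad → IsExposed ℝ Q S) : Scribing P bad W where
  pos x hx := h.pos x (hv hx)
  face S hS hne hSb := by
    obtain ⟨L, hL⟩ := h.face S (hface S hS hSb) hne (Set.notMem_empty _)
    exact ⟨L, fun x hx => hL x (hv hx)⟩
  edge S hS hSb x hx y hy hxy hz := by
    refine h.edge S (hface S hS hSb) (Set.notMem_empty _) x (hv hx) y (hv hy) hxy fun z hzQ => ?_
    constructor
    · intro hzS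
      have hzP : z ∈ P := hS.subset hzS
      exact (hz z (inter_extremePoints_subset_extremePoints_of_subset hPQ ⟨hzP, hzQ⟩)).1 hzS
    · rintro (rfl | rfl)
      · exact (hz _ hx).2 (Or.inl rfl)
      · exact (hz _ hy).2 (Or.inr rfl)

/-- The other facet at the ridge `r` of the facet `f` of a realization of a model. -/
structure IsFlagIn (P r f g : Set E4) (κ κ' : ℝ) : Prop where
  exposed_g : IsExposed ℝ P g
  r_subset_g : r ⊆ g
  ne_g : g ≠ P
  inter : ∀ x ∈ vertices P, x ∈ f → x ∈ g → x ∈ r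
  exists_f : ∃ x ∈ vertices P, x ∈ f ∧ x ∉ r
  exists_g : ∃ x ∈ vertices P, x ∈ g ∧ x ∉ r
  other : ∀ f', IsFacet P f' → r ⊆ f' → f' = f ∨ f' = g
  hinge : ∀ W, Scribing P {P, f, g} W → IsHinge (vertices P) W r f g κ κ'

/-- The given isomorphism with the model is corrected by a symmetry so that it matches the flag of
`r` and `f` with the chosen flag of the model; `g` is the image of the second facet. A scribing of
`P` is pulled back along the induced map of vertices, and its hinge is pushed forward again. -/
lemma IsModel.exists_flag {V r₀ F₀ G₀ P f r : Set E4} {κ κ' : ℝ} (hM : IsModel V r₀ F₀ G₀ κ κ')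
    (hP : IsFiniteHull P) (hc : CombEquiv P (convexHull ℝ V)) (hf : IsFacet P f)
    (hr : IsRidgeOf P f r) : ∃ g, IsFlagIn P r f g κ κ' := by
  obtain ⟨Ψ₀⟩ := hc
  have hX : IsFiniteHull (convexHull ℝ V) := ⟨V, hM.finite, rfl⟩
  obtain ⟨Θ, hΘr, hΘF⟩ := hM.flag (Ψ₀ ⟨f, hf.1⟩) (Ψ₀ ⟨r, hr.1⟩)
    (IsFacet.map Ψ₀ (F := ⟨f, hf.1⟩) hf)
    (IsRidgeOf.map Ψ₀ (F := ⟨f, hf.1⟩) (r := ⟨r, hr.1⟩) hr)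
  let Ψ : FaceLattice (convexHull ℝ V) ≃o FaceLattice P := Θ.trans Ψ₀.symm
  let R : FaceLattice (convexHull ℝ V) := ⟨r₀, hM.exposed_r⟩
  let F : FaceLattice (convexHull ℝ V) := ⟨F₀, hM.exposed_F⟩
  let G : FaceLattice (convexHull ℝ V) := ⟨G₀, hM.exposed_G⟩
  have hΨr : Ψ R = ⟨r, hr.1⟩ := by simp [Ψ, R, hΘr]
  have hΨF : Ψ F = ⟨f, hf.1⟩ := by simp [Ψ, F, hΘF]
  obtain ⟨p, hp, hpF, hps⟩ := exists_vertexMap hX hP Ψ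
  rw [hM.vertices_eq] at hp hpF hps
  have mem_r : ∀ x ∈ V, p x ∈ r ↔ x ∈ r₀ := by
    intro x hx
    have := hpF x hx R
    rwa [hΨr] at this
  have mem_f : ∀ x ∈ V, p x ∈ f ↔ x ∈ F₀ := by
    intro x hx
    have := hpF x hx F
    rwa [hΨF] at this
  have mem_g : ∀ x ∈ V, p x ∈ (Ψ G).1 ↔ x ∈ G₀ := fun x hx => hpF x hx G
  have hΨP : ∀ S, (Ψ S).1 = P → S.1 = convexHull ℝ V := by
    intro S hS
    apply S.2.subset.antisymm
    have h1 : Ψ ⟨_, IsExposed.refl _⟩ ≤ Ψ S := by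
      change _ ⊆ (Ψ S).1
      rw [hS]
      exact (Ψ _).2.subset
    exact Ψ.le_iff_le.1 h1
  refine ⟨(Ψ G).1, (Ψ G).2, ?_, ?_, ?_, ?_, ?_, ?_, ?_⟩
  · have h1 : Ψ R ≤ Ψ G := Ψ.le_iff_le.2 hM.r_subset_G
    rw [hΨr] at h1
    exact h1
  · intro h
    have h1 : G₀ = convexHull ℝ V := hΨP G h
    obtain ⟨x, hx, hxF, hxr⟩ := hM.exists_F
    exact hxr (hM.inter x hx hxF (h1 ▸ subset_convexHull ℝ V hx))
  · intro y hy hyf hyg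
    obtain ⟨x, hx, rfl⟩ := hps y hy
    exact (mem_r x hx).2 (hM.inter x hx ((mem_f x hx).1 hyf) ((mem_g x hx).1 hyg))
  · obtain ⟨x, hx, hxF, hxr⟩ := hM.exists_F
    exact ⟨p x, hp x hx, (mem_f x hx).2 hxF, fun h => hxr ((mem_r x hx).1 h)⟩
  · obtain ⟨x, hx, hxF, hxr⟩ := hM.exists_G
    exact ⟨p x, hp x hx, (mem_g x hx).2 hxF, fun h => hxr ((mem_r x hx).1 h)⟩
  · intro f' hf' hrf'
    have h1 : IsFacet (convexHull ℝ V) (Ψ.symm ⟨f', hf'.1⟩).1 :=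
      IsFacet.map Ψ.symm (F := ⟨f', hf'.1⟩) hf'
    have h2 : R ≤ Ψ.symm ⟨f', hf'.1⟩ := by
      rw [Ψ.le_symm_apply, hΨr]
      exact hrf'
    rcases hM.other _ h1 h2 with h | h
    · left
      have : Ψ.symm ⟨f', hf'.1⟩ = F := Subtype.ext h
      rw [OrderIso.symm_apply_eq, hΨF] at this
      exact congrArg Subtype.val this
    · right
      have : Ψ.symm ⟨f', hf'.1⟩ = G := Subtype.ext h
      rw [OrderIso.symm_apply_eq] at this
      exact congrArg Subtype.val this
  · intro W hW
    have hW' : Scribing (convexHull ℝ V) {convexHull ℝ V, F₀, G₀} (W ∘ p) := by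
      refine hW.comap hX Ψ (bad' := {convexHull ℝ V, F₀, G₀}) ?_ ?_ ?_ ?_
      · rintro S (h | h | h)
        · exact Or.inl (hΨP S h)
        · right; left
          have : Ψ S = Ψ F := by rw [hΨF]; exact Subtype.ext h
          exact congrArg Subtype.val (Ψ.injective this)
        · right; right
          have : Ψ S = Ψ G := Subtype.ext h
          exact congrArg Subtype.val (Ψ.injective this)
      · rwa [hM.vertices_eq]
      · rwa [hM.vertices_eq]
      · rwa [hM.vertices_eq]
    obtain ⟨⟨a, ha, b, hb, c, hc, har, hbr, hcr, hpath⟩, kf, kg, hkf, hkg, hk⟩ := hM.hinge _ hW'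
    have himage : (W ∘ p) '' (V ∩ r₀) = W '' (vertices P ∩ r) := by
      rw [Set.image_comp]
      congr 1
      ext y
      constructor
      · rintro ⟨x, ⟨hx, hxr⟩, rfl⟩
        exact ⟨hp x hx, (mem_r x hx).2 hxr⟩
      · rintro ⟨hy, hyr⟩
        obtain ⟨x, hx, rfl⟩ := hps y hy
        exact ⟨x, ⟨hx, (mem_r x hx).1 hyr⟩, rfl⟩
    have trans : ∀ {k : M5} {A B : Set E4}, (∀ x ∈ V, p x ∈ B ↔ x ∈ A) →
        IsNormal V (W ∘ p) r₀ A κ k → IsNormal (vertices P) W r B κ k := by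
      intro k A B hAB h
      refine ⟨fun y hy hyr => ?_, h.norm, fun y hy hyB hyr => ?_⟩
      · obtain ⟨x, hx, rfl⟩ := hps y hy
        exact h.perp x hx ((mem_r x hx).1 hyr)
      · obtain ⟨x, hx, rfl⟩ := hps y hy
        rw [← himage]
        exact h.sub_mem x hx ((hAB x hx).1 hyB) fun h => hyr ((mem_r x hx).2 h)
    exact ⟨⟨p a, hp a ha, p b, hp b hb, p c, hp c hc, (mem_r a ha).2 har, (mem_r b hb).2 hbr,
      (mem_r c hc).2 hcr, hpath⟩, kf, kg, trans mem_f hkf, trans mem_g hkg, hk⟩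

/-- Every facet of a polytope contains a ridge. -/
lemma exists_isRidgeOf {P f : Set E4} (hP : IsFiniteHull P) (hf : IsExposed ℝ P f)
    (hne : f.Nonempty) (hd : Module.finrank ℝ (vectorSpan ℝ f) ≠ 0) : ∃ r, IsRidgeOf P f r := by
  -- A face of largest dimension among the nonempty proper faces of `f` is covered by `f`, since
  -- dimension is strictly monotone.
  let S : Set ℕ := {d | ∃ r, IsExposed ℝ P r ∧ r.Nonempty ∧ r ⊆ f ∧ r ≠ f ∧
    Module.finrank ℝ (vectorSpan ℝ r) = d}
  have hS : S.Nonempty := by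
    obtain ⟨x, hx, hxf⟩ := hP.exists_vertex hf hne
    refine ⟨_, {x}, hP.isExposed_singleton_iff.2 hx, ⟨x, rfl⟩, by simpa using hxf, ?_, rfl⟩
    rintro rfl
    simp at hd
  have hb : BddAbove S := by
    refine ⟨4, ?_⟩
    rintro _ ⟨r, -, -, -, -, rfl⟩
    simpa using Submodule.finrank_le (vectorSpan ℝ r)
  obtain ⟨r, hr, hrne, hrf, hrn, hrd⟩ := Nat.sSup_mem hS hb
  refine ⟨r, hr, hrne, hrf, hrn, fun G hG hrG hGf => ?_⟩
  by_contra! hc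
  have h1 := finrank_vectorSpan_lt hr hG hrne hrG hc.1.symm
  have h2 := le_csSup hb (⟨G, hG, hrne.mono hrG, hGf, hc.2, rfl⟩ : _ ∈ S)
  exact (h1.trans_le h2).ne hrd

/-! ### Connected sums and the angle count around a ridge -/

namespace IsConnectedSum

variable {P P' f Q : Set E4} (h : IsConnectedSum P P' f Q)
include h

lemma symm : IsConnectedSum P' P f Q where
  polytope_left := h.polytope_right
  polytope_right := h.polytope_left
  polytope_sum := h.polytope_sum
  facet_left := h.facet_right
  facet_right := h.facet_left
  inter_eq := by rw [Set.inter_comm, h.inter_eq]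
  union_eq := by rw [Set.union_comm, h.union_eq]
  faces_iff G := by rw [h.faces_iff, or_comm]

lemma subset : P ⊆ Q := h.union_eq ▸ Set.subset_union_left

lemma isFacet : IsFacet P f := IsFaceOfDim.isFacet h.polytope_left h.facet_left

lemma exposed {G : Set E4} (hG : IsExposed ℝ P G) (hP : G ≠ P) (hf : G ≠ f) : IsExposed ℝ Q G :=
  ((h.faces_iff G).2 ⟨Or.inl ⟨hG, hP⟩, hf⟩).1

lemma ne_sum {G : Set E4} (hG : IsExposed ℝ P G) (hP : G ≠ P) (hf : G ≠ f) : G ≠ Q :=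
  ((h.faces_iff G).2 ⟨Or.inl ⟨hG, hP⟩, hf⟩).2

/-- Vertices are faces of dimension zero, so they are neither `P` nor `f` and survive the gluing. -/
lemma vertices_subset : vertices P ⊆ vertices Q := by
  intro x hx
  rw [← h.polytope_sum.isFiniteHull.isExposed_singleton_iff]
  apply h.exposed (h.polytope_left.isFiniteHull.isExposed_singleton_iff.2 hx)
  · rintro rfl
    have := h.polytope_left.finrank_eq
    rw [vectorSpan_singleton, finrank_bot] at this
    omega
  · rintro rfl
    have := h.facet_left.2.2
    rw [vectorSpan_singleton, finrank_bot] at this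
    omega

lemma mem_vertices {x : E4} (hx : x ∈ vertices Q) (hxP : x ∈ P) : x ∈ vertices P :=
  inter_extremePoints_subset_extremePoints_of_subset h.subset ⟨hxP, hx⟩

/-- A face properly inside `f` is a face of the sum, hence of the other summand, which is a subset
containing it. So both summands see the same faces below `f`. -/
lemma isRidgeOf_right {r : Set E4} (hr : IsRidgeOf P f r) : IsRidgeOf P' f r := by
  obtain ⟨hr, hne, hrf, hrn, hmax⟩ := hr
  have aux : ∀ {A A' : Set E4} (_ : IsConnectedSum A A' f Q) {G : Set E4}, IsExposed ℝ A G →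
      G ⊆ f → G ≠ f → IsExposed ℝ A' G := by
    intro A A' hA G hG hGf hGn
    have hGA : G ≠ A := by
      rintro rfl
      exact hGn (hGf.antisymm hA.facet_left.1.subset)
    exact (hA.exposed hG hGA hGn).mono hA.symm.subset (hGf.trans hA.symm.facet_left.1.subset)
  refine ⟨aux h hr hrf hrn, hne, hrf, hrn, fun G hG hrG hGf => ?_⟩
  by_cases hGn : G = f
  · exact Or.inr hGn
  · exact hmax G (aux h.symm hG hGf hGn) hrG hGf

end IsConnectedSum

/-- Two copies of a right-angled model cannot be joined. -/
theorem IsModel.not_isEdgeScribable_sum {V r₀ F₀ G₀ : Set E4} {κ : ℝ}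
    (hM : IsModel V r₀ F₀ G₀ κ 0) (hκ : 0 < κ) {P P' f Q : Set E4}
    (hP : CombEquiv P (convexHull ℝ V)) (hP' : CombEquiv P' (convexHull ℝ V))
    (h : IsConnectedSum P P' f Q) : ¬ IsEdgeScribable Q := by
  intro hQ
  obtain ⟨W, hW⟩ := hQ.exists_scribing h.polytope_sum.isFiniteHull
  obtain ⟨r, hr⟩ := exists_isRidgeOf h.polytope_left.isFiniteHull h.facet_left.1
    h.facet_left.2.1 (by rw [h.facet_left.2.2]; norm_num)
  have hrf := hr.2.2.1
  have hr' := h.isRidgeOf_right hr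
  have key : ∀ {A A' : Set E4} (_ : IsConnectedSum A A' f Q), CombEquiv A (convexHull ℝ V) →
      IsRidgeOf A f r → ∃ g, IsFlagIn A r f g κ 0 ∧ IsHinge (vertices Q) W r f g κ 0 ∧
        IsExposed ℝ Q g := by
    intro A A' hA hc hrA
    obtain ⟨g, hg⟩ := hM.exists_flag hA.polytope_left.isFiniteHull hc hA.isFacet hrA
    refine ⟨g, hg, ?_, ?_⟩
    · have hr := hW.restrict (bad := {A, f, g}) hA.subset hA.vertices_subset fun S hS hSb =>
        hA.exposed hS (fun h => hSb (Or.inl h)) (fun h => hSb (Or.inr (Or.inl h)))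
      exact (hg.hinge W hr).superset hA.vertices_subset
        (fun x hx hxf => hA.mem_vertices hx (hA.facet_left.1.subset hxf))
        (fun x hx hxg => hA.mem_vertices hx (hg.exposed_g.subset hxg)) hrf hg.r_subset_g
    · apply hA.exposed hg.exposed_g hg.ne_g
      rintro rfl
      obtain ⟨x, hx, hxg, hxr⟩ := hg.exists_g
      exact hxr (hg.inter x hx hxg hxg)
  obtain ⟨g, hg, ⟨path, k₁, k₀, n₁, n₀, k10⟩, hgQ⟩ := key h hP hr
  obtain ⟨g', hg', ⟨-, k₁', k₂, n₁', n₂, k12⟩, hgQ'⟩ := key h.symm hP' hr'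
  have lift_ex : ∀ {A A' s : Set E4} (_ : IsConnectedSum A A' f Q),
      (∃ x ∈ vertices A, x ∈ s ∧ x ∉ r) → ∃ x ∈ vertices Q, x ∈ s ∧ x ∉ r := by
    rintro A A' s hA ⟨x, hx, hxs⟩
    exact ⟨x, hA.vertices_subset hx, hxs⟩
  have exf := lift_ex h hg.exists_f
  have exg := lift_ex h hg.exists_g
  have exg' := lift_ex h.symm hg'.exists_g
  -- The facet `f` has one and the same normal seen from both sides.
  have hkk : k₁ = k₁' := n₁.unique n₁' path exf
  subst hkk
  have hrQ : IsExposed ℝ Q r := by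
    apply h.exposed hr.1 _ hr.2.2.2.1
    rintro rfl
    exact hr.2.2.2.1 (hrf.antisymm h.facet_left.1.subset)
  obtain ⟨a, ha, b, hb, c, hc, har, hbr, hcr, hp⟩ := path
  rcases planar_reflection hp (n₀.perp a ha har) (n₀.perp b hb hbr) (n₀.perp c hc hcr)
    (n₁.perp a ha har) (n₁.perp b hb hbr) (n₁.perp c hc hcr) (n₂.perp a ha har)
    (n₂.perp b hb hbr) (n₂.perp c hc hcr) n₀.norm n₁.norm n₂.norm (by rw [lor_comm, k10]) k12 hκ
    (by rw [zero_pow two_ne_zero]; positivity) with h20 | h20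
  · subst h20
    -- Equal normals put the vertices of `g'` into the hyperplane of `g`, hence into both summands
    -- and so into `f`; but `f` and `g'` share no vertices off `r`.
    obtain ⟨L, hL⟩ := hW.face g hgQ (hr.2.1.mono hg.r_subset_g) (Set.notMem_empty _)
    obtain ⟨y, hy, hyg', hyr⟩ := hg'.exists_g
    have hyg := n₀.mem_of_eq n₂ hg.r_subset_g hL exg (h.symm.vertices_subset hy) hyg' hyr
    have hyf : y ∈ f := by
      rw [← h.inter_eq]
      exact ⟨hg.exposed_g.subset hyg, hg'.exposed_g.subset hyg'⟩
    exact hyr (hg'.inter y hy hyf hyg')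
  -- Two right angles: the outer normals are opposite.
  · obtain ⟨L, hL⟩ := hW.face r hrQ hr.2.1 (Set.notMem_empty _)
    refine n₀.not_neg n₂ hL exg exg' ?_
    rw [h20]
    simp

/-- Three copies of a model with dihedral angle `π / 3` cannot be joined around a ridge; here the
second gluing is along a facet of the second copy. -/
theorem IsModel.not_isEdgeScribable_triple_aux {V r₀ F₀ G₀ : Set E4} {κ κ' : ℝ}
    (hM : IsModel V r₀ F₀ G₀ κ κ') (hκ : 0 < κ) (hκ' : κ = 2 * κ')
    {P₁ P₂ P₃ Q R f₁ f₂ r : Set E4}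
    (hP₁ : CombEquiv P₁ (convexHull ℝ V)) (hP₂ : CombEquiv P₂ (convexHull ℝ V))
    (hP₃ : CombEquiv P₃ (convexHull ℝ V))
    (h : IsConnectedSum P₁ P₂ f₁ R) (h' : IsConnectedSum R P₃ f₂ Q)
    (hr₁ : IsFaceOfDim 2 P₁ r) (hr₂ : IsFaceOfDim 2 P₂ r) (hr₃ : IsFaceOfDim 2 P₃ r)
    (hf₂ : IsFaceOfDim 3 P₂ f₂) (hne : f₂ ≠ f₁) : ¬ IsEdgeScribable Q := by
  intro hQ
  obtain ⟨W, hW⟩ := hQ.exists_scribing h'.polytope_sum.isFiniteHull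
  have hrf₁ : r ⊆ f₁ := by
    rw [← h.inter_eq]
    exact Set.subset_inter hr₁.1.subset hr₂.1.subset
  have hrf₂ : r ⊆ f₂ := by
    rw [← h'.inter_eq]
    exact Set.subset_inter (hr₁.1.subset.trans h.subset) hr₃.1.subset
  have facet₂ := IsFaceOfDim.isFacet h.polytope_right hf₂
  obtain ⟨g₁, hg₁⟩ := hM.exists_flag h.polytope_left.isFiniteHull hP₁ h.isFacet
    (IsFaceOfDim.isRidgeOf h.facet_left hr₁ hrf₁)
  obtain ⟨g₂, hg₂⟩ := hM.exists_flag h.polytope_right.isFiniteHull hP₂ h.symm.isFacet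
    (IsFaceOfDim.isRidgeOf h.facet_right hr₂ hrf₁)
  obtain ⟨g₃, hg₃⟩ := hM.exists_flag h'.polytope_right.isFiniteHull hP₃ h'.symm.isFacet
    (IsFaceOfDim.isRidgeOf h'.facet_right hr₃ hrf₂)
  -- At `r` the middle copy has only the two facets `f₁` and `f₂`.
  obtain rfl : f₂ = g₂ := (hg₂.other f₂ facet₂ hrf₂).resolve_left hne
  -- Faces of `P₁` must survive the second gluing too. If `f₂` were a face of `P₁`, it would lie in
  -- `P₁ ∩ P₂ = f₁`, so the facets `f₁` and `f₂` of `P₂` would coincide.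
  have exp₁ : ∀ S, IsExposed ℝ P₁ S → S ≠ P₁ → S ≠ f₁ → IsExposed ℝ Q S := by
    intro S hS hSP hSf
    refine h'.exposed (h.exposed hS hSP hSf) (h.ne_sum hS hSP hSf) ?_
    rintro rfl
    have hsub : S ⊆ f₁ := by
      rw [← h.inter_eq]
      exact Set.subset_inter hS.subset facet₂.1.subset
    rcases facet₂.2.2.2 f₁ h.facet_right.1 hsub with h1 | h1
    · exact hSf h1.symm
    · exact h.symm.isFacet.2.2.1 h1
  have exp₂ : ∀ S, IsExposed ℝ P₂ S → S ≠ P₂ → S ≠ f₁ → S ≠ f₂ → IsExposed ℝ Q S :=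
    fun S hS hSP hS₁ hS₂ =>
      h'.exposed (h.symm.exposed hS hSP hS₁) (h.symm.ne_sum hS hSP hS₁) hS₂
  have exp₃ : ∀ S, IsExposed ℝ P₃ S → S ≠ P₃ → S ≠ f₂ → IsExposed ℝ Q S :=
    fun S hS hSP hS₂ => h'.symm.exposed hS hSP hS₂
  have v₁ := h.vertices_subset.trans h'.vertices_subset
  have v₂ := h.symm.vertices_subset.trans h'.vertices_subset
  have v₃ := h'.symm.vertices_subset
  have m₁ : ∀ x ∈ vertices Q, x ∈ P₁ → x ∈ vertices P₁ := fun x hx hxP =>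
    h.mem_vertices (h'.mem_vertices hx (h.subset hxP)) hxP
  have m₂ : ∀ x ∈ vertices Q, x ∈ P₂ → x ∈ vertices P₂ := fun x hx hxP =>
    h.symm.mem_vertices (h'.mem_vertices hx (h.symm.subset hxP)) hxP
  have m₃ : ∀ x ∈ vertices Q, x ∈ P₃ → x ∈ vertices P₃ := fun x hx hxP =>
    h'.symm.mem_vertices hx hxP
  have H₁ : IsHinge (vertices Q) W r f₁ g₁ κ κ' :=
    (hg₁.hinge W (hW.restrict (h.subset.trans h'.subset) v₁ fun S hS hSb =>
      exp₁ S hS (fun h => hSb (Or.inl h)) (fun h => hSb (Or.inr (Or.inl h))))).superset v₁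
      (fun x hx hxf => m₁ x hx (h.facet_left.1.subset hxf))
      (fun x hx hxf => m₁ x hx (hg₁.exposed_g.subset hxf)) hrf₁ hg₁.r_subset_g
  -- The middle copy has lost both of its facets at `r`. This is why the hinge of a model has to
  -- hold for scribings that ignore two facets.
  have H₂ : IsHinge (vertices Q) W r f₁ f₂ κ κ' :=
    (hg₂.hinge W (hW.restrict (h.symm.subset.trans h'.subset) v₂ fun S hS hSb =>
      exp₂ S hS (fun h => hSb (Or.inl h)) (fun h => hSb (Or.inr (Or.inl h)))
        (fun h => hSb (Or.inr (Or.inr h))))).superset v₂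
      (fun x hx hxf => m₂ x hx (h.facet_right.1.subset hxf))
      (fun x hx hxf => m₂ x hx (facet₂.1.subset hxf)) hrf₁ hrf₂
  have H₃ : IsHinge (vertices Q) W r f₂ g₃ κ κ' :=
    (hg₃.hinge W (hW.restrict h'.symm.subset v₃ fun S hS hSb =>
      exp₃ S hS (fun h => hSb (Or.inl h)) (fun h => hSb (Or.inr (Or.inl h))))).superset v₃
      (fun x hx hxf => m₃ x hx (h'.facet_right.1.subset hxf))
      (fun x hx hxf => m₃ x hx (hg₃.exposed_g.subset hxf)) hrf₂ hg₃.r_subset_g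
  obtain ⟨path, k₁, k₀, n₁, n₀, k10⟩ := H₁
  obtain ⟨-, k₁', k₂, n₁', n₂, k12⟩ := H₂
  obtain ⟨-, k₂', k₃, n₂', n₃, k23⟩ := H₃
  have lift_ex : ∀ {A s : Set E4}, vertices A ⊆ vertices Q →
      (∃ x ∈ vertices A, x ∈ s ∧ x ∉ r) → ∃ x ∈ vertices Q, x ∈ s ∧ x ∉ r := by
    rintro A s hA ⟨x, hx, hxs⟩
    exact ⟨x, hA hx, hxs⟩
  have ex₀ := lift_ex v₁ hg₁.exists_g
  have ex₁ := lift_ex v₁ hg₁.exists_f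
  have ex₂ := lift_ex v₃ hg₃.exists_f
  have ex₃ := lift_ex v₃ hg₃.exists_g
  obtain rfl : k₁ = k₁' := n₁.unique n₁' path ex₁
  obtain rfl : k₂ = k₂' := n₂.unique n₂' path ex₂
  have hg₁Q : IsExposed ℝ Q g₁ := by
    apply exp₁ g₁ hg₁.exposed_g hg₁.ne_g
    rintro rfl
    obtain ⟨x, hx, hxg, hxr⟩ := hg₁.exists_g
    exact hxr (hg₁.inter x hx hxg hxg)
  have hg₃Q : IsExposed ℝ Q g₃ := by
    apply exp₃ g₃ hg₃.exposed_g hg₃.ne_g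
    rintro rfl
    obtain ⟨x, hx, hxg, hxr⟩ := hg₃.exists_g
    exact hxr (hg₃.inter x hx hxg hxg)
  have hrQ : IsExposed ℝ Q r := by
    apply exp₁ r hr₁.1
    · rintro rfl
      have := h.polytope_left.finrank_eq
      have := hr₁.2.2
      omega
    · rintro rfl
      have := h.facet_left.2.2
      have := hr₁.2.2
      omega
  have hrne : r.Nonempty := hr₁.2.1
  have inter₂ : ∀ x ∈ vertices Q, x ∈ f₁ → x ∈ f₂ → x ∈ r := fun x hx h1 h2 =>
    hg₂.inter x (m₂ x hx (facet₂.1.subset h2)) h1 h2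
  have hsq : κ' ^ 2 < κ ^ 2 := by rw [hκ']; nlinarith
  have hquot : 2 * κ' / κ = 1 := by rw [← hκ', div_self hκ.ne']
  have path' := path
  obtain ⟨a, ha, b, hb, c, hc, har, hbr, hcr, hp⟩ := path'
  have h2 : k₂ = k₁ - k₀ := by
    rcases planar_reflection hp (n₀.perp a ha har) (n₀.perp b hb hbr) (n₀.perp c hc hcr)
      (n₁.perp a ha har) (n₁.perp b hb hbr) (n₁.perp c hc hcr) (n₂.perp a ha har)
      (n₂.perp b hb hbr) (n₂.perp c hc hcr) n₀.norm n₁.norm n₂.norm (by rw [lor_comm, k10]) k12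
      hκ hsq with h20 | h20
    · subst h20
      obtain ⟨L, hL⟩ := hW.face g₁ hg₁Q (hrne.mono hg₁.r_subset_g) (Set.notMem_empty _)
      obtain ⟨y, hy, hyg, hyr⟩ := ex₂
      have hyg₁ := n₀.mem_of_eq n₂ hg₁.r_subset_g hL ex₀ hy hyg hyr
      have hyf : y ∈ f₁ := by
        rw [← h.inter_eq]
        exact ⟨hg₁.exposed_g.subset hyg₁, facet₂.1.subset hyg⟩
      exact absurd (inter₂ y hy hyf hyg) hyr
    · rw [h20, hquot, one_smul]
  -- In the excluded case `k₃ = k₁` a vertex of `f₁` off `r` would lie in `g₃`, hence in `f₂`; but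
  -- `f₁` and `f₂` share no vertices off `r`.
  have h3 : k₃ = k₂ - k₁ := by
    rcases planar_reflection hp (n₁.perp a ha har) (n₁.perp b hb hbr) (n₁.perp c hc hcr)
      (n₂.perp a ha har) (n₂.perp b hb hbr) (n₂.perp c hc hcr) (n₃.perp a ha har)
      (n₃.perp b hb hbr) (n₃.perp c hc hcr) n₁.norm n₂.norm n₃.norm k12 k23
      hκ hsq with h31 | h31
    · subst h31
      obtain ⟨L, hL⟩ := hW.face g₃ hg₃Q (hrne.mono hg₃.r_subset_g) (Set.notMem_empty _)
      obtain ⟨y, hy, hyf, hyr⟩ := ex₁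
      have hyg₃ := n₃.mem_of_eq n₁ hg₃.r_subset_g hL ex₃ hy hyf hyr
      have hyf₂ : y ∈ f₂ := by
        rw [← h'.inter_eq]
        exact ⟨h.subset (h.facet_left.1.subset hyf), hg₃.exposed_g.subset hyg₃⟩
      exact absurd (inter₂ y hy hyf hyf₂) hyr
    · rw [h31, hquot, one_smul]
  obtain ⟨L, hL⟩ := hW.face r hrQ hrne (Set.notMem_empty _)
  -- Three angles `π / 3` make a straight angle: `k₃ = (k₁ - k₀) - k₁ = -k₀`.
  refine n₀.not_neg n₃ hL ex₀ ex₃ ?_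
  rw [h3, h2]
  abel

/-- The second gluing facet is a proper face of the first sum, so it is a facet of `P₁` or `P₂`
other than `f₁`. The first sum is symmetric, so both cases are the same. -/
theorem IsModel.not_isEdgeScribable_triple {V r₀ F₀ G₀ : Set E4} {κ κ' : ℝ}
    (hM : IsModel V r₀ F₀ G₀ κ κ') (hκ : 0 < κ) (hκ' : κ = 2 * κ') {P₁ P₂ P₃ Q : Set E4}
    (hP₁ : CombEquiv P₁ (convexHull ℝ V)) (hP₂ : CombEquiv P₂ (convexHull ℝ V))
    (hP₃ : CombEquiv P₃ (convexHull ℝ V)) (h : IsTripleSumSharingRidge P₁ P₂ P₃ Q) :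
    ¬ IsEdgeScribable Q := by
  obtain ⟨f₁, f₂, r, R, h, h', hr₁, hr₂, hr₃⟩ := h
  have hR : IsProperFace R f₂ := by
    refine ⟨h'.facet_left.1, ?_⟩
    rintro rfl
    have := h.polytope_sum.finrank_eq
    have := h'.facet_left.2.2
    omega
  obtain ⟨hf | hf, hne⟩ := (h.faces_iff f₂).1 hR
  · exact hM.not_isEdgeScribable_triple_aux hκ hκ' hP₂ hP₁ hP₃ h.symm h' hr₂ hr₁ hr₃
      ⟨hf.1, h'.facet_left.2⟩ hne
  · exact hM.not_isEdgeScribable_triple_aux hκ hκ' hP₁ hP₂ hP₃ h h' hr₁ hr₂ hr₃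
      ⟨hf.1, h'.facet_left.2⟩ hne

/-! ### Finite point sets on a sphere and their partial scribings -/

lemma inner_eq_sum (x y : E4) : inner ℝ x y = ∑ i, x i * y i := by
  simp [PiLp.inner_apply, mul_comm]

/-- The vectors of `V` lie on a sphere, and the products of distinct vectors are at most `m`. -/
structure IsSpherical (V : Set E4) (ρ m : ℝ) : Prop where
  finite : V.Finite
  norm : ∀ x ∈ V, inner ℝ x x = ρ
  le : ∀ x ∈ V, ∀ y ∈ V, x ≠ y → inner ℝ x y ≤ m
  lt : m < ρ

/-- The face of the convex hull of `V` where `inner n x ≤ c` is attained. -/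
def faceOf (V : Set E4) (n : E4) (c : ℝ) : Set E4 := {x ∈ convexHull ℝ V | inner ℝ n x = c}

lemma mem_faceOf {V : Set E4} {n : E4} {c : ℝ} {x : E4} (hx : x ∈ V) :
    x ∈ faceOf V n c ↔ inner ℝ n x = c :=
  and_iff_right (subset_convexHull ℝ V hx)

lemma inner_le_of_mem_convexHull {V : Set E4} {n : E4} {c : ℝ} (h : ∀ x ∈ V, inner ℝ n x ≤ c)
    {x : E4} (hx : x ∈ convexHull ℝ V) : inner ℝ n x ≤ c := by
  have : convexHull ℝ V ⊆ {z | (innerSL ℝ n) z ≤ c} :=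
    convexHull_min h (convex_halfSpace_le (innerSL ℝ n).toLinearMap.isLinear _)
  exact this hx

lemma isExposed_faceOf {V : Set E4} {n : E4} {c : ℝ} (h : ∀ x ∈ V, inner ℝ n x ≤ c) :
    IsExposed ℝ (convexHull ℝ V) (faceOf V n c) := by
  rintro ⟨w, hw⟩
  refine ⟨innerSL ℝ n, Set.Subset.antisymm ?_ ?_⟩
  · rintro x ⟨hx, hxc⟩
    refine ⟨hx, fun y hy => ?_⟩
    simp only [innerSL_apply_apply, hxc]
    exact inner_le_of_mem_convexHull h hy
  · rintro x ⟨hx, hmax⟩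
    refine ⟨hx, (inner_le_of_mem_convexHull h hx).antisymm ?_⟩
    have := hmax w hw.1
    simp only [innerSL_apply_apply, hw.2] at this
    exact this

/-- Every nonempty face is the set of maximizers of an inner product. -/
lemma exists_normal {V S : Set E4} (hS : IsExposed ℝ (convexHull ℝ V) S) (hne : S.Nonempty) :
    ∃ n : E4, ∀ x ∈ V, x ∈ S ↔ ∀ y ∈ V, inner ℝ n y ≤ inner ℝ n x := by
  obtain ⟨l, hl⟩ := hS hne
  refine ⟨(InnerProductSpace.toDual ℝ E4).symm l, fun x hx => ?_⟩
  simp only [InnerProductSpace.toDual_symm_apply]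
  rw [hl]
  refine ⟨fun h y hy => h.2 y (subset_convexHull ℝ V hy), fun h =>
    ⟨subset_convexHull ℝ V hx, fun y hy => ?_⟩⟩
  have : convexHull ℝ V ⊆ {z | l z ≤ l x} :=
    convexHull_min h (convex_halfSpace_le l.toLinearMap.isLinear _)
  exact this hy

namespace IsSpherical

variable {V : Set E4} {ρ m : ℝ} (h : IsSpherical V ρ m)
include h

lemma isFiniteHull : IsFiniteHull (convexHull ℝ V) := ⟨V, h.finite, rfl⟩

lemma inner_le (x : E4) (hx : x ∈ V) (y : E4) (hy : y ∈ V) : inner ℝ x y ≤ ρ := by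
  by_cases hxy : x = y
  · subst hxy; exact (h.norm x hx).le
  · exact (h.le x hx y hy hxy).trans h.lt.le

/-- On `V` the functional `inner ℝ x` is maximal at `x` only. -/
lemma vertices_eq : vertices (convexHull ℝ V) = V := by
  refine extremePoints_convexHull_subset.antisymm fun x hx => ?_
  rw [← h.isFiniteHull.isExposed_singleton_iff]
  have h1 := isExposed_faceOf (h.inner_le x hx)
  have hmem : x ∈ faceOf V x ρ := (mem_faceOf hx).2 (h.norm x hx)
  have h2 : faceOf V x ρ ∩ vertices (convexHull ℝ V) = {x} := by
    ext y
    constructor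
    · rintro ⟨hy, hyv⟩
      have hyV := extremePoints_convexHull_subset hyv
      by_contra hne
      have := h.le x hx y hyV (Ne.symm hne)
      rw [(mem_faceOf hyV).1 hy] at this
      exact absurd h.lt this.not_gt
    · rintro rfl
      refine ⟨hmem, ?_⟩
      obtain ⟨z, hz, hzf⟩ := h.isFiniteHull.exists_vertex h1 ⟨y, hmem⟩
      have hzV := extremePoints_convexHull_subset hz
      by_cases hzy : y = z
      · exact hzy ▸ hz
      · have := h.le y hx z hzV hzy
        rw [(mem_faceOf hzV).1 hzf] at this
        exact absurd h.lt this.not_gt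
  have h3 := h.isFiniteHull.face_eq h1
  rw [h2, convexHull_singleton] at h3
  rwa [h3] at h1

lemma face_ext {F G : Set E4} (hF : IsExposed ℝ (convexHull ℝ V) F)
    (hG : IsExposed ℝ (convexHull ℝ V) G) (hs : ∀ x ∈ V, x ∈ F ↔ x ∈ G) : F = G :=
  h.isFiniteHull.face_ext hF hG (by rwa [h.vertices_eq])

lemma face_subset {F G : Set E4} (hF : IsExposed ℝ (convexHull ℝ V) F)
    (hG : IsExposed ℝ (convexHull ℝ V) G) (hs : ∀ x ∈ V, x ∈ F → x ∈ G) : F ⊆ G :=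
  h.isFiniteHull.face_subset hF hG (by rwa [h.vertices_eq])

lemma exists_mem {F : Set E4} (hF : IsExposed ℝ (convexHull ℝ V) F) (hne : F.Nonempty) :
    ∃ x ∈ V, x ∈ F := by
  have := h.isFiniteHull.exists_vertex hF hne
  rwa [h.vertices_eq] at this

/-- Pairs at minimal distance span edges: any other point has product at most `m < ρ` with each of
`u` and `v`. -/
lemma edge_face {u v : E4} (hu : u ∈ V) (hv : v ∈ V) (huv : inner ℝ u v = m) :
    (∀ x ∈ V, inner ℝ (u + v) x ≤ ρ + m) ∧
      ∀ x ∈ V, inner ℝ (u + v) x = ρ + m ↔ x = u ∨ x = v := by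
  have key : ∀ x ∈ V, x ≠ u → x ≠ v → inner ℝ (u + v) x < ρ + m := by
    intro x hx hxu hxv
    rw [inner_add_left]
    have h1 := h.le u hu x hx hxu.symm
    have h2 := h.le v hv x hx hxv.symm
    have := h.lt
    linarith
  have eu : inner ℝ (u + v) u = ρ + m := by
    rw [inner_add_left, h.norm u hu, real_inner_comm, huv]
  have ev : inner ℝ (u + v) v = ρ + m := by
    rw [inner_add_left, h.norm v hv, huv, add_comm]
  constructor
  · intro x hx
    by_cases hxu : x = u
    · rw [hxu, eu]
    by_cases hxv : x = v
    · rw [hxv, ev]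
    exact (key x hx hxu hxv).le
  · intro x hx
    constructor
    · intro he
      by_contra! hc
      exact (key x hx hc.1 hc.2).ne he
    · rintro (rfl | rfl)
      · exact eu
      · exact ev

end IsSpherical

/-- A face that misses a vertex of each of the two ignored facets is not ignored, so its functional
or tangency data is available. -/
lemma notMem_bad {V F G S : Set E4} (hF : ∃ x ∈ V, x ∈ F ∧ x ∉ S) (hG : ∃ x ∈ V, x ∈ G ∧ x ∉ S) :
    S ∉ ({convexHull ℝ V, F, G} : Set (Set E4)) := by
  obtain ⟨x, hx, hxF, hxS⟩ := hF
  obtain ⟨y, hy, hyF, hyS⟩ := hG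
  rintro (rfl | rfl | rfl)
  · exact hxS (subset_convexHull ℝ V hx)
  · exact hxS hxF
  · exact hyS hyF

/-- A scribing of the convex hull of `V` that ignores two faces with at least three vertices. -/
structure IsPartialScribing (V F G : Set E4) (W : E4 → M5) : Prop where
  scribing : Scribing (convexHull ℝ V) {convexHull ℝ V, F, G} W
  three_F : ∀ u v : E4, ∃ x ∈ V, x ∈ F ∧ x ≠ u ∧ x ≠ v
  three_G : ∀ u v : E4, ∃ x ∈ V, x ∈ G ∧ x ≠ u ∧ x ≠ v

namespace IsPartialScribing

variable {V F G : Set E4} {W : E4 → M5} {ρ m : ℝ} (hW : IsPartialScribing V F G W)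
  (h : IsSpherical V ρ m)
include hW h

lemma pos {x : E4} (hx : x ∈ V) : 0 < (W x).2 :=
  hW.scribing.pos x (by rwa [h.vertices_eq])

lemma functional {n : E4} {c : ℝ} (hn : ∀ x ∈ V, inner ℝ n x ≤ c) (hex : ∃ x ∈ V, inner ℝ n x = c)
    (hF : ∃ x ∈ V, x ∈ F ∧ inner ℝ n x ≠ c) (hG : ∃ x ∈ V, x ∈ G ∧ inner ℝ n x ≠ c) :
    ∃ L : M5 →ₗ[ℝ] ℝ, ∀ x ∈ V, 0 ≤ L (W x) ∧ (L (W x) = 0 ↔ inner ℝ n x = c) := by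
  obtain ⟨x, hx, hxc⟩ := hex
  obtain ⟨L, hL⟩ := hW.scribing.face (faceOf V n c) (isExposed_faceOf hn)
    ⟨x, (mem_faceOf hx).2 hxc⟩ (notMem_bad
      (hF.imp fun y hy => ⟨hy.1, hy.2.1, fun hm => hy.2.2 ((mem_faceOf hy.1).1 hm)⟩)
      (hG.imp fun y hy => ⟨hy.1, hy.2.1, fun hm => hy.2.2 ((mem_faceOf hy.1).1 hm)⟩))
  rw [h.vertices_eq] at hL
  exact ⟨L, fun y hy => by rw [← mem_faceOf hy]; exact hL y hy⟩

lemma vertex {v : E4} (hv : v ∈ V) :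
    ∃ L : M5 →ₗ[ℝ] ℝ, L (W v) = 0 ∧ ∀ x ∈ V, x ≠ v → 0 < L (W x) := by
  have key : ∀ x ∈ V, inner ℝ v x = ρ ↔ x = v := by
    intro x hx
    constructor
    · intro hi
      by_contra hne
      have := h.le v hv x hx (Ne.symm hne)
      have := h.lt
      linarith
    · rintro rfl
      exact h.norm x hx
  obtain ⟨L, hL⟩ := hW.functional h (h.inner_le v hv) ⟨v, hv, h.norm v hv⟩
    ((hW.three_F v v).imp fun x hx => ⟨hx.1, hx.2.1, fun hi => hx.2.2.1 ((key x hx.1).1 hi)⟩)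
    ((hW.three_G v v).imp fun x hx => ⟨hx.1, hx.2.1, fun hi => hx.2.2.1 ((key x hx.1).1 hi)⟩)
  refine ⟨L, (hL v hv).2.2 (h.norm v hv), fun x hx hxv => ?_⟩
  exact lt_of_le_of_ne (hL x hx).1 fun h0 => hxv ((key x hx).1 ((hL x hx).2.1 h0.symm))

lemma ne {u v : E4} (hu : u ∈ V) (hv : v ∈ V) (huv : u ≠ v) : W u ≠ W v := by
  intro he
  obtain ⟨L, hL, hL'⟩ := hW.vertex h hv
  have := hL' u hu huv
  rw [he, hL] at this
  exact lt_irrefl _ this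

lemma edge_functional {u v : E4} (hu : u ∈ V) (hv : v ∈ V) (huv : inner ℝ u v = m) :
    ∃ L : M5 →ₗ[ℝ] ℝ, L (W u) = 0 ∧ L (W v) = 0 ∧ ∀ x ∈ V, x ≠ u → x ≠ v → 0 < L (W x) := by
  obtain ⟨hle, key⟩ := h.edge_face hu hv huv
  have hne : ∀ x ∈ V, x ≠ u ∧ x ≠ v → inner ℝ (u + v) x ≠ ρ + m := fun x hx hxn hi =>
    ((key x hx).1 hi).elim hxn.1 hxn.2
  obtain ⟨L, hL⟩ := hW.functional h hle ⟨u, hu, (key u hu).2 (Or.inl rfl)⟩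
    ((hW.three_F u v).imp fun x hx => ⟨hx.1, hx.2.1, hne x hx.1 hx.2.2⟩)
    ((hW.three_G u v).imp fun x hx => ⟨hx.1, hx.2.1, hne x hx.1 hx.2.2⟩)
  refine ⟨L, (hL u hu).2.2 ((key u hu).2 (Or.inl rfl)), (hL v hv).2.2 ((key v hv).2 (Or.inr rfl)),
    fun x hx hxu hxv => ?_⟩
  exact lt_of_le_of_ne (hL x hx).1 fun h0 => hne x hx ⟨hxu, hxv⟩ ((hL x hx).2.1 h0.symm)

lemma edge {u v : E4} (hu : u ∈ V) (hv : v ∈ V) (huv : inner ℝ u v = m) :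
    (lor (W u) (W u) = 0 ∨ lor (W u) (W u) = 1) ∧
      lor (W u) (W v) = -(lor (W u) (W u) * lor (W v) (W v)) := by
  obtain ⟨hle, key⟩ := h.edge_face hu hv huv
  have hne : u ≠ v := by
    rintro rfl
    rw [h.norm u hu] at huv
    exact h.lt.ne' huv
  refine hW.scribing.edge _ (isExposed_faceOf hle) (notMem_bad ?_ ?_) u
    (by rwa [h.vertices_eq]) v (by rwa [h.vertices_eq]) hne ?_
  · obtain ⟨x, hx, hxF, hxu, hxv⟩ := hW.three_F u v
    refine ⟨x, hx, hxF, ?_⟩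
    rw [mem_faceOf hx, key x hx]
    exact fun h => h.elim hxu hxv
  · obtain ⟨x, hx, hxF, hxu, hxv⟩ := hW.three_G u v
    refine ⟨x, hx, hxF, ?_⟩
    rw [mem_faceOf hx, key x hx]
    exact fun h => h.elim hxu hxv
  · intro z hz
    rw [h.vertices_eq] at hz
    rw [mem_faceOf hz, key z hz]

/-- No vertex of a triangle of edges lies on the sphere: its null lift would be orthogonal to both
neighbors and therefore parallel to the tangency point of the opposite edge. -/
lemma norm_of_triangle {u v w : E4} (hu : u ∈ V) (hv : v ∈ V) (hw : w ∈ V)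
    (huv : inner ℝ u v = m) (huw : inner ℝ u w = m) (hvw : inner ℝ v w = m) :
    lor (W u) (W u) = 1 := by
  have hne : ∀ {x y : E4}, x ∈ V → inner ℝ x y = m → y ≠ x := by
    rintro x y hx hxy rfl
    rw [h.norm _ hx] at hxy
    exact h.lt.ne' hxy
  obtain ⟨L, hL, hL'⟩ := hW.vertex h hu
  have hwv : inner ℝ w v = m := by rw [real_inner_comm, hvw]
  exact nonnull_of_triangle (hW.edge h hu hv huv).1 (hW.edge h hv hw hvw).1
    (hW.edge h hw hv hwv).1 (hW.edge h hu hv huv).2 (hW.edge h hu hw huw).2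
    (hW.edge h hv hw hvw).2 (hW.pos h hu) (hW.pos h hv) (hW.pos h hw) hL
    (hL' v hv (hne hu huv)) (hL' w hw (hne hu huw))

end IsPartialScribing

/-- Linear symmetries of the vertex set act on the face lattice. -/
lemma exists_automorphism {V : Set E4} {ρ m : ℝ} (hV : IsSpherical V ρ m) (T : E4 ≃ₗ[ℝ] E4)
    (hT : ∀ x ∈ V, T x ∈ V) (hT' : ∀ x ∈ V, T.symm x ∈ V)
    (r F s f : FaceLattice (convexHull ℝ V)) (hr : ∀ x ∈ V, T x ∈ s.1 ↔ x ∈ r.1)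
    (hF : ∀ x ∈ V, T x ∈ f.1 ↔ x ∈ F.1) :
    ∃ Θ : FaceLattice (convexHull ℝ V) ≃o FaceLattice (convexHull ℝ V), Θ r = s ∧ Θ F = f := by
  have himg : ∀ (T : E4 ≃ₗ[ℝ] E4), (∀ x ∈ V, T x ∈ V) → (∀ x ∈ V, T.symm x ∈ V) →
      T '' convexHull ℝ V = convexHull ℝ V := by
    intro T hT hT'
    have : T '' V = V := by
      apply Set.Subset.antisymm
      · rintro _ ⟨x, hx, rfl⟩
        exact hT x hx
      · intro x hx
        exact ⟨T.symm x, hT' x hx, by simp⟩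
    have h2 := (T : E4 →ₗ[ℝ] E4).image_convexHull V
    simp only [LinearEquiv.coe_coe] at h2
    rw [h2, this]
  have hexp : ∀ (T : E4 ≃ₗ[ℝ] E4), (∀ x ∈ V, T x ∈ V) → (∀ x ∈ V, T.symm x ∈ V) →
      ∀ S, IsExposed ℝ (convexHull ℝ V) S → IsExposed ℝ (convexHull ℝ V) (T '' S) := by
    rintro T hT hT' S hS ⟨_, w, hw, rfl⟩
    obtain ⟨l, hl⟩ := hS ⟨w, hw⟩
    have h1 := himg T hT hT'
    have hmem : ∀ z ∈ convexHull ℝ V, T z ∈ convexHull ℝ V := fun z hz =>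
      h1 ▸ Set.mem_image_of_mem T hz
    refine ⟨LinearMap.toContinuousLinearMap (l.toLinearMap ∘ₗ (T.symm : E4 →ₗ[ℝ] E4)),
      Set.Subset.antisymm ?_ ?_⟩
    · rintro _ ⟨x, hx, rfl⟩
      rw [hl] at hx
      refine ⟨hmem x hx.1, fun y hy => ?_⟩
      rw [← h1] at hy
      obtain ⟨z, hz, rfl⟩ := hy
      simpa using hx.2 z hz
    · rintro x ⟨hx, hmax⟩
      rw [← h1] at hx
      obtain ⟨z, hz, rfl⟩ := hx
      refine ⟨z, ?_, rfl⟩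
      rw [hl]
      exact ⟨hz, fun y hy => by simpa using hmax (T y) (hmem y hy)⟩
  let Θ : FaceLattice (convexHull ℝ V) ≃o FaceLattice (convexHull ℝ V) :=
    { toFun := fun S => ⟨T '' S.1, hexp T hT hT' S.1 S.2⟩
      invFun := fun S => ⟨T.symm '' S.1, hexp T.symm hT' (by simpa using hT) S.1 S.2⟩
      left_inv := fun S => Subtype.ext (by simp [Set.image_image])
      right_inv := fun S => Subtype.ext (by simp [Set.image_image])
      map_rel_iff' := fun {a b} => Set.image_subset_image_iff T.injective }
  have key : ∀ (A B : FaceLattice (convexHull ℝ V)), (∀ x ∈ V, T x ∈ B.1 ↔ x ∈ A.1) →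
      Θ A = B := by
    intro A B hAB
    refine Subtype.ext (hV.face_ext (Θ A).2 B.2 fun y hy => ?_)
    have h1 := hAB (T.symm y) (hT' y hy)
    rw [LinearEquiv.apply_symm_apply] at h1
    rw [h1]
    change y ∈ T '' A.1 ↔ _
    constructor
    · rintro ⟨x, hx, rfl⟩
      simpa using hx
    · intro hx
      exact ⟨_, hx, by simp⟩
  exact ⟨Θ, key r s hr, key F f hF⟩

/-! ### Signed permutations and signs -/

/-- Signed permutation of the coordinates. -/
noncomputable def signedPerm (σ : Fin 4 → ℝ) (hσ : ∀ i, σ i * σ i = 1) (e : Equiv.Perm (Fin 4)) :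
    E4 ≃ₗ[ℝ] E4 where
  toFun x := WithLp.toLp 2 fun k => σ k * x (e k)
  invFun y := WithLp.toLp 2 fun k => σ (e.symm k) * y (e.symm k)
  map_add' x y := by ext k; simp [mul_add]
  map_smul' c x := by ext k; simp; ring
  left_inv x := by ext k; simp [← mul_assoc, hσ]
  right_inv x := by ext k; simp [← mul_assoc, hσ]

lemma signedPerm_apply (σ : Fin 4 → ℝ) (hσ : ∀ i, σ i * σ i = 1) (e : Equiv.Perm (Fin 4)) (x : E4)
    (k : Fin 4) : signedPerm σ hσ e x k = σ k * x (e k) := rfl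

lemma signedPerm_symm_apply (σ : Fin 4 → ℝ) (hσ : ∀ i, σ i * σ i = 1) (e : Equiv.Perm (Fin 4))
    (x : E4) (k : Fin 4) :
    (signedPerm σ hσ e).symm x k = σ (e.symm k) * x (e.symm k) := rfl

lemma exists_ne_ne {V F : Set E4} {a b c : E4} (ha : a ∈ V) (hb : b ∈ V) (hc : c ∈ V) (haF : a ∈ F)
    (hbF : b ∈ F) (hcF : c ∈ F) (hab : a ≠ b) (hac : a ≠ c) (hbc : b ≠ c) (u v : E4) :
    ∃ x ∈ V, x ∈ F ∧ x ≠ u ∧ x ≠ v := by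
  by_cases ha' : a ≠ u ∧ a ≠ v
  · exact ⟨a, ha, haF, ha'⟩
  by_cases hb' : b ≠ u ∧ b ≠ v
  · exact ⟨b, hb, hbF, hb'⟩
  refine ⟨c, hc, hcF, ?_, ?_⟩ <;> rintro rfl <;> grind

/-- The sign of a real number, with the convention that the sign of zero is positive. -/
noncomputable def sgn (t : ℝ) : ℝ := if 0 ≤ t then 1 else -1

lemma sgn_mul_self (t : ℝ) : sgn t * sgn t = 1 := by
  unfold sgn; split_ifs <;> norm_num

lemma sgn_eq (t : ℝ) : sgn t = 1 ∨ sgn t = -1 := by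
  unfold sgn; split_ifs <;> simp

lemma mul_sgn (t : ℝ) : t * sgn t = |t| := by
  unfold sgn
  split_ifs with h
  · rw [mul_one, abs_of_nonneg h]
  · rw [abs_of_neg (not_le.1 h)]; ring

lemma eq_sgn {t a : ℝ} (ht : t ≠ 0) (h : t * a = |t|) : a = sgn t := by
  rw [← mul_sgn] at h
  exact mul_left_cancel₀ ht h

/-! ### The orthoplex: dihedral angle `π / 2` -/

section Orthoplex

/-- The vertices of the regular orthoplex. -/
def orthoplexVertices : Set E4 :=
  {x | ∃ (i : Fin 4) (a : ℝ), (a = 1 ∨ a = -1) ∧ x = EuclideanSpace.single i a}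

lemma inner_single_right (n : E4) (i : Fin 4) (a : ℝ) :
    inner ℝ n (EuclideanSpace.single i a) = n i * a := by
  rw [EuclideanSpace.inner_single_right]
  simp [mul_comm]

lemma single_mem {i : Fin 4} {a : ℝ} (ha : a = 1 ∨ a = -1) :
    EuclideanSpace.single i a ∈ orthoplexVertices := ⟨i, a, ha, rfl⟩

lemma isSpherical_orthoplex : IsSpherical orthoplexVertices 1 0 where
  finite := by
    have : orthoplexVertices ⊆ Set.range fun p : Fin 4 × Bool =>
        (EuclideanSpace.single p.1 (if p.2 then (1 : ℝ) else -1) : E4) := by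
      rintro _ ⟨i, a, rfl | rfl, rfl⟩
      · exact ⟨(i, true), by simp⟩
      · exact ⟨(i, false), by simp⟩
    exact (Set.finite_range _).subset this
  norm := by
    rintro _ ⟨i, a, ha, rfl⟩
    rw [inner_single_right]
    rcases ha with rfl | rfl <;> simp
  le := by
    rintro _ ⟨i, a, ha, rfl⟩ _ ⟨j, b, hb, rfl⟩ hne
    rw [inner_single_right]
    by_cases hij : j = i
    · subst hij
      rcases ha with rfl | rfl <;> rcases hb with rfl | rfl <;> simp at hne ⊢
    · simp [hij]
  lt := one_pos

/-- The vector with the given coordinates. -/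
noncomputable abbrev vec (τ : Fin 4 → ℝ) : E4 := WithLp.toLp 2 τ

lemma orthoplex_le {τ : Fin 4 → ℝ} (hτ : ∀ i, |τ i| ≤ 1) :
    ∀ x ∈ orthoplexVertices, inner ℝ (vec τ) x ≤ 1 := by
  rintro _ ⟨i, a, ha, rfl⟩
  rw [inner_single_right]
  have := abs_le.1 (hτ i)
  rcases ha with rfl | rfl
  · simpa using this.2
  · have := this.1
    simp only [mul_neg, mul_one]
    linarith

lemma abs_sgn (t : ℝ) : |sgn t| = 1 := by
  rcases sgn_eq t with h | h <;> rw [h] <;> simp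

/-- A vertex on the face with normal `n` is `sgn (n i)` times a unit vector for which `|n i|` is
maximal. So the face lies in the facet with the signs of `n`, and a facet equals it by maximality.
-/
lemma orthoplex_facet {f : Set E4} (hf : IsFacet (convexHull ℝ orthoplexVertices) f) :
    ∃ σ : Fin 4 → ℝ, (∀ i, σ i = 1 ∨ σ i = -1) ∧ f = faceOf orthoplexVertices (vec σ) 1 := by
  obtain ⟨hf, hne, hn, hmax⟩ := hf
  obtain ⟨n, hnf⟩ := exists_normal hf hne
  have hsph := isSpherical_orthoplex
  refine ⟨fun i => sgn (n i), fun i => sgn_eq _, ?_⟩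
  have hexp := isExposed_faceOf (V := orthoplexVertices)
    (orthoplex_le (τ := fun i => sgn (n i)) fun i => (abs_sgn _).le)
  have hsub : f ⊆ faceOf orthoplexVertices (vec fun i => sgn (n i)) 1 := by
    refine hsph.face_subset hf hexp ?_
    rintro x hx hxf
    obtain ⟨i, a, ha, rfl⟩ := hx
    have hmaxi := (hnf _ (single_mem ha)).1 hxf
    rw [mem_faceOf (single_mem ha), inner_single_right]
    have hk : ∀ k, |n k| ≤ n i * a := by
      intro k
      have := hmaxi _ (single_mem (i := k) (sgn_eq (n k)))
      rwa [inner_single_right, inner_single_right, mul_sgn] at this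
    have hle : n i * a ≤ |n i| := by
      rcases ha with rfl | rfl
      · simpa using le_abs_self (n i)
      · simpa using neg_abs_le (n i) |> fun h => (neg_le.1 h : -n i ≤ |n i|)
    have hi0 : n i ≠ 0 := by
      intro h0
      apply hn
      refine hsph.face_ext hf (IsExposed.refl _) fun y hy =>
        iff_of_true ((hnf y hy).2 ?_) (subset_convexHull ℝ _ hy)
      have hz : ∀ k, n k = 0 := fun k => by
        have := hk k
        rw [h0, zero_mul] at this
        exact abs_nonpos_iff.1 this
      intro z _
      simp [inner_eq_sum, hz]
    rw [eq_sgn hi0 (le_antisymm hle (hk i))]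
    exact sgn_mul_self _
  rcases hmax _ hexp hsub with h | h
  · exact h.symm
  · exfalso
    have hmem : EuclideanSpace.single 0 (-sgn (n 0)) ∈ orthoplexVertices :=
      single_mem (by rcases sgn_eq (n 0) with h | h <;> rw [h] <;> simp)
    have h1 : EuclideanSpace.single 0 (-sgn (n 0)) ∈
        faceOf orthoplexVertices (vec fun i => sgn (n i)) 1 :=
      h ▸ subset_convexHull ℝ _ hmem
    rw [mem_faceOf hmem, inner_single_right, mul_neg] at h1
    have := sgn_mul_self (n 0)
    change -(sgn (n 0) * sgn (n 0)) = 1 at h1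
    linarith

/-- A proper face of the simplex misses some vertex `σ j` on the axis `j`, hence lies in the
triangle opposite to it. -/
lemma orthoplex_ridge {σ : Fin 4 → ℝ} (hσ : ∀ i, σ i = 1 ∨ σ i = -1) {s : Set E4}
    (hs : IsRidgeOf (convexHull ℝ orthoplexVertices) (faceOf orthoplexVertices (vec σ) 1) s) :
    ∃ j, s = faceOf orthoplexVertices (vec fun k => if k = j then 0 else σ k) 1 := by
  obtain ⟨hs, hne, hsf, hn, hmax⟩ := hs
  have hsph := isSpherical_orthoplex
  have habs : ∀ i, |σ i| ≤ 1 := fun i => by rcases hσ i with h | h <;> rw [h] <;> simp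
  have hsq : ∀ i, σ i * σ i = 1 := fun i => by rcases hσ i with h | h <;> rw [h] <;> simp
  have hfexp := isExposed_faceOf (V := orthoplexVertices) (orthoplex_le habs)
  obtain ⟨x, hx, hxf, hxs⟩ : ∃ x ∈ orthoplexVertices,
      x ∈ faceOf orthoplexVertices (vec σ) 1 ∧ x ∉ s := by
    by_contra! hc
    exact hn (hsf.antisymm (hsph.face_subset hfexp hs hc))
  obtain ⟨j, a, ha, rfl⟩ := hx
  rw [mem_faceOf (single_mem ha), inner_single_right] at hxf
  have haσ : a = σ j := by
    have : σ j * a = σ j * σ j := by rw [hsq]; exact hxf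
    exact mul_left_cancel₀ (fun h0 => by simpa [h0] using hsq j) this
  subst haσ
  have hexp := isExposed_faceOf (V := orthoplexVertices)
    (orthoplex_le (τ := fun k => if k = j then 0 else σ k) fun i => by
      by_cases h : i = j <;> simp [h, habs])
  refine ⟨j, ?_⟩
  have h1 : s ⊆ faceOf orthoplexVertices (vec fun k => if k = j then 0 else σ k) 1 := by
    refine hsph.face_subset hs hexp ?_
    rintro x hx hxs'
    obtain ⟨i, b, hb, rfl⟩ := hx
    have h2 := (mem_faceOf (single_mem hb)).1 (hsf hxs')
    rw [inner_single_right] at h2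
    rw [mem_faceOf (single_mem hb), inner_single_right]
    by_cases hij : i = j
    · subst hij
      have : b = σ i := by
        have : σ i * b = σ i * σ i := by rw [hsq]; exact h2
        exact mul_left_cancel₀ (fun h0 => by simpa [h0] using hsq i) this
      rw [this] at hxs'
      exact absurd hxs' hxs
    · simpa [hij] using h2
  have h2 : faceOf orthoplexVertices (vec fun k => if k = j then 0 else σ k) 1 ⊆
      faceOf orthoplexVertices (vec σ) 1 := by
    refine hsph.face_subset hexp hfexp ?_
    rintro x hx hxs'
    obtain ⟨i, b, hb, rfl⟩ := hx
    rw [mem_faceOf (single_mem hb), inner_single_right] at hxs' ⊢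
    by_cases hij : i = j
    · simp [hij] at hxs'
    · simpa [hij] using hxs'
  rcases hmax _ hexp h1 h2 with h | h
  · exact h.symm
  · exfalso
    have h3 : EuclideanSpace.single j (σ j) ∈ faceOf orthoplexVertices (vec σ) 1 :=
      (mem_faceOf (single_mem ha)).2 (by rw [inner_single_right]; exact hsq j)
    rw [← h, mem_faceOf (single_mem ha), inner_single_right] at h3
    simp at h3

lemma signedPerm_single (σ : Fin 4 → ℝ) (hσ : ∀ i, σ i * σ i = 1) (e : Equiv.Perm (Fin 4))
    (i : Fin 4) (a : ℝ) : signedPerm σ hσ e (EuclideanSpace.single i a) =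
      EuclideanSpace.single (e.symm i) (σ (e.symm i) * a) := by
  ext k
  rw [signedPerm_apply]
  by_cases hk : k = e.symm i
  · subst hk; simp
  · have : e k ≠ i := fun h => hk (by rw [← h]; simp)
    simp [hk, this]

lemma signedPerm_symm_single (σ : Fin 4 → ℝ) (hσ : ∀ i, σ i * σ i = 1) (e : Equiv.Perm (Fin 4))
    (i : Fin 4) (a : ℝ) : (signedPerm σ hσ e).symm (EuclideanSpace.single i a) =
      EuclideanSpace.single (e i) (σ i * a) := by
  rw [LinearEquiv.symm_apply_eq, signedPerm_single, Equiv.symm_apply_apply, ← mul_assoc, hσ,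
    one_mul]

lemma sign_mul {a b : ℝ} (ha : a = 1 ∨ a = -1) (hb : b = 1 ∨ b = -1) :
    a * b = 1 ∨ a * b = -1 := by
  rcases ha with rfl | rfl <;> rcases hb with rfl | rfl <;> simp

/-- Every vertex off the ridge considered here has product `-1` with the ridge vertices, and so does
`w 0 + w 1 + w 2`; subtracting gives the normals. Their norm is `1 + 6 - 3 = 4`, and their product
is `-3 + 3 + 3 - 3 = 0` since opposite vertices have product `-3`. -/
lemma orthoplex_hinge {W : E4 → M5}
    (hW : Scribing (convexHull ℝ orthoplexVertices) {convexHull ℝ orthoplexVertices,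
      faceOf orthoplexVertices (vec fun _ => 1) 1,
      faceOf orthoplexVertices (vec fun k => if k = 3 then -1 else 1) 1} W) :
    IsHinge orthoplexVertices W (faceOf orthoplexVertices (vec fun k => if k = 3 then 0 else 1) 1)
      (faceOf orthoplexVertices (vec fun _ => 1) 1)
      (faceOf orthoplexVertices (vec fun k => if k = 3 then -1 else 1) 1) 4 0 := by
  have hsph := isSpherical_orthoplex
  have mem₁ : ∀ i : Fin 4, (EuclideanSpace.single i 1 : E4) ∈ orthoplexVertices := fun i =>
    single_mem (Or.inl rfl)
  have mem₂ : ∀ i : Fin 4, (EuclideanSpace.single i (-1) : E4) ∈ orthoplexVertices := fun i =>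
    single_mem (Or.inr rfl)
  have hne : ∀ i j : Fin 4, i ≠ j → (EuclideanSpace.single i 1 : E4) ≠ EuclideanSpace.single j 1 := by
    intro i j hij h
    have := congrArg (fun x : E4 => x i) h
    simp [hij] at this
  have hP : IsPartialScribing orthoplexVertices (faceOf orthoplexVertices (vec fun _ => 1) 1)
      (faceOf orthoplexVertices (vec fun k => if k = 3 then -1 else 1) 1) W := by
    refine ⟨hW, fun u v => exists_ne_ne (mem₁ 0) (mem₁ 1) (mem₁ 2) ?_ ?_ ?_ (hne _ _ ?_)
        (hne _ _ ?_) (hne _ _ ?_) u v,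
      fun u v => exists_ne_ne (mem₁ 0) (mem₁ 1) (mem₁ 2) ?_ ?_ ?_ (hne _ _ ?_)
        (hne _ _ ?_) (hne _ _ ?_) u v⟩ <;>
    first
    | decide
    | (rw [mem_faceOf (mem₁ _), inner_single_right]; simp)
  have hother : ∀ i : Fin 4, ∃ j k : Fin 4, i ≠ j ∧ i ≠ k ∧ j ≠ k := by decide
  have hin : ∀ (i j : Fin 4) (a b : ℝ), i ≠ j →
      inner ℝ (EuclideanSpace.single i a : E4) (EuclideanSpace.single j b) = 0 := by
    intro i j a b hij
    rw [inner_single_right]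
    simp [hij.symm]
  have norm : ∀ (i : Fin 4) (a : ℝ), (a = 1 ∨ a = -1) →
      lor (W (EuclideanSpace.single i a)) (W (EuclideanSpace.single i a)) = 1 := by
    intro i a ha
    obtain ⟨j, k, hij, hik, hjk⟩ := hother i
    exact hP.norm_of_triangle hsph (single_mem ha) (mem₁ j) (mem₁ k) (hin _ _ _ _ hij)
      (hin _ _ _ _ hik) (hin _ _ _ _ hjk)
  have prod : ∀ (i j : Fin 4) (a b : ℝ), (a = 1 ∨ a = -1) → (b = 1 ∨ b = -1) → i ≠ j →
      lor (W (EuclideanSpace.single i a)) (W (EuclideanSpace.single j b)) = -1 := by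
    intro i j a b ha hb hij
    rw [(hP.edge hsph (single_mem ha) (single_mem hb) (hin _ _ _ _ hij)).2, norm i a ha,
      norm j b hb, one_mul]
  have opp := orthoplex_rigid (fun i => W (EuclideanSpace.single i 1))
    (fun i => W (EuclideanSpace.single i (-1))) (fun i => norm i 1 (Or.inl rfl))
    (fun i => norm i _ (Or.inr rfl)) (fun i j => prod i j _ _ (Or.inl rfl) (Or.inl rfl))
    (fun i j => prod i j _ _ (Or.inr rfl) (Or.inr rfl))
    (fun i j => prod i j _ _ (Or.inl rfl) (Or.inr rfl)) (fun i => hP.pos hsph (mem₁ i))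
    (fun i => hP.ne hsph (mem₁ i) (mem₂ i) (fun h => by
      have := congrArg (fun x : E4 => x i) h
      norm_num at this))
  have opp3 := opp 3
  set w : Fin 4 → M5 := fun i => W (EuclideanSpace.single i 1) with hw
  set w' : M5 := W (EuclideanSpace.single 3 (-1)) with hw'
  have ww : ∀ i j, i ≠ j → lor (w i) (w j) = -1 := fun i j =>
    prod i j _ _ (Or.inl rfl) (Or.inl rfl)
  have wn : ∀ i, lor (w i) (w i) = 1 := fun i => norm i 1 (Or.inl rfl)
  have ww' : ∀ i, i ≠ 3 → lor w' (w i) = -1 := fun i hi =>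
    prod 3 i _ _ (Or.inr rfl) (Or.inl rfl) hi.symm
  have wn' : lor w' w' = 1 := norm 3 _ (Or.inr rfl)
  have h01 := ww 0 1 (by decide)
  have h02 := ww 0 2 (by decide)
  have h03 := ww 0 3 (by decide)
  have h12 := ww 1 2 (by decide)
  have h13 := ww 1 3 (by decide)
  have h23 := ww 2 3 (by decide)
  have h10 := ww 1 0 (by decide)
  have h20 := ww 2 0 (by decide)
  have h30 := ww 3 0 (by decide)
  have h21 := ww 2 1 (by decide)
  have h31 := ww 3 1 (by decide)
  have h32 := ww 3 2 (by decide)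
  have g0 := ww' 0 (by decide)
  have g1 := ww' 1 (by decide)
  have g2 := ww' 2 (by decide)
  have g0' : lor (w 0) w' = -1 := by rw [lor_comm, g0]
  have g1' : lor (w 1) w' = -1 := by rw [lor_comm, g1]
  have g2' : lor (w 2) w' = -1 := by rw [lor_comm, g2]
  have opp3' : lor (w 3) w' = -3 := opp3
  have mem_r : ∀ x ∈ orthoplexVertices,
      x ∈ faceOf orthoplexVertices (vec fun k => if k = 3 then 0 else 1) 1 →
      ∃ i : Fin 4, i ≠ 3 ∧ x = EuclideanSpace.single i 1 := by
    rintro x hx hxr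
    obtain ⟨i, a, ha, rfl⟩ := hx
    rw [mem_faceOf (single_mem ha), inner_single_right] at hxr
    by_cases hi : i = 3
    · simp [hi] at hxr
    · simp only [hi, if_false, one_mul] at hxr
      exact ⟨i, hi, by rw [hxr]⟩
  have r_mem : ∀ i : Fin 4, i ≠ 3 → (EuclideanSpace.single i 1 : E4) ∈
      faceOf orthoplexVertices (vec fun k => if k = 3 then 0 else 1) 1 := by
    intro i hi
    rw [mem_faceOf (mem₁ i), inner_single_right]
    simp [hi]
  have in_span : ∀ i : Fin 4, i ≠ 3 → w i ∈ Submodule.span ℝ (W '' (orthoplexVertices ∩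
      faceOf orthoplexVertices (vec fun k => if k = 3 then 0 else 1) 1)) := fun i hi =>
    Submodule.subset_span ⟨_, ⟨mem₁ i, r_mem i hi⟩, rfl⟩
  have sum_span : w 0 + w 1 + w 2 ∈ Submodule.span ℝ (W '' (orthoplexVertices ∩
      faceOf orthoplexVertices (vec fun k => if k = 3 then 0 else 1) 1)) :=
    Submodule.add_mem _ (Submodule.add_mem _ (in_span 0 (by decide)) (in_span 1 (by decide)))
      (in_span 2 (by decide))
  refine ⟨⟨_, mem₁ 0, _, mem₁ 1, _, mem₁ 2, r_mem 0 (by decide), r_mem 1 (by decide),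
    r_mem 2 (by decide), wn 0, wn 1, wn 2, h01, h12, h02.le, hP.pos hsph (mem₁ 0),
    hP.pos hsph (mem₁ 1)⟩, w 3 - (w 0 + w 1 + w 2), w' - (w 0 + w 1 + w 2),
    ⟨?_, ?_, ?_⟩, ⟨?_, ?_, ?_⟩, ?_⟩
  · intro x hx hxr
    obtain ⟨i, hi, rfl⟩ := mem_r x hx hxr
    change lor _ (w i) = 0
    fin_cases i <;>
    simp [wn, h01, h02, h12, h10, h20, h30, h21, h31, h32] at hi ⊢
  · simp only [map_sub, map_add, LinearMap.sub_apply, LinearMap.add_apply, wn, h01, h02, h03, h12,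
      h13, h23, h10, h20, h30, h21, h31, h32]
    norm_num
  · intro x hx hxF hxr
    obtain ⟨i, a, ha, rfl⟩ := hx
    rw [mem_faceOf (single_mem ha), inner_single_right, one_mul] at hxF
    subst hxF
    obtain rfl : i = 3 := by
      by_contra hi
      exact hxr (r_mem i hi)
    rw [sub_sub_cancel]
    exact sum_span
  · intro x hx hxr
    obtain ⟨i, hi, rfl⟩ := mem_r x hx hxr
    change lor _ (w i) = 0
    fin_cases i <;>
    simp [wn, h01, h02, h12, h10, h20, g0, h21, g1, g2] at hi ⊢
  · simp only [map_sub, map_add, LinearMap.sub_apply, LinearMap.add_apply, wn, h01, h02, h12,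
      h10, h20, h21, g0, g1, g2, g0', g1', g2', wn']
    norm_num
  · intro x hx hxF hxr
    obtain ⟨i, a, ha, rfl⟩ := hx
    rw [mem_faceOf (single_mem ha), inner_single_right] at hxF
    by_cases hi : i = 3
    · subst hi
      simp only [if_true] at hxF
      obtain rfl : a = -1 := by linarith
      rw [sub_sub_cancel]
      exact sum_span
    · simp only [hi, if_false, one_mul] at hxF
      subst hxF
      exact absurd (r_mem i hi) hxr
  · simp only [map_sub, map_add, LinearMap.sub_apply, LinearMap.add_apply, wn, h01, h02, h12,
      h10, h20, h30, h21, h31, h32, g0', g1', g2', opp3']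
    norm_num

lemma isModel_orthoplex : IsModel orthoplexVertices
    (faceOf orthoplexVertices (vec fun k => if k = 3 then 0 else 1) 1)
    (faceOf orthoplexVertices (vec fun _ => 1) 1)
    (faceOf orthoplexVertices (vec fun k => if k = 3 then -1 else 1) 1) 4 0 := by
  have hsph := isSpherical_orthoplex
  have er := isExposed_faceOf (V := orthoplexVertices)
    (orthoplex_le (τ := fun k => if k = 3 then 0 else 1) fun i => by split_ifs <;> simp)
  have eF := isExposed_faceOf (V := orthoplexVertices)
    (orthoplex_le (τ := fun _ => 1) fun i => by simp)
  have eG := isExposed_faceOf (V := orthoplexVertices)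
    (orthoplex_le (τ := fun k => if k = 3 then -1 else 1) fun i => by split_ifs <;> simp)
  refine ⟨hsph.finite, hsph.vertices_eq, er, eF, eG, ?_, ?_, ?_, ?_, ?_, ?_, ?_,
    fun W hW => orthoplex_hinge hW⟩
  · refine hsph.face_subset er eF fun x hx hxr => ?_
    obtain ⟨i, a, ha, rfl⟩ := hx
    rw [mem_faceOf (single_mem ha), inner_single_right] at hxr ⊢
    by_cases hi : i = 3
    · simp [hi] at hxr
    · simpa [hi] using hxr
  · refine hsph.face_subset er eG fun x hx hxr => ?_
    obtain ⟨i, a, ha, rfl⟩ := hx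
    rw [mem_faceOf (single_mem ha), inner_single_right] at hxr ⊢
    by_cases hi : i = 3
    · simp [hi] at hxr
    · simpa [hi] using hxr
  · intro x hx hF hG
    obtain ⟨i, a, ha, rfl⟩ := hx
    rw [mem_faceOf (single_mem ha), inner_single_right] at hF hG ⊢
    by_cases hi : i = 3
    · simp only [hi, if_true] at hF hG
      linarith
    · simpa [hi] using hF
  · refine ⟨_, single_mem (i := 3) (a := 1) (Or.inl rfl), ?_, ?_⟩ <;>
    rw [mem_faceOf (single_mem (Or.inl rfl)), inner_single_right] <;> simp
  · refine ⟨_, single_mem (i := 3) (a := -1) (Or.inr rfl), ?_, ?_⟩ <;>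
    rw [mem_faceOf (single_mem (Or.inr rfl)), inner_single_right] <;> simp
  · rintro ⟨f, hfe⟩ ⟨s, hse⟩ hf hs
    dsimp only at hf hs
    obtain ⟨σ, hσ, rfl⟩ := orthoplex_facet hf
    obtain ⟨j, rfl⟩ := orthoplex_ridge hσ hs
    have hsq : ∀ i, σ i * σ i = 1 := fun i => by rcases hσ i with h | h <;> rw [h] <;> simp
    have hT : ∀ x ∈ orthoplexVertices, signedPerm σ hsq (Equiv.swap 3 j) x ∈ orthoplexVertices := by
      rintro _ ⟨i, a, ha, rfl⟩
      rw [signedPerm_single]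
      exact single_mem (sign_mul (hσ _) ha)
    refine exists_automorphism hsph (signedPerm σ hsq (Equiv.swap 3 j)) hT ?_ _ _ _ _ ?_ ?_
    · rintro _ ⟨i, a, ha, rfl⟩
      rw [signedPerm_symm_single]
      exact single_mem (sign_mul (hσ _) ha)
    · intro x hx
      have hx' := hT x hx
      obtain ⟨i, a, ha, rfl⟩ := hx
      rw [mem_faceOf hx', mem_faceOf (single_mem ha), signedPerm_single, inner_single_right,
        inner_single_right]
      by_cases hi : i = 3
      · simp [hi]
      · have : Equiv.swap 3 j i ≠ j := fun h => hi (by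
          rw [← Equiv.swap_apply_left 3 j] at h
          exact (Equiv.swap 3 j).injective h)
        simp [hi, this, ← mul_assoc, hsq]
    · intro x hx
      have hx' := hT x hx
      obtain ⟨i, a, ha, rfl⟩ := hx
      rw [mem_faceOf hx', mem_faceOf (single_mem ha), signedPerm_single, inner_single_right,
        inner_single_right]
      simp [← mul_assoc, hsq]
  · intro f hf hrf
    obtain ⟨σ, hσ, rfl⟩ := orthoplex_facet hf
    have h1 : ∀ i : Fin 4, i ≠ 3 → σ i = 1 := by
      intro i hi
      have hmem : (EuclideanSpace.single i 1 : E4) ∈ orthoplexVertices := single_mem (Or.inl rfl)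
      have hm : (EuclideanSpace.single i 1 : E4) ∈
          faceOf orthoplexVertices (vec fun k => if k = 3 then 0 else 1) 1 := by
        rw [mem_faceOf hmem, inner_single_right]
        simp [hi]
      have := hrf hm
      rw [mem_faceOf hmem, inner_single_right] at this
      simpa using this
    rcases hσ 3 with h | h
    · left
      congr 2
      ext i
      by_cases hi : i = 3
      · rw [hi, h]
      · exact h1 i hi
    · right
      congr 2
      ext i
      by_cases hi : i = 3
      · simp [hi, h]
      · simp [hi, h1 i hi]

end Orthoplex

/-! ### The hypercube: dihedral angle `π / 3` -/

section Hypercube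

/-- The vertices of the regular hypercube. -/
def cubeVertices : Set E4 := {x | ∀ i : Fin 4, x i = 1 ∨ x i = -1}

/-- Reflection in a coordinate hyperplane. -/
noncomputable def flip (i : Fin 4) (x : E4) : E4 := vec fun k => if k = i then -x k else x k

lemma flip_apply (i k : Fin 4) (x : E4) : flip i x k = if k = i then -x k else x k := rfl

lemma flip_mem {x : E4} (hx : x ∈ cubeVertices) (i : Fin 4) : flip i x ∈ cubeVertices := by
  intro k
  rw [flip_apply]
  split_ifs
  · rcases hx k with h | h <;> rw [h] <;> simp
  · exact hx k

lemma flip_flip (i : Fin 4) (x : E4) : flip i (flip i x) = x := by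
  ext k
  simp only [flip_apply]
  split_ifs <;> simp

lemma flip_comm (i j : Fin 4) (x : E4) : flip i (flip j x) = flip j (flip i x) := by
  ext k
  simp only [flip_apply]
  split_ifs <;> simp

lemma cube_sq {x : E4} (hx : x ∈ cubeVertices) (i : Fin 4) : x i * x i = 1 := by
  rcases hx i with h | h <;> rw [h] <;> simp

lemma cube_ne {x : E4} (hx : x ∈ cubeVertices) (i : Fin 4) : -x i ≠ x i := by
  rcases hx i with h | h <;> rw [h] <;> norm_num

lemma inner_flip (n x : E4) (i : Fin 4) :
    inner ℝ n (flip i x) = inner ℝ n x - 2 * (n i * x i) := by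
  have : flip i x = x - EuclideanSpace.single i (2 * x i) := by
    ext k
    by_cases hk : k = i
    · subst hk; simp [flip_apply]; ring
    · simp [flip_apply, hk]
  rw [this, inner_sub_right, inner_single_right]
  ring

lemma cube_mul_le {x y : E4} (hx : x ∈ cubeVertices) (hy : y ∈ cubeVertices) (i : Fin 4) :
    x i * y i ≤ 1 := by
  rcases hx i with h | h <;> rcases hy i with h' | h' <;> rw [h, h'] <;> norm_num

lemma isSpherical_cube : IsSpherical cubeVertices 4 2 where
  finite := by
    have : cubeVertices ⊆ Set.range fun ε : Fin 4 → Bool =>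
        vec fun i => if ε i then (1 : ℝ) else -1 := by
      intro x hx
      refine ⟨fun i => decide (x i = 1), ?_⟩
      ext i
      rcases hx i with h | h <;> simp [h]
      norm_num
    exact (Set.finite_range _).subset this
  norm := by
    intro x hx
    rw [inner_eq_sum]
    simp [cube_sq hx]
  le := by
    intro x hx y hy hne
    obtain ⟨j, hj⟩ : ∃ j, x j ≠ y j := by
      by_contra! hc
      exact hne (by ext k; exact hc k)
    have hj' : x j * y j = -1 := by
      rcases hx j with h | h <;> rcases hy j with h' | h' <;> rw [h, h'] at hj ⊢ <;> simp at hj ⊢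
    rw [inner_eq_sum, ← Finset.add_sum_erase _ _ (Finset.mem_univ j), hj']
    have h1 : ∑ i ∈ Finset.univ.erase j, x i * y i ≤ ∑ i ∈ Finset.univ.erase j, 1 :=
      Finset.sum_le_sum fun i _ => cube_mul_le hx hy i
    have h2 : ∑ i ∈ Finset.univ.erase j, (1 : ℝ) = 3 := by
      rw [Finset.sum_const, Finset.card_erase_of_mem (Finset.mem_univ j)]
      simp
    linarith
  lt := by norm_num

lemma inner_flip_self {x : E4} (hx : x ∈ cubeVertices) (i : Fin 4) :
    inner ℝ x (flip i x) = 2 := by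
  rw [inner_flip, isSpherical_cube.norm x hx, cube_sq hx]
  norm_num

lemma inner_single_left (n : E4) (i : Fin 4) (a : ℝ) :
    inner ℝ (EuclideanSpace.single i a) n = a * n i := by
  rw [real_inner_comm, inner_single_right, mul_comm]

lemma sign_mul_eq_one {s t : ℝ} (hs : s = 1 ∨ s = -1) (ht : t = 1 ∨ t = -1) :
    s * t ≤ 1 ∧ (s * t = 1 ↔ t = s) := by
  rcases hs with rfl | rfl <;> rcases ht with rfl | rfl <;> norm_num

/-- The facet of the cube in which the coordinate `i` equals `s`. -/
noncomputable abbrev cubeFacet (i : Fin 4) (s : ℝ) : Set E4 :=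
  faceOf cubeVertices (EuclideanSpace.single i s) 1

/-- The ridge of the cube in which the coordinates `i` and `j` equal `s` and `t`. -/
noncomputable abbrev cubeRidge (i j : Fin 4) (s t : ℝ) : Set E4 :=
  faceOf cubeVertices (EuclideanSpace.single i s + EuclideanSpace.single j t) 2

lemma cubeFacet_le {i : Fin 4} {s : ℝ} (hs : s = 1 ∨ s = -1) :
    ∀ x ∈ cubeVertices, inner ℝ (EuclideanSpace.single i s) x ≤ 1 := by
  intro x hx
  rw [inner_single_left]
  exact (sign_mul_eq_one hs (hx i)).1

lemma cubeFacet_eq {i : Fin 4} {s : ℝ} (hs : s = 1 ∨ s = -1) {x : E4} (hx : x ∈ cubeVertices) :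
    inner ℝ (EuclideanSpace.single i s) x = 1 ↔ x i = s := by
  rw [inner_single_left]
  exact (sign_mul_eq_one hs (hx i)).2

lemma cubeRidge_le {i j : Fin 4} {s t : ℝ} (hs : s = 1 ∨ s = -1) (ht : t = 1 ∨ t = -1) :
    ∀ x ∈ cubeVertices,
      inner ℝ (EuclideanSpace.single i s + EuclideanSpace.single j t) x ≤ 2 := by
  intro x hx
  rw [inner_add_left]
  have := cubeFacet_le (i := i) hs x hx
  have := cubeFacet_le (i := j) ht x hx
  linarith

lemma cubeRidge_eq {i j : Fin 4} {s t : ℝ} (hs : s = 1 ∨ s = -1) (ht : t = 1 ∨ t = -1) {x : E4}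
    (hx : x ∈ cubeVertices) :
    inner ℝ (EuclideanSpace.single i s + EuclideanSpace.single j t) x = 2 ↔ x i = s ∧ x j = t := by
  rw [inner_add_left, ← cubeFacet_eq hs hx, ← cubeFacet_eq ht hx]
  have := cubeFacet_le (i := i) hs x hx
  have := cubeFacet_le (i := j) ht x hx
  constructor
  · intro h
    constructor <;> linarith
  · rintro ⟨h1, h2⟩
    linarith

lemma mem_cubeFacet {i : Fin 4} {s : ℝ} (hs : s = 1 ∨ s = -1) {x : E4} (hx : x ∈ cubeVertices) :
    x ∈ cubeFacet i s ↔ x i = s := by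
  rw [mem_faceOf hx, cubeFacet_eq hs hx]

lemma mem_cubeRidge {i j : Fin 4} {s t : ℝ} (hs : s = 1 ∨ s = -1) (ht : t = 1 ∨ t = -1) {x : E4}
    (hx : x ∈ cubeVertices) : x ∈ cubeRidge i j s t ↔ x i = s ∧ x j = t := by
  rw [mem_faceOf hx, cubeRidge_eq hs ht hx]

lemma exposed_cubeFacet {i : Fin 4} {s : ℝ} (hs : s = 1 ∨ s = -1) :
    IsExposed ℝ (convexHull ℝ cubeVertices) (cubeFacet i s) := isExposed_faceOf (cubeFacet_le hs)

lemma exposed_cubeRidge {i j : Fin 4} {s t : ℝ} (hs : s = 1 ∨ s = -1) (ht : t = 1 ∨ t = -1) :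
    IsExposed ℝ (convexHull ℝ cubeVertices) (cubeRidge i j s t) :=
  isExposed_faceOf (cubeRidge_le hs ht)

/-- Flipping the coordinate `i` changes the functional by `-2 * (n i * x i)`, so a maximizer has the
sign of `n i` there. -/
lemma cube_coordinate {S : Set E4} {n : E4}
    (hn : ∀ x ∈ cubeVertices, x ∈ S ↔ ∀ y ∈ cubeVertices, inner ℝ n y ≤ inner ℝ n x)
    {i : Fin 4} (hi : n i ≠ 0) {x : E4} (hx : x ∈ cubeVertices) (hxS : x ∈ S) :
    x i = sgn (n i) := by
  have h := (hn x hx).1 hxS _ (flip_mem hx i)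
  rw [inner_flip] at h
  have h1 : 0 ≤ n i * x i := by linarith
  refine eq_sgn hi ?_
  rw [← abs_of_nonneg h1, abs_mul]
  rcases hx i with h | h <;> rw [h] <;> simp

lemma cube_facet {f : Set E4} (hf : IsFacet (convexHull ℝ cubeVertices) f) :
    ∃ (i : Fin 4) (s : ℝ), (s = 1 ∨ s = -1) ∧ f = cubeFacet i s := by
  obtain ⟨hf, hne, hn, hmax⟩ := hf
  obtain ⟨n, hnf⟩ := exists_normal hf hne
  have hsph := isSpherical_cube
  obtain ⟨i, hi⟩ : ∃ i, n i ≠ 0 := by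
    by_contra! hc
    apply hn
    refine hsph.face_ext hf (IsExposed.refl _) fun y hy =>
      iff_of_true ((hnf y hy).2 fun z _ => ?_) (subset_convexHull ℝ _ hy)
    simp [inner_eq_sum, hc]
  have hs := sgn_eq (n i)
  refine ⟨i, sgn (n i), hs, ?_⟩
  have hsub : f ⊆ cubeFacet i (sgn (n i)) :=
    hsph.face_subset hf (exposed_cubeFacet hs) fun x hx hxf =>
      (mem_cubeFacet hs hx).2 (cube_coordinate hnf hi hx hxf)
  rcases hmax _ (exposed_cubeFacet hs) hsub with h | h
  · exact h.symm
  · exfalso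
    obtain ⟨x, hx, hxf⟩ := hsph.exists_mem hf hne
    have h1 : flip i x ∈ cubeFacet i (sgn (n i)) := h ▸ subset_convexHull ℝ _ (flip_mem hx i)
    rw [mem_cubeFacet hs (flip_mem hx i), flip_apply, if_pos rfl,
      ← cube_coordinate hnf hi hx hxf] at h1
    exact cube_ne hx i h1

lemma cube_ridge {i : Fin 4} {s : ℝ} (hs : s = 1 ∨ s = -1) {r : Set E4}
    (hr : IsRidgeOf (convexHull ℝ cubeVertices) (cubeFacet i s) r) :
    ∃ (j : Fin 4) (t : ℝ), i ≠ j ∧ (t = 1 ∨ t = -1) ∧ r = cubeRidge i j s t := by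
  obtain ⟨hr, hne, hrf, hn, hmax⟩ := hr
  obtain ⟨n, hnr⟩ := exists_normal hr hne
  have hsph := isSpherical_cube
  obtain ⟨x, hx, hxr⟩ := hsph.exists_mem hr hne
  have hxi := (mem_cubeFacet hs hx).1 (hrf hxr)
  -- Otherwise `n` would be constant on the vertices of the facet, and the ridge would be the whole
  -- facet.
  obtain ⟨j, hij, hj⟩ : ∃ j, i ≠ j ∧ n j ≠ 0 := by
    by_contra! hc
    apply hn
    refine hrf.antisymm (hsph.face_subset (exposed_cubeFacet hs) hr fun y hy hyf => ?_)
    have hyi := (mem_cubeFacet hs hy).1 hyf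
    have heq : inner ℝ n y = inner ℝ n x := by
      rw [inner_eq_sum, inner_eq_sum]
      refine Finset.sum_congr rfl fun k _ => ?_
      by_cases hk : i = k
      · rw [← hk, hxi, hyi]
      · rw [hc k hk, zero_mul, zero_mul]
    rw [hnr y hy, heq]
    exact (hnr x hx).1 hxr
  have ht := sgn_eq (n j)
  refine ⟨j, sgn (n j), hij, ht, ?_⟩
  have h1 : r ⊆ cubeRidge i j s (sgn (n j)) :=
    hsph.face_subset hr (exposed_cubeRidge hs ht) fun y hy hyr =>
      (mem_cubeRidge hs ht hy).2 ⟨(mem_cubeFacet hs hy).1 (hrf hyr), cube_coordinate hnr hj hy hyr⟩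
  have h2 : cubeRidge i j s (sgn (n j)) ⊆ cubeFacet i s :=
    hsph.face_subset (exposed_cubeRidge hs ht) (exposed_cubeFacet hs) fun y hy hyr =>
      (mem_cubeFacet hs hy).2 ((mem_cubeRidge hs ht hy).1 hyr).1
  rcases hmax _ (exposed_cubeRidge hs ht) h1 h2 with h | h
  · exact h.symm
  · exfalso
    have h3 : flip j x ∈ cubeFacet i s := by
      rw [mem_cubeFacet hs (flip_mem hx j), flip_apply, if_neg hij, hxi]
    rw [← h, mem_cubeRidge hs ht (flip_mem hx j), flip_apply, flip_apply, if_pos rfl,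
      ← cube_coordinate hnr hj hx hxr] at h3
    exact cube_ne hx j h3.2

/-- The scribings of the cube considered here ignore the facets `x₀ = 1` and `x₁ = 1`. -/
abbrev IsCubeScribing (W : E4 → M5) : Prop :=
  IsPartialScribing cubeVertices (cubeFacet 0 1) (cubeFacet 1 1) W

/-- The facet through `x` in which the coordinate `i` is constant is not ignored. -/
def IsGood (i : Fin 4) (x : E4) : Prop := (i = 0 → x 0 = -1) ∧ (i = 1 → x 1 = -1)

lemma IsGood.flip {i j : Fin 4} {x : E4} (h : IsGood i x) (hij : i ≠ j) : IsGood i (flip j x) := by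
  refine ⟨fun hi => ?_, fun hi => ?_⟩
  · rw [flip_apply, if_neg (hi ▸ hij), h.1 hi]
  · rw [flip_apply, if_neg (hi ▸ hij), h.2 hi]

/-- The vertex whose coordinates are `1`, except for the coordinate `i`. -/
noncomputable def cubePoint (i : Fin 4) (t : ℝ) : E4 := vec fun k => if k = i then t else 1

lemma cubePoint_apply (i k : Fin 4) (t : ℝ) : cubePoint i t k = if k = i then t else 1 := rfl

lemma cubePoint_mem {i : Fin 4} {t : ℝ} (ht : t = 1 ∨ t = -1) : cubePoint i t ∈ cubeVertices := by
  intro k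
  rw [cubePoint_apply]
  split_ifs
  · exact ht
  · exact Or.inl rfl

/-- Used with `j = 0` and `j = 1`: it yields vertices of the ignored facets that witness that a face
through `x` is not one of them. -/
lemma IsGood.exists_mem {i j : Fin 4} {x : E4} (hx : x ∈ cubeVertices)
    (hg : i = j → x j = -1) : ∃ y ∈ cubeVertices, y ∈ cubeFacet j 1 ∧ y i ≠ x i := by
  by_cases hij : i = j
  · subst hij
    have hm := cubePoint_mem (i := i) (t := 1) (Or.inl rfl)
    refine ⟨_, hm, ?_, ?_⟩
    · rw [mem_cubeFacet (Or.inl rfl) hm, cubePoint_apply]; simp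
    · rw [cubePoint_apply, hg rfl]; norm_num
  · have hm := cubePoint_mem (i := i) (t := -x i) (by rcases hx i with h | h <;> rw [h] <;> simp)
    refine ⟨_, hm, ?_, ?_⟩
    · rw [mem_cubeFacet (Or.inl rfl) hm, cubePoint_apply, if_neg (Ne.symm hij)]
    · rw [cubePoint_apply, if_pos rfl]
      exact cube_ne hx i

section Scribing

variable {W : E4 → M5} (hW : IsCubeScribing W)
include hW

lemma cube_facet_functional {x : E4} (hx : x ∈ cubeVertices) {i : Fin 4} (hg : IsGood i x) :
    ∃ L : M5 →ₗ[ℝ] ℝ, ∀ y ∈ cubeVertices, 0 ≤ L (W y) ∧ (L (W y) = 0 ↔ y i = x i) := by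
  have key : ∀ y ∈ cubeVertices, inner ℝ (EuclideanSpace.single i (x i)) y = 1 ↔ y i = x i :=
    fun y hy => cubeFacet_eq (hx i) hy
  have aux : ∀ {y : E4} {A : Set E4}, y ∈ cubeVertices ∧ y ∈ A ∧ y i ≠ x i →
      y ∈ cubeVertices ∧ y ∈ A ∧ inner ℝ (EuclideanSpace.single i (x i)) y ≠ 1 :=
    fun h => ⟨h.1, h.2.1, fun he => h.2.2 ((key _ h.1).1 he)⟩
  obtain ⟨L, hL⟩ := hW.functional isSpherical_cube (cubeFacet_le (i := i) (hx i))
    ⟨x, hx, (key x hx).2 rfl⟩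
    ((IsGood.exists_mem hx fun h => hg.1 h).imp fun _ => aux)
    ((IsGood.exists_mem hx fun h => hg.2 h).imp fun _ => aux)
  exact ⟨L, fun y hy => by rw [← key y hy]; exact hL y hy⟩

lemma cube_square_functional {x : E4} (hx : x ∈ cubeVertices) {i l : Fin 4} (hil : i ≠ l) :
    ∃ L : M5 →ₗ[ℝ] ℝ, ∀ y ∈ cubeVertices,
      0 ≤ L (W y) ∧ (L (W y) = 0 ↔ y i = x i ∧ y l = x l) := by
  have key := fun y (hy : y ∈ cubeVertices) => cubeRidge_eq (i := i) (j := l) (hx i) (hx l) hy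
  have ex : ∀ j : Fin 4, ∃ y ∈ cubeVertices, y ∈ cubeFacet j 1 ∧
      inner ℝ (EuclideanSpace.single i (x i) + EuclideanSpace.single l (x l)) y ≠ 2 := by
    intro j
    by_cases hij : i = j
    · obtain ⟨y, hy, hyj, hyl⟩ := IsGood.exists_mem (i := l) (j := j) hx
        (fun h => absurd (hij.trans h.symm) hil)
      exact ⟨y, hy, hyj, fun he => hyl ((key y hy).1 he).2⟩
    · obtain ⟨y, hy, hyj, hyl⟩ := IsGood.exists_mem (i := i) (j := j) hx (fun h => absurd h hij)
      exact ⟨y, hy, hyj, fun he => hyl ((key y hy).1 he).1⟩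
  obtain ⟨L, hL⟩ := hW.functional isSpherical_cube (cubeRidge_le (i := i) (j := l) (hx i) (hx l))
    ⟨x, hx, (key x hx).2 ⟨rfl, rfl⟩⟩ (ex 0) (ex 1)
  exact ⟨L, fun y hy => by rw [← key y hy]; exact hL y hy⟩

/-- The square at `x` in the directions `j`, `k` lies in the two facets where coordinate `i`,
respectively `l`, is constant. One unignored facet together with the square itself makes it flat; `W
(flip l x)` and `W (flip i x)` are the auxiliary vectors off the square and off the facet. -/
lemma cube_square_relation {x : E4} (hx : x ∈ cubeVertices) {i j k l : Fin 4} (hij : i ≠ j)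
    (hik : i ≠ k) (hil : i ≠ l) (hjk : j ≠ k) (hjl : j ≠ l) (hkl : k ≠ l) (hg : IsGood i x) :
    ∃ p q r s : ℝ, 0 < p ∧ 0 < q ∧ 0 < r ∧ 0 < s ∧
      p • W x + q • W (flip j (flip k x)) = r • W (flip j x) + s • W (flip k x) := by
  obtain ⟨L, hL⟩ := cube_square_functional hW hx hil
  obtain ⟨G, hG⟩ := cube_facet_functional hW hx hg
  have hj := flip_mem hx j
  have hk := flip_mem hx k
  have hjk' := flip_mem hk j
  have hl := flip_mem hx l
  have hi := flip_mem hx i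
  have coord : ∀ {y z : E4} (m : Fin 4), y m ≠ z m → y ≠ z := by
    rintro y z m h rfl
    exact h rfl
  have n1 : flip j x ≠ x := coord j (by simpa [flip_apply] using cube_ne hx j)
  have n2 : flip k x ≠ x := coord k (by simpa [flip_apply] using cube_ne hx k)
  have n3 : flip j (flip k x) ≠ x :=
    coord j (by simpa [flip_apply, hjk] using cube_ne hx j)
  have n4 : flip j (flip k x) ≠ flip j x :=
    coord k (by simpa [flip_apply, hjk.symm] using cube_ne hx k)
  have n5 : flip j (flip k x) ≠ flip k x :=
    coord j (by simpa [flip_apply, hjk] using cube_ne hx j)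
  have n6 : flip j x ≠ flip k x :=
    coord j (by simpa [flip_apply, hjk] using cube_ne hx j)
  have i3 : inner ℝ (flip j (flip k x)) (flip j x) = 2 := by
    rw [flip_comm, real_inner_comm]
    exact inner_flip_self hj k
  obtain ⟨L₁, a1, a2, a3⟩ := hW.edge_functional isSpherical_cube hx hj (inner_flip_self hx j)
  obtain ⟨L₂, b1, b2, b3⟩ := hW.edge_functional isSpherical_cube hx hk (inner_flip_self hx k)
  obtain ⟨L₃, c1, c2, c3⟩ := hW.edge_functional isSpherical_cube hjk' hj i3
  refine square_relation (L := L) (G := G) (x := W (flip l x)) (y := W (flip i x))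
    ((hL _ hx).2.2 ⟨rfl, rfl⟩) ((hL _ hjk').2.2 ?_) ((hL _ hj).2.2 ?_) ((hL _ hk).2.2 ?_)
    (fun h => ?_) ((hG _ hx).2.2 rfl) ((hG _ hjk').2.2 ?_) ((hG _ hj).2.2 ?_) ((hG _ hk).2.2 ?_)
    ((hG _ hl).2.2 ?_) (fun h => ?_)
    ⟨a1, a2, a3 _ hjk' n3 n4, a3 _ hk n2 n6.symm⟩ ⟨b1, b2, b3 _ hjk' n3 n5, b3 _ hj n1 n6⟩
    ⟨c1, c2, c3 _ hx n3.symm n1.symm, c3 _ hk n5.symm n6.symm⟩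
  · simp [flip_apply, hij, hik, hjl.symm, hkl.symm]
  · simp [flip_apply, hij, hjl.symm]
  · simp [flip_apply, hik, hkl.symm]
  · have := ((hL _ hl).2.1 h).2
    rw [flip_apply, if_pos rfl] at this
    exact cube_ne hx l this
  · simp [flip_apply, hij, hik]
  · simp [flip_apply, hij]
  · simp [flip_apply, hik]
  · simp [flip_apply, hil]
  · have := (hG _ hi).2.1 h
    rw [flip_apply, if_pos rfl] at this
    exact cube_ne hx i this

lemma cube_norm {x : E4} (hx : x ∈ cubeVertices) : lor (W x) (W x) = 1 := by
  have hsph := isSpherical_cube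
  -- A facet on which coordinate `2` is constant is never ignored, so this square is available at
  -- every vertex.
  obtain ⟨p, q, r, s, -, hq, -, -, hrel⟩ := cube_square_relation hW hx (i := 2) (j := 0) (k := 1)
    (l := 3) (by decide) (by decide) (by decide) (by decide) (by decide) (by decide)
    ⟨fun h => absurd h (by decide), fun h => absurd h (by decide)⟩
  obtain ⟨L, hL, hL'⟩ := hW.vertex hsph hx
  have h0 := flip_mem hx 0
  have h1 := flip_mem hx 1
  have h01 := flip_mem h1 0
  have e0 := hW.edge hsph hx h0 (inner_flip_self hx 0)
  have e1 := hW.edge hsph hx h1 (inner_flip_self hx 1)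
  have e2 := hW.edge hsph h01 h0 (by
    rw [flip_comm, real_inner_comm]
    exact inner_flip_self h0 1)
  have e3 := hW.edge hsph h0 hx (by rw [real_inner_comm]; exact inner_flip_self hx 0)
  refine nonnull_of_square hq hrel e0.1 e2.1 e3.1 e0.2 e1.2 e2.2 (hW.pos hsph hx)
    (hW.pos hsph h01) (hW.pos hsph h0) hL (hL' _ h01 fun h => ?_) (hL' _ h0 fun h => ?_)
  · have := congrArg (fun y : E4 => y 0) h
    simp only [flip_apply] at this
    exact cube_ne hx 0 (by simpa using this)
  · have := congrArg (fun y : E4 => y 0) h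
    simp only [flip_apply] at this
    exact cube_ne hx 0 (by simpa using this)

lemma cube_edge {x : E4} (hx : x ∈ cubeVertices) (i : Fin 4) :
    lor (W x) (W (flip i x)) = -1 := by
  rw [(hW.edge isSpherical_cube hx (flip_mem hx i) (inner_flip_self hx i)).2, cube_norm hW hx,
    cube_norm hW (flip_mem hx i), one_mul]

lemma cube_edge' {x : E4} (hx : x ∈ cubeVertices) (i : Fin 4) :
    lor (W (flip i x)) (W x) = -1 := by
  rw [lor_comm, cube_edge hW hx]

lemma cube_square {x : E4} (hx : x ∈ cubeVertices) {i j k l : Fin 4} (hij : i ≠ j)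
    (hik : i ≠ k) (hil : i ≠ l) (hjk : j ≠ k) (hjl : j ≠ l) (hkl : k ≠ l) (hg : IsGood i x) :
    ∃ t : ℝ, 0 < t ∧
      W x + W (flip j (flip k x)) = t • (W (flip j x) + W (flip k x)) := by
  obtain ⟨p, q, r, s, hp, hq, hr, hs, hrel⟩ :=
    cube_square_relation hW hx hij hik hil hjk hjl hkl hg
  have hj := flip_mem hx j
  have hk := flip_mem hx k
  refine square_normalize hp hq hr hs hrel (cube_norm hW hx) (cube_norm hW (flip_mem hk j))
    (cube_norm hW hj) (cube_norm hW hk) (cube_edge hW hx j) (cube_edge hW hx k) ?_ ?_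
  · rw [flip_comm]
    exact cube_edge' hW hj k
  · exact cube_edge' hW hk j

lemma cube_isTangentCube {x : E4} (hx : x ∈ cubeVertices) {i j k l : Fin 4} (hij : i ≠ j)
    (hik : i ≠ k) (hil : i ≠ l) (hjk : j ≠ k) (hjl : j ≠ l) (hkl : k ≠ l) (hg : IsGood i x) :
    IsTangentCube (W x) (W (flip j x)) (W (flip k x)) (W (flip l x)) (W (flip k (flip l x)))
      (W (flip j (flip l x))) (W (flip j (flip k x))) (W (flip j (flip k (flip l x)))) := by
  have hj := flip_mem hx j
  have hk := flip_mem hx k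
  have hl := flip_mem hx l
  have hkl' := flip_mem hl k
  have hjl' := flip_mem hl j
  have hjk' := flip_mem hk j
  refine ⟨cube_norm hW hx, cube_norm hW hj, cube_norm hW hk, cube_norm hW hl, cube_norm hW hkl',
    cube_norm hW hjl', cube_norm hW hjk', cube_edge hW hx j, cube_edge hW hx k, cube_edge hW hx l,
    ?_, cube_edge' hW hl k, ?_, cube_edge' hW hl j, ?_, cube_edge' hW hk j, ?_, ?_, ?_, ?_, ?_,
    ?_, ?_, ?_, ?_⟩
  · rw [flip_comm]; exact cube_edge' hW hk l
  · rw [flip_comm]; exact cube_edge' hW hj l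
  · rw [flip_comm]; exact cube_edge' hW hj k
  · exact cube_edge hW hkl' j
  · rw [flip_comm j k]; exact cube_edge hW hjl' k
  · rw [flip_comm k l, flip_comm j l]; exact cube_edge hW hjk' l
  · exact cube_square hW hx hik hil hij hkl hjk.symm hjl.symm hg
  · exact cube_square hW hx hij hil hik hjl hjk hkl.symm hg
  · exact cube_square hW hx hij hik hil hjk hjl hkl hg
  -- Seen from a neighbor of `x`, the relation of a square at the antipodal vertex has the diagonals
  -- in the other order; hence the inverse factor.
  · obtain ⟨t, ht, h⟩ := cube_square hW hj (i := i) (j := k) (k := l) (l := j) hik hil hij hkl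
      hjk.symm hjl.symm (hg.flip hij)
    refine ⟨t⁻¹, inv_pos.2 ht, ?_⟩
    rw [flip_comm l j, flip_comm k j, flip_comm k j] at h
    rw [h, smul_smul, inv_mul_cancel₀ ht.ne', one_smul, add_comm]
  · obtain ⟨t, ht, h⟩ := cube_square hW hk (i := i) (j := j) (k := l) (l := k) hij hil hik hjl
      hjk hkl.symm (hg.flip hik)
    refine ⟨t⁻¹, inv_pos.2 ht, ?_⟩
    rw [flip_comm l k] at h
    rw [h, smul_smul, inv_mul_cancel₀ ht.ne', one_smul, add_comm]
  · obtain ⟨t, ht, h⟩ := cube_square hW hl (i := i) (j := j) (k := k) (l := l) hij hik hil hjk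
      hjl hkl (hg.flip hil)
    refine ⟨t⁻¹, inv_pos.2 ht, ?_⟩
    rw [h, smul_smul, inv_mul_cancel₀ ht.ne', one_smul, add_comm]

/-- The squares of a flat tangent cube are parallelograms. -/
lemma cube_parallelogram {x : E4} (hx : x ∈ cubeVertices) {i j k l : Fin 4} (hij : i ≠ j)
    (hik : i ≠ k) (hil : i ≠ l) (hjk : j ≠ k) (hjl : j ≠ l) (hkl : k ≠ l) (hg : IsGood i x) :
    W x + W (flip k (flip l x)) = W (flip k x) + W (flip l x) := by
  have diag : ∀ {y : E4}, y ∈ cubeVertices → IsGood i y → ∀ {a b c : Fin 4}, i ≠ a → i ≠ b →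
      i ≠ c → a ≠ b → a ≠ c → b ≠ c →
      lor (W y) (W (flip b (flip c y))) = lor (W y) (W (flip a (flip c y))) :=
    fun hy hg _ _ _ ha hb hc hab hac hbc =>
      (cube_isTangentCube hW hy ha hb hc hab hac hbc hg).diagonal_eq
  -- Face diagonals from one vertex agree. Applied at `x` and at the opposite corner of a square,
  -- which share a diagonal, this compares all diagonals needed.
  refine (cube_isTangentCube hW hx hij hik hil hjk hjl hkl hg).parallelogram ?_ ?_ ?_
  · rw [flip_comm k l]
    exact diag hx hg hil hij hik hjl.symm hkl.symm hjk
  · have h := diag (flip_mem (flip_mem hx l) k) ((hg.flip hil).flip hik) hil hij hik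
      hjl.symm hkl.symm hjk
    rw [flip_flip, flip_comm k l, flip_flip, flip_comm l k] at h
    rw [h, lor_comm]
  · have h := diag (flip_mem (flip_mem hx l) k) ((hg.flip hil).flip hik) hik hij hil
      hjk.symm hkl hjl
    have e : flip l (flip k (flip l x)) = flip k x := by rw [flip_comm k l, flip_flip]
    rw [e, flip_flip] at h
    rw [h, lor_comm]

end Scribing

/-- Squares in unignored facets show that moving from the ridge square `A B C D` in direction `0` or
`1` adds a constant vector `E`. Both `E` and `A + C` have product `-2` with each corner, so `E - (A
+ C)` is normal, of norm `4 + 8 - 4 = 8`. The two translations are orthogonal, whence the product `0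
+ 4 + 4 - 4 = 4`. -/
lemma cube_hinge {W : E4 → M5}
    (hW : Scribing (convexHull ℝ cubeVertices)
      {convexHull ℝ cubeVertices, cubeFacet 0 1, cubeFacet 1 1} W) :
    IsHinge cubeVertices W (cubeRidge 0 1 1 1) (cubeFacet 0 1) (cubeFacet 1 1) 8 4 := by
  have hsph := isSpherical_cube
  have one : (1 : ℝ) = 1 ∨ (1 : ℝ) = -1 := Or.inl rfl
  set o : E4 := vec fun _ => 1 with ho
  have oi : ∀ i, o i = 1 := fun i => rfl
  have hom : o ∈ cubeVertices := fun i => Or.inl rfl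
  have mem_r : ∀ x ∈ cubeVertices, x ∈ cubeRidge 0 1 1 1 ↔ x 0 = 1 ∧ x 1 = 1 := fun x hx =>
    mem_cubeRidge one one hx
  have h2m := flip_mem hom 2
  have h3m := flip_mem hom 3
  have h23m := flip_mem h3m 2
  have hr0 : o ∈ cubeRidge 0 1 1 1 := (mem_r o hom).2 ⟨rfl, rfl⟩
  have hr2 : flip 2 o ∈ cubeRidge 0 1 1 1 := (mem_r _ h2m).2 (by simp [flip_apply, oi])
  have hr23 : flip 2 (flip 3 o) ∈ cubeRidge 0 1 1 1 :=
    (mem_r _ h23m).2 (by simp [flip_apply, oi])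
  have ne_o : ∀ (x y : E4) (i : Fin 4), x i ≠ y i → x ≠ y := by
    rintro x y i h rfl
    exact h rfl
  have n2 : o ≠ flip 2 o := ne_o _ _ 2 (by norm_num [flip_apply, oi])
  have n3 : o ≠ flip 3 o := ne_o _ _ 3 (by norm_num [flip_apply, oi])
  have n23 : flip 2 o ≠ flip 3 o := ne_o _ _ 3 (by norm_num [flip_apply, oi, (by decide : (3 : Fin 4) ≠ 2)])
  have hP : IsCubeScribing W := by
    refine ⟨hW, fun u v => exists_ne_ne hom h2m h3m ?_ ?_ ?_ n2 n3 n23 u v,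
      fun u v => exists_ne_ne hom h2m h3m ?_ ?_ ?_ n2 n3 n23 u v⟩ <;>
    rw [mem_cubeFacet one (by assumption)] <;> simp [flip_apply, oi]
  have good2 : ∀ x, IsGood 2 x := fun x =>
    ⟨fun h => absurd h (by decide), fun h => absurd h (by decide)⟩
  have good3 : ∀ x, IsGood 3 x := fun x =>
    ⟨fun h => absurd h (by decide), fun h => absurd h (by decide)⟩
  set A := W o with hA
  set B := W (flip 2 o) with hB
  set C := W (flip 2 (flip 3 o)) with hC
  set D := W (flip 3 o) with hD
  have par3 : ∀ {x : E4}, x ∈ cubeVertices → ∀ {j k l : Fin 4}, 3 ≠ j → 3 ≠ k → 3 ≠ l → j ≠ k →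
      j ≠ l → k ≠ l → W x + W (flip k (flip l x)) = W (flip k x) + W (flip l x) :=
    fun hx _ _ _ a b c d e f => cube_parallelogram hP hx a b c d e f (good3 _)
  have par2 : ∀ {x : E4}, x ∈ cubeVertices → ∀ {j k l : Fin 4}, 2 ≠ j → 2 ≠ k → 2 ≠ l → j ≠ k →
      j ≠ l → k ≠ l → W x + W (flip k (flip l x)) = W (flip k x) + W (flip l x) :=
    fun hx _ _ _ a b c d e f => cube_parallelogram hP hx a b c d e f (good2 _)
  have side : ∀ m : Fin 4, m = 0 ∨ m = 1 → W (flip m (flip 2 o)) = B + (W (flip m o) - A) ∧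
      W (flip m (flip 3 o)) = D + (W (flip m o) - A) ∧
      W (flip m (flip 2 (flip 3 o))) = C + (W (flip m o) - A) := by
    intro m hm
    obtain ⟨j, hj⟩ : ∃ j : Fin 4, m ≠ j ∧ j ≠ 2 ∧ j ≠ 3 := by
      rcases hm with rfl | rfl
      · exact ⟨1, by decide⟩
      · exact ⟨0, by decide⟩
    have hm2 : m ≠ 2 := by rcases hm with rfl | rfl <;> decide
    have hm3 : m ≠ 3 := by rcases hm with rfl | rfl <;> decide
    have e2 := par3 hom (j := j) (k := m) (l := 2) hj.2.2.symm hm3.symm (by decide) hj.1.symm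
      hj.2.1 hm2
    have e3 := par2 hom (j := j) (k := m) (l := 3) hj.2.1.symm hm2.symm (by decide) hj.1.symm
      hj.2.2 hm3
    have e23 := par3 h3m (j := j) (k := m) (l := 2) hj.2.2.symm hm3.symm (by decide) hj.1.symm
      hj.2.1 hm2
    rw [← eq_sub_iff_add_eq'] at e2 e3 e23
    refine ⟨?_, ?_, ?_⟩
    · rw [e2]; abel
    · rw [e3]; abel
    · rw [e23, e3]; abel
  obtain ⟨s02, s03, s023⟩ := side 0 (Or.inl rfl)
  obtain ⟨s12, s13, s123⟩ := side 1 (Or.inr rfl)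
  set U := W (flip 0 o) with hU
  set T := W (flip 1 o) with hT
  -- Both facets containing the ridge square are ignored, so its own flatness is not given. The
  -- parallelogram law is read off the translated square in the facet where coordinate `0` equals
  -- `-1`.
  have hABCD : A + C = B + D := by
    have e := cube_parallelogram hP (flip_mem hom 0) (i := 0) (j := 1) (k := 2) (l := 3)
      (by decide) (by decide) (by decide) (by decide) (by decide) (by decide)
      ⟨fun _ => by simp [flip_apply, oi], fun h => absurd h (by decide)⟩
    rw [flip_comm 3 0, flip_comm 2 0, flip_comm 2 0, s02, s03, s023] at e
    rw [← sub_eq_zero] at e ⊢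
    rw [← e]
    abel
  have AA : lor A A = 1 := cube_norm hP hom
  have BB : lor B B = 1 := cube_norm hP h2m
  have CC : lor C C = 1 := cube_norm hP h23m
  have AB : lor A B = -1 := cube_edge hP hom 2
  have AD : lor A D = -1 := cube_edge hP hom 3
  have BC : lor B C = -1 := by
    rw [hB, hC, flip_comm]
    exact cube_edge hP h2m 3
  have DC : lor D C = -1 := cube_edge hP h3m 2
  have AC : lor A C = -3 := by
    have := congrArg (lor A) hABCD
    simp only [map_add, AA, AB, AD] at this
    linarith
  have BD : lor B D = -3 := by
    have := congrArg (lor B) hABCD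
    simp only [map_add, BB, BC, lor_comm B A, AB] at this
    linarith
  have CB := (lor_comm C B).trans BC
  have CD := (lor_comm C D).trans DC
  have CA := (lor_comm C A).trans AC
  have dir : ∀ m : Fin 4, m = 0 ∨ m = 1 → ∀ E : M5, E = W (flip m o) - A →
      lor E A = -2 ∧ lor E B = -2 ∧ lor E C = -2 ∧ lor E D = -2 ∧ lor E E = 4 := by
    intro m hm E hE
    obtain ⟨t2, t3, t23⟩ := side m hm
    rw [← hE] at t2 t3 t23
    have key : ∀ (x : E4), x ∈ cubeVertices → W (flip m x) = W x + E → lor E (W x) = -2 := by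
      intro x hx h
      have := cube_edge' hP hx m
      rw [h, map_add, LinearMap.add_apply, cube_norm hP hx] at this
      linarith
    have hEA := key o hom (by rw [hE]; abel)
    refine ⟨hEA, key _ h2m t2, key _ h23m t23, key _ h3m t3, ?_⟩
    have := cube_norm hP (flip_mem hom m)
    have h2 : W (flip m o) = A + E := by rw [hE]; abel
    rw [h2] at this
    simp only [map_add, LinearMap.add_apply, AA, lor_comm A E] at this
    linarith
  obtain ⟨UA, UB, UC, UD, UU⟩ := dir 0 (Or.inl rfl) _ rfl
  obtain ⟨TA, TB, TC, TD, TT⟩ := dir 1 (Or.inr rfl) _ rfl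
  have TU : lor (T - A) (U - A) = 0 := by
    have e := par3 hom (j := 2) (k := 0) (l := 1) (by decide) (by decide) (by decide) (by decide)
      (by decide) (by decide)
    have h1 := cube_edge hP (flip_mem hom 1) 0
    have h2 : W (flip 0 (flip 1 o)) = T + (U - A) := by
      rw [← eq_sub_iff_add_eq'] at e
      rw [e]; abel
    have h3 : lor T (U - A) = -2 := by
      rw [h2, map_add, cube_norm hP (flip_mem hom 1)] at h1
      linarith
    rw [map_sub lor T A, LinearMap.sub_apply, h3, lor_comm A, UA]
    norm_num
  have r_cases : ∀ x ∈ cubeVertices, x ∈ cubeRidge 0 1 1 1 →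
      x = o ∨ x = flip 2 o ∨ x = flip 3 o ∨ x = flip 2 (flip 3 o) := by
    intro x hx hxr
    obtain ⟨h0, h1⟩ := (mem_r x hx).1 hxr
    have ext4 : ∀ y : E4, y 0 = 1 → y 1 = 1 → x 2 = y 2 → x 3 = y 3 → x = y := by
      intro y y0 y1 y2 y3
      ext k
      fin_cases k
      · exact h0.trans y0.symm
      · exact h1.trans y1.symm
      · exact y2
      · exact y3
    rcases hx 2 with h2 | h2 <;> rcases hx 3 with h3 | h3
    · exact Or.inl (ext4 _ rfl rfl h2 h3)
    · refine Or.inr (Or.inr (Or.inl (ext4 _ ?_ ?_ ?_ ?_))) <;> simp [flip_apply, oi, h2, h3]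
    · refine Or.inr (Or.inl (ext4 _ ?_ ?_ ?_ ?_)) <;> simp [flip_apply, oi, h2, h3]
    · refine Or.inr (Or.inr (Or.inr (ext4 _ ?_ ?_ ?_ ?_))) <;> simp [flip_apply, oi, h2, h3]
  have hspan : ∀ x ∈ cubeVertices, x ∈ cubeRidge 0 1 1 1 →
      W x ∈ Submodule.span ℝ (W '' (cubeVertices ∩ cubeRidge 0 1 1 1)) := fun x hx hxr =>
    Submodule.subset_span ⟨x, ⟨hx, hxr⟩, rfl⟩
  have normal : ∀ m : Fin 4, m = 0 ∨ m = 1 → ∀ E : M5, E = W (flip m o) - A →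
      ∀ m' : Fin 4, m' = 0 ∨ m' = 1 → m ≠ m' →
      IsNormal cubeVertices W (cubeRidge 0 1 1 1) (cubeFacet m' 1) 8 (E - (A + C)) := by
    intro m hm E hE m' hm' hmm
    obtain ⟨EA, EB, EC, ED, EE⟩ := dir m hm E hE
    obtain ⟨t2, t3, t23⟩ := side m hm
    rw [← hE] at t2 t3 t23
    refine ⟨?_, ?_, ?_⟩
    · intro x hx hxr
      rcases r_cases x hx hxr with rfl | rfl | rfl | rfl
      · change lor _ A = 0
        simp only [map_sub, map_add, LinearMap.sub_apply, LinearMap.add_apply, EA, AA, CA]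
        norm_num
      · change lor _ B = 0
        simp only [map_sub, map_add, LinearMap.sub_apply, LinearMap.add_apply, EB, AB, CB]
        norm_num
      · change lor _ D = 0
        simp only [map_sub, map_add, LinearMap.sub_apply, LinearMap.add_apply, ED, AD, CD]
        norm_num
      · change lor _ C = 0
        simp only [map_sub, map_add, LinearMap.sub_apply, LinearMap.add_apply, EC, AC, CC]
        norm_num
    · simp only [map_sub, map_add, LinearMap.sub_apply, LinearMap.add_apply, EA, EC, EE, AA, CA,
        AC, CC, lor_comm A E, lor_comm C E]
      norm_num
    · intro x hx hxF hxr
      have hx1 := (mem_cubeFacet one hx).1 hxF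
      have hxm : x m = -1 := by
        refine (hx m).resolve_left fun h => hxr ((mem_r x hx).2 ?_)
        rcases hm with rfl | rfl <;> rcases hm' with rfl | rfl
        · exact absurd rfl hmm
        · exact ⟨h, hx1⟩
        · exact ⟨hx1, h⟩
        · exact absurd rfl hmm
      have hfl : flip m x ∈ cubeRidge 0 1 1 1 := by
        rw [mem_r _ (flip_mem hx m)]
        rcases hm with rfl | rfl <;> rcases hm' with rfl | rfl
        · exact absurd rfl hmm
        · simp [flip_apply, hxm, hx1]
        · simp [flip_apply, hxm, hx1]
        · exact absurd rfl hmm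
      have hWx : W x = W (flip m x) + E := by
        rcases r_cases _ (flip_mem hx m) hfl with h | h | h | h
        all_goals
          have hxe := congrArg (flip m) h
          rw [flip_flip] at hxe
          rw [h, hxe]
        · rw [hE]; abel
        · exact t2
        · exact t3
        · exact t23
      have : W x - (E - (A + C)) = W (flip m x) + (A + C) := by rw [hWx]; abel
      rw [this]
      exact Submodule.add_mem _ (hspan _ (flip_mem hx m) hfl)
        (Submodule.add_mem _ (hspan o hom hr0) (hspan _ h23m hr23))
  refine ⟨⟨o, hom, _, h2m, _, h23m, hr0, hr2, hr23, AA, BB, CC, AB, BC, by rw [AC]; norm_num,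
    hP.pos hsph hom, hP.pos hsph h2m⟩, T - A - (A + C), U - A - (A + C),
    normal 1 (Or.inr rfl) _ rfl 0 (Or.inl rfl) (by decide),
    normal 0 (Or.inl rfl) _ rfl 1 (Or.inr rfl) (by decide), ?_⟩
  generalize hE : T - A = E at *
  generalize hE' : U - A = E' at *
  simp only [map_sub, map_add, LinearMap.sub_apply, LinearMap.add_apply, TA, TC, TU, AA, CA, AC,
    CC, lor_comm A E', lor_comm C E', UA, UC]
  norm_num

lemma isModel_cube : IsModel cubeVertices (cubeRidge 0 1 1 1) (cubeFacet 0 1) (cubeFacet 1 1)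
    8 4 := by
  have hsph := isSpherical_cube
  have one : (1 : ℝ) = 1 ∨ (1 : ℝ) = -1 := Or.inl rfl
  have neg : (-1 : ℝ) = 1 ∨ (-1 : ℝ) = -1 := Or.inr rfl
  have er := exposed_cubeRidge (i := 0) (j := 1) one one
  have eF := exposed_cubeFacet (i := 0) one
  have eG := exposed_cubeFacet (i := 1) one
  refine ⟨hsph.finite, hsph.vertices_eq, er, eF, eG, ?_, ?_, ?_, ?_, ?_, ?_, ?_,
    fun W hW => cube_hinge hW⟩
  · exact hsph.face_subset er eF fun x hx hxr =>
      (mem_cubeFacet one hx).2 ((mem_cubeRidge one one hx).1 hxr).1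
  · exact hsph.face_subset er eG fun x hx hxr =>
      (mem_cubeFacet one hx).2 ((mem_cubeRidge one one hx).1 hxr).2
  · exact fun x hx hF hG => (mem_cubeRidge one one hx).2
      ⟨(mem_cubeFacet one hx).1 hF, (mem_cubeFacet one hx).1 hG⟩
  · have hm := cubePoint_mem (i := 1) neg
    refine ⟨_, hm, ?_, ?_⟩
    · rw [mem_cubeFacet one hm]; simp [cubePoint_apply]
    · rw [mem_cubeRidge one one hm]; norm_num [cubePoint_apply]
  · have hm := cubePoint_mem (i := 0) neg
    refine ⟨_, hm, ?_, ?_⟩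
    · rw [mem_cubeFacet one hm]; simp [cubePoint_apply]
    · rw [mem_cubeRidge one one hm]; norm_num [cubePoint_apply]
  · rintro ⟨f, hfe⟩ ⟨s, hse⟩ hf hs
    dsimp only at hf hs
    obtain ⟨i, a, ha, rfl⟩ := cube_facet hf
    obtain ⟨j, b, hij, hb, rfl⟩ := cube_ridge ha hs
    obtain ⟨e, hei, hej⟩ : ∃ e : Equiv.Perm (Fin 4), e i = 0 ∧ e j = 1 := by
      clear hf hs hfe hse
      revert i j
      decide
    let σ : Fin 4 → ℝ := fun k => if k = i then a else b
    have hσ : ∀ k, σ k = 1 ∨ σ k = -1 := by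
      intro k
      simp only [σ]
      split_ifs
      · exact ha
      · exact hb
    have hσ2 : ∀ k, σ k * σ k = 1 := fun k => by rcases hσ k with h | h <;> rw [h] <;> simp
    have hT : ∀ x ∈ cubeVertices, signedPerm σ hσ2 e x ∈ cubeVertices := fun x hx k =>
      sign_mul (hσ k) (hx _)
    have hTi : ∀ x ∈ cubeVertices, signedPerm σ hσ2 e x i = a ↔ x 0 = 1 := by
      intro x hx
      rw [signedPerm_apply, hei]
      simp only [σ, if_true]
      rcases ha with rfl | rfl
      · rw [one_mul]
      · constructor <;> intro h <;> linarith
    have hTj : ∀ x ∈ cubeVertices, signedPerm σ hσ2 e x j = b ↔ x 1 = 1 := by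
      intro x hx
      rw [signedPerm_apply, hej]
      simp only [σ, hij.symm, if_false]
      rcases hb with rfl | rfl
      · rw [one_mul]
      · constructor <;> intro h <;> linarith
    refine exists_automorphism hsph (signedPerm σ hσ2 e) hT
      (fun x hx k => sign_mul (hσ _) (hx _)) _ _ _ _ ?_ ?_
    · intro x hx
      rw [mem_cubeRidge ha hb (hT x hx), mem_cubeRidge one one hx, hTi x hx, hTj x hx]
    · intro x hx
      rw [mem_cubeFacet ha (hT x hx), mem_cubeFacet one hx, hTi x hx]
  · intro f hf hrf
    obtain ⟨i, s, hs, rfl⟩ := cube_facet hf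
    have key : ∀ x ∈ cubeVertices, x 0 = 1 → x 1 = 1 → x i = s := fun x hx h0 h1 =>
      (mem_cubeFacet hs hx).1 (hrf ((mem_cubeRidge one one hx).2 ⟨h0, h1⟩))
    have hs1 : s = 1 := (key (vec fun _ => 1) (fun _ => Or.inl rfl) rfl rfl).symm
    have hi : i = 0 ∨ i = 1 := by
      by_contra! hc
      have := key (cubePoint i (-1)) (cubePoint_mem neg) (by simp [cubePoint_apply, hc.1.symm])
        (by simp [cubePoint_apply, hc.2.symm])
      rw [cubePoint_apply, if_pos rfl, hs1] at this
      norm_num at this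
    rcases hi with rfl | rfl
    · left; rw [hs1]
    · right; rw [hs1]

end Hypercube

/-! ### The 24-cell: dihedral angle `π / 3` -/

section Cell24

/-- The vector with coordinates `a` and `b` at `i` and `j`. -/
noncomputable def pt (i j : Fin 4) (a b : ℝ) : E4 :=
  EuclideanSpace.single i a + EuclideanSpace.single j b

/-- The vertices of the regular 24-cell. -/
def cellVertices : Set E4 := {x | ∃ (i j : Fin 4) (a b : ℝ), i ≠ j ∧ (a = 1 ∨ a = -1) ∧
  (b = 1 ∨ b = -1) ∧ x = EuclideanSpace.single i a + EuclideanSpace.single j b}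

lemma pt_mem {i j : Fin 4} {a b : ℝ} (hij : i ≠ j) (ha : a = 1 ∨ a = -1) (hb : b = 1 ∨ b = -1) :
    pt i j a b ∈ cellVertices := ⟨i, j, a, b, hij, ha, hb, rfl⟩

lemma pt_apply (i j k : Fin 4) (a b : ℝ) :
    pt i j a b k = (if k = i then a else 0) + (if k = j then b else 0) := by
  simp [pt]

lemma inner_pt (i j : Fin 4) (a b : ℝ) (x : E4) : inner ℝ x (pt i j a b) = x i * a + x j * b := by
  rw [pt, inner_add_right, inner_single_right, inner_single_right]

lemma pt_comm (i j : Fin 4) (a b : ℝ) : pt i j a b = pt j i b a := add_comm _ _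

/-- The vertices are the integer vectors of squared length two. This description makes invariance
under symmetries and bounds on products into integer arithmetic. -/
lemma mem_cellVertices_iff {x : E4} :
    x ∈ cellVertices ↔ (∀ i, ∃ z : ℤ, x i = z) ∧ ∑ i, x i * x i = 2 := by
  constructor
  · rintro ⟨i, j, a, b, hij, ha, hb, rfl⟩
    change (∀ k, ∃ z : ℤ, pt i j a b k = z) ∧ _
    constructor
    · intro k
      obtain ⟨c, hc⟩ : ∃ z : ℤ, a = z := by
        rcases ha with rfl | rfl
        exacts [⟨1, by simp⟩, ⟨-1, by simp⟩]
      obtain ⟨d, hd⟩ : ∃ z : ℤ, b = z := by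
        rcases hb with rfl | rfl
        exacts [⟨1, by simp⟩, ⟨-1, by simp⟩]
      refine ⟨(if k = i then c else 0) + (if k = j then d else 0), ?_⟩
      rw [pt_apply, hc, hd]
      push_cast
      rfl
    · rw [← inner_eq_sum]
      change inner ℝ (pt i j a b) (pt i j a b) = 2
      rw [inner_pt, pt_apply, pt_apply]
      rcases ha with rfl | rfl <;> rcases hb with rfl | rfl <;> simp [hij, hij.symm] <;> norm_num
  · rintro ⟨hint, hsum⟩
    choose z hz using hint
    have hz2 : ∑ i, z i * z i = 2 := by
      have : ((∑ i, z i * z i : ℤ) : ℝ) = 2 := by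
        push_cast
        rw [← hsum]
        exact Finset.sum_congr rfl fun i _ => by rw [hz]
      exact_mod_cast this
    have hle : ∀ i, z i * z i ≤ 2 := by
      intro i
      rw [← hz2]
      exact Finset.single_le_sum (f := fun i => z i * z i) (fun j _ => mul_self_nonneg (z j))
        (Finset.mem_univ i)
    have hcase : ∀ i, z i = 0 ∨ z i = 1 ∨ z i = -1 := by
      intro i
      have h1 : z i ≤ 1 := by nlinarith [hle i]
      have h2 : -1 ≤ z i := by nlinarith [hle i]
      omega
    have hcard : (Finset.univ.filter fun i => z i ≠ 0).card = 2 := by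
      have h1 : ∑ i, z i * z i = ∑ i, if z i ≠ 0 then (1 : ℤ) else 0 := by
        refine Finset.sum_congr rfl fun i _ => ?_
        rcases hcase i with h | h | h <;> rw [h] <;> simp
      rw [h1, Finset.sum_boole] at hz2
      exact_mod_cast hz2
    obtain ⟨i, j, hij, hS⟩ := Finset.card_eq_two.1 hcard
    have hmem : ∀ k, z k ≠ 0 ↔ k = i ∨ k = j := by
      intro k
      have := Finset.ext_iff.1 hS k
      simpa using this
    have hunit : ∀ k, z k ≠ 0 → x k = 1 ∨ x k = -1 := by
      intro k hk
      rw [hz]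
      rcases hcase k with h | h | h
      · exact absurd h hk
      · left; rw [h]; simp
      · right; rw [h]; simp
    refine ⟨i, j, x i, x j, hij, hunit i ((hmem i).2 (Or.inl rfl)),
      hunit j ((hmem j).2 (Or.inr rfl)), ?_⟩
    ext k
    change x k = pt i j (x i) (x j) k
    rw [pt_apply]
    by_cases hki : k = i
    · subst hki; simp [hij]
    · by_cases hkj : k = j
      · subst hkj; simp [hij.symm]
      · have : z k = 0 := by
          by_contra h
          exact ((hmem k).1 h).elim hki hkj
        rw [hz, this]
        simp [hki, hkj]

lemma neg_mem_cell {x : E4} (hx : x ∈ cellVertices) : -x ∈ cellVertices := by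
  rw [mem_cellVertices_iff] at hx ⊢
  refine ⟨fun i => ?_, by simpa using hx.2⟩
  obtain ⟨z, hz⟩ := hx.1 i
  exact ⟨-z, by simp [hz]⟩

lemma isSpherical_cell : IsSpherical cellVertices 2 1 where
  finite := by
    have : cellVertices ⊆ Set.range fun p : Fin 4 × Fin 4 × Bool × Bool =>
        pt p.1 p.2.1 (if p.2.2.1 then (1 : ℝ) else -1) (if p.2.2.2 then (1 : ℝ) else -1) := by
      rintro _ ⟨i, j, a, b, -, rfl | rfl, rfl | rfl, rfl⟩
      · exact ⟨(i, j, true, true), by simp [pt]⟩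
      · exact ⟨(i, j, true, false), by simp [pt]⟩
      · exact ⟨(i, j, false, true), by simp [pt]⟩
      · exact ⟨(i, j, false, false), by simp [pt]⟩
    exact (Set.finite_range _).subset this
  norm := by
    intro x hx
    rw [inner_eq_sum]
    exact (mem_cellVertices_iff.1 hx).2
  le := by
    intro x hx y hy hne
    have hx' := mem_cellVertices_iff.1 hx
    have hy' := mem_cellVertices_iff.1 hy
    -- The product of distinct vertices is an integer below `2`, hence at most `1`.
    have hlt : inner ℝ x y < 2 := by
      have h0 : 0 < ‖x - y‖ := norm_pos_iff.2 (sub_ne_zero.2 hne)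
      have h1 : 0 < ‖x - y‖ ^ 2 := by positivity
      rw [norm_sub_sq_real, ← real_inner_self_eq_norm_sq, ← real_inner_self_eq_norm_sq,
        inner_eq_sum x x, inner_eq_sum y y, hx'.2, hy'.2] at h1
      linarith
    choose z hz using hx'.1
    choose w hw using hy'.1
    have : inner ℝ x y = ((∑ i, z i * w i : ℤ) : ℝ) := by
      rw [inner_eq_sum]
      push_cast
      exact Finset.sum_congr rfl fun i _ => by rw [hz, hw]
    rw [this] at hlt ⊢
    have h2 : (∑ i, z i * w i : ℤ) < 2 := by exact_mod_cast hlt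
    have h3 : (∑ i, z i * w i : ℤ) ≤ 1 := by omega
    exact_mod_cast h3
  lt := by norm_num

/-- The octahedral facet in which the coordinate `i` equals `s`. -/
noncomputable abbrev cellFacetA (i : Fin 4) (s : ℝ) : Set E4 :=
  faceOf cellVertices (EuclideanSpace.single i s) 1

/-- The octahedral facet whose vertices have the signs `σ`. -/
noncomputable abbrev cellFacetB (σ : Fin 4 → ℝ) : Set E4 :=
  faceOf cellVertices (vec fun i => σ i / 2) 1

/-- The triangle between `x₀ = 1` and the facet with signs `σ`. -/
noncomputable abbrev cellRidge (σ : Fin 4 → ℝ) : Set E4 :=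
  faceOf cellVertices (EuclideanSpace.single 0 1 + vec fun i => σ i / 2) 2

lemma cellA_le {i : Fin 4} {s : ℝ} (hs : s = 1 ∨ s = -1) :
    ∀ x ∈ cellVertices, inner ℝ (EuclideanSpace.single i s) x ≤ 1 := by
  rintro _ ⟨p, q, a, b, hpq, ha, hb, rfl⟩
  change inner ℝ _ (pt p q a b) ≤ 1
  rw [inner_single_left, pt_apply]
  have h1 := (sign_mul_eq_one hs ha).1
  have h2 := (sign_mul_eq_one hs hb).1
  by_cases hp : i = p
  · subst hp; simpa [hpq] using h1
  · by_cases hq : i = q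
    · subst hq; simpa [hp] using h2
    · simp [hp, hq]

lemma mem_cellA {i : Fin 4} {s : ℝ} (hs : s = 1 ∨ s = -1) {x : E4} (hx : x ∈ cellVertices) :
    x ∈ cellFacetA i s ↔ x i = s := by
  rw [mem_faceOf hx, inner_single_left]
  rcases hs with rfl | rfl
  · rw [one_mul]
  · constructor <;> intro h <;> linarith

lemma inner_half (σ : Fin 4 → ℝ) (x : E4) :
    inner ℝ (vec fun i => σ i / 2) x = (∑ i, σ i * x i) / 2 := by
  rw [inner_eq_sum, Finset.sum_div]
  exact Finset.sum_congr rfl fun i _ => by ring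

lemma sum_mul_pt (σ : Fin 4 → ℝ) (p q : Fin 4) (a b : ℝ) :
    ∑ i, σ i * pt p q a b i = σ p * a + σ q * b := by
  have := inner_pt p q a b (vec σ)
  rwa [inner_eq_sum] at this

lemma cellB_le {σ : Fin 4 → ℝ} (hσ : ∀ i, σ i = 1 ∨ σ i = -1) :
    ∀ x ∈ cellVertices, inner ℝ (vec fun i => σ i / 2) x ≤ 1 := by
  rintro _ ⟨p, q, a, b, hpq, ha, hb, rfl⟩
  change inner ℝ _ (pt p q a b) ≤ 1
  rw [inner_half, sum_mul_pt]
  have h1 := (sign_mul_eq_one (hσ p) ha).1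
  have h2 := (sign_mul_eq_one (hσ q) hb).1
  linarith

lemma mem_cellB {σ : Fin 4 → ℝ} {x : E4} (hx : x ∈ cellVertices) :
    x ∈ cellFacetB σ ↔ ∑ i, σ i * x i = 2 := by
  rw [mem_faceOf hx, inner_half]
  constructor <;> intro h <;> linarith

lemma cellRidge_le {σ : Fin 4 → ℝ} (hσ : ∀ i, σ i = 1 ∨ σ i = -1) :
    ∀ x ∈ cellVertices,
      inner ℝ (EuclideanSpace.single 0 1 + vec fun i => σ i / 2) x ≤ 2 := by
  intro x hx
  rw [inner_add_left]
  have := cellA_le (i := 0) (Or.inl rfl) x hx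
  have := cellB_le hσ x hx
  linarith

lemma mem_cellRidge {σ : Fin 4 → ℝ} (hσ : ∀ i, σ i = 1 ∨ σ i = -1) {x : E4}
    (hx : x ∈ cellVertices) : x ∈ cellRidge σ ↔ x 0 = 1 ∧ ∑ i, σ i * x i = 2 := by
  rw [← mem_cellA (Or.inl rfl) hx, ← mem_cellB hx, mem_faceOf hx, mem_faceOf hx, mem_faceOf hx,
    inner_add_left]
  have := cellA_le (i := 0) (Or.inl rfl) x hx
  have := cellB_le hσ x hx
  constructor
  · intro h
    constructor <;> linarith
  · rintro ⟨h1, h2⟩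
    linarith

lemma exposed_cellA {i : Fin 4} {s : ℝ} (hs : s = 1 ∨ s = -1) :
    IsExposed ℝ (convexHull ℝ cellVertices) (cellFacetA i s) := isExposed_faceOf (cellA_le hs)

lemma exposed_cellB {σ : Fin 4 → ℝ} (hσ : ∀ i, σ i = 1 ∨ σ i = -1) :
    IsExposed ℝ (convexHull ℝ cellVertices) (cellFacetB σ) := isExposed_faceOf (cellB_le hσ)

lemma exposed_cellRidge {σ : Fin 4 → ℝ} (hσ : ∀ i, σ i = 1 ∨ σ i = -1) :
    IsExposed ℝ (convexHull ℝ cellVertices) (cellRidge σ) := isExposed_faceOf (cellRidge_le hσ)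

lemma mul_sign_le {t a : ℝ} (ha : a = 1 ∨ a = -1) : t * a ≤ |t| := by
  rcases ha with rfl | rfl
  · simpa using le_abs_self t
  · simpa using neg_le_abs t

/-- Consider the coordinates of the normal of largest absolute value. If only one attains the
maximum, every maximizing vertex uses it, with its sign; if several do, both nonzero coordinates of
a maximizing vertex are among them, with their signs. -/
lemma cell_facet_subset {f : Set E4} (hf : IsExposed ℝ (convexHull ℝ cellVertices) f)
    (hne : f.Nonempty) (hn : f ≠ convexHull ℝ cellVertices) :
    (∃ (i : Fin 4) (s : ℝ), (s = 1 ∨ s = -1) ∧ f ⊆ cellFacetA i s) ∨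
      ∃ σ : Fin 4 → ℝ, (∀ i, σ i = 1 ∨ σ i = -1) ∧ f ⊆ cellFacetB σ := by
  have hsph := isSpherical_cell
  obtain ⟨n, hnf⟩ := exists_normal hf hne
  have hmaxi : ∀ {p q : Fin 4} {a b : ℝ}, p ≠ q → (a = 1 ∨ a = -1) → (b = 1 ∨ b = -1) →
      pt p q a b ∈ f → ∀ {p' q' : Fin 4} {a' b' : ℝ}, p' ≠ q' → (a' = 1 ∨ a' = -1) →
      (b' = 1 ∨ b' = -1) → n p' * a' + n q' * b' ≤ n p * a + n q * b := by
    intro p q a b hpq ha hb hm p' q' a' b' hpq' ha' hb'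
    have := (hnf _ (pt_mem hpq ha hb)).1 hm _ (pt_mem hpq' ha' hb')
    rwa [inner_pt, inner_pt] at this
  obtain ⟨i, hi⟩ := Finite.exists_max fun i => |n i|
  have hi0 : n i ≠ 0 := by
    intro h0
    have hz : ∀ k, n k = 0 := fun k => by
      have := hi k
      rw [h0, abs_zero] at this
      exact abs_nonpos_iff.1 this
    apply hn
    refine hsph.face_ext hf (IsExposed.refl _) fun y hy =>
      iff_of_true ((hnf y hy).2 fun z _ => ?_) (subset_convexHull ℝ _ hy)
    simp [inner_eq_sum, hz]
  by_cases hj : ∃ j, i ≠ j ∧ |n j| = |n i|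
  · right
    obtain ⟨j, hij, hj⟩ := hj
    have hσ : ∀ k, sgn (n k) = 1 ∨ sgn (n k) = -1 := fun k => sgn_eq _
    refine ⟨fun k => sgn (n k), hσ, hsph.face_subset hf (exposed_cellB hσ) ?_⟩
    intro x hx hxf
    rw [mem_cellB hx]
    obtain ⟨p, q, a, b, hpq, ha, hb, rfl⟩ := hx
    change ∑ i, sgn (n i) * pt p q a b i = 2
    have h1 := hmaxi hpq ha hb hxf hij (sgn_eq (n i)) (sgn_eq (n j))
    rw [mul_sgn, mul_sgn, hj] at h1
    have h2 := mul_sign_le (t := n p) ha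
    have h3 := mul_sign_le (t := n q) hb
    have h4 := hi p
    have h5 := hi q
    have hpos : 0 < |n i| := abs_pos.2 hi0
    have hpa : n p * a = |n p| := by linarith
    have hqb : n q * b = |n q| := by linarith
    have hp0 : n p ≠ 0 := by
      intro h; rw [h, zero_mul] at hpa h1; linarith
    have hq0 : n q ≠ 0 := by
      intro h; rw [h, zero_mul] at hqb h1; linarith
    rw [sum_mul_pt, eq_sgn hp0 hpa, eq_sgn hq0 hqb, sgn_mul_self, sgn_mul_self]
    norm_num
  · left
    push Not at hj
    have hlt : ∀ k, i ≠ k → |n k| < |n i| := fun k hk => lt_of_le_of_ne (hi k) (hj k hk)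
    have hs := sgn_eq (n i)
    refine ⟨i, sgn (n i), hs, hsph.face_subset hf (exposed_cellA hs) ?_⟩
    intro x hx hxf
    rw [mem_cellA hs hx]
    have half : ∀ {p q : Fin 4} {a b : ℝ}, p ≠ q → (a = 1 ∨ a = -1) → (b = 1 ∨ b = -1) →
        pt p q a b ∈ f → i = p → pt p q a b i = sgn (n i) := by
      rintro p q a b hpq ha hb hm rfl
      have h1 := hmaxi hpq ha hb hm hpq (sgn_eq (n i)) hb
      rw [mul_sgn] at h1
      have h2 := mul_sign_le (t := n i) ha
      rw [pt_apply, if_pos rfl, if_neg hpq, add_zero]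
      exact eq_sgn hi0 (by linarith)
    obtain ⟨p, q, a, b, hpq, ha, hb, rfl⟩ := hx
    change pt p q a b i = _
    by_cases hp : i = p
    · exact half hpq ha hb hxf hp
    by_cases hq : i = q
    · rw [pt_comm]
      refine half hpq.symm hb ha ?_ hq
      rw [pt_comm]
      exact hxf
    exfalso
    have h1 := hmaxi hpq ha hb hxf (p' := p) (q' := i) (Ne.symm hp) ha hs
    rw [mul_sgn] at h1
    have h2 := mul_sign_le (t := n q) hb
    have h3 := hlt q hq
    linarith

lemma cell_facet {f : Set E4} (hf : IsFacet (convexHull ℝ cellVertices) f) :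
    (∃ (i : Fin 4) (s : ℝ), (s = 1 ∨ s = -1) ∧ f = cellFacetA i s) ∨
      ∃ σ : Fin 4 → ℝ, (∀ i, σ i = 1 ∨ σ i = -1) ∧ f = cellFacetB σ := by
  obtain ⟨hf, hne, hn, hmax⟩ := hf
  obtain ⟨x, hx, hxf⟩ := isSpherical_cell.exists_mem hf hne
  have aux : ∀ {n : E4}, IsExposed ℝ (convexHull ℝ cellVertices) (faceOf cellVertices n 1) →
      f ⊆ faceOf cellVertices n 1 → f = faceOf cellVertices n 1 := by
    intro n he hs
    refine (((hmax _ he hs).resolve_right) fun h => ?_).symm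
    have h1 := (mem_faceOf hx).1 (hs hxf)
    have h2 : -x ∈ faceOf cellVertices n 1 := h ▸ subset_convexHull ℝ _ (neg_mem_cell hx)
    rw [mem_faceOf (neg_mem_cell hx), inner_neg_right, h1] at h2
    norm_num at h2
  rcases cell_facet_subset hf hne hn with ⟨i, s, hs, h⟩ | ⟨σ, hσ, h⟩
  · exact Or.inl ⟨i, s, hs, aux (exposed_cellA hs) h⟩
  · exact Or.inr ⟨σ, hσ, aux (exposed_cellB hσ) h⟩

lemma cell_eq_pt {x : E4} (hx : x ∈ cellVertices) (h0 : x 0 = 1) :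
    ∃ (q : Fin 4) (b : ℝ), 0 ≠ q ∧ (b = 1 ∨ b = -1) ∧ x = pt 0 q 1 b := by
  obtain ⟨p, q, a, b, hpq, ha, hb, rfl⟩ := hx
  change pt p q a b 0 = 1 at h0
  rw [pt_apply] at h0
  by_cases hp : 0 = p
  · subst hp
    simp only [if_true, hpq, if_false, add_zero] at h0
    exact ⟨q, b, hpq, hb, by rw [h0]; rfl⟩
  · by_cases hq : 0 = q
    · subst hq
      simp only [if_true, hp, if_false, zero_add] at h0
      exact ⟨p, a, hp, ha, by rw [h0]; exact pt_comm _ _ _ _⟩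
    · simp [hp, hq] at h0

/-- The facet is an octahedron with vertices `pt 0 q 1 b`. A proper face of it has a normal with a
nonzero coordinate outside `0`, and the signs of the coordinates outside `0` determine a triangle
containing the face. -/
lemma cell_ridge {r : Set E4} (hr : IsRidgeOf (convexHull ℝ cellVertices) (cellFacetA 0 1) r) :
    ∃ σ : Fin 4 → ℝ, (∀ i, σ i = 1 ∨ σ i = -1) ∧ σ 0 = 1 ∧ r = cellRidge σ := by
  obtain ⟨hr, hne, hrf, hn, hmax⟩ := hr
  have hsph := isSpherical_cell
  have one : (1 : ℝ) = 1 ∨ (1 : ℝ) = -1 := Or.inl rfl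
  obtain ⟨n, hnr⟩ := exists_normal hr hne
  have hr0 : ∀ x ∈ cellVertices, x ∈ r → x 0 = 1 := fun x hx hxr =>
    (mem_cellA one hx).1 (hrf hxr)
  obtain ⟨j, h0j, hj⟩ : ∃ j, 0 ≠ j ∧ n j ≠ 0 := by
    by_contra! hc
    apply hn
    refine hrf.antisymm (hsph.face_subset (exposed_cellA one) hr fun y hy hyf => ?_)
    obtain ⟨x, hx, hxr⟩ := hsph.exists_mem hr hne
    obtain ⟨q, b, hq, hb, rfl⟩ := cell_eq_pt hy ((mem_cellA one hy).1 hyf)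
    obtain ⟨q', b', hq', hb', rfl⟩ := cell_eq_pt hx (hr0 x hx hxr)
    have heq : inner ℝ n (pt 0 q 1 b) = inner ℝ n (pt 0 q' 1 b') := by
      rw [inner_pt, inner_pt, hc q hq, hc q' hq', zero_mul, zero_mul]
    rw [hnr _ hy, heq]
    exact (hnr _ hx).1 hxr
  let σ : Fin 4 → ℝ := fun k => if k = 0 then 1 else sgn (n k)
  have hσ : ∀ k, σ k = 1 ∨ σ k = -1 := by
    intro k
    simp only [σ]
    split_ifs
    · exact one
    · exact sgn_eq _
  have hσ0 : σ 0 = 1 := rfl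
  refine ⟨σ, hσ, hσ0, ?_⟩
  have h1 : r ⊆ cellRidge σ := by
    refine hsph.face_subset hr (exposed_cellRidge hσ) fun y hy hyr => ?_
    rw [mem_cellRidge hσ hy]
    have hy0 := hr0 y hy hyr
    refine ⟨hy0, ?_⟩
    obtain ⟨q, b, hq, hb, rfl⟩ := cell_eq_pt hy hy0
    have hk : ∀ k, 0 ≠ k → |n k| ≤ n q * b := by
      intro k hk
      have := (hnr _ hy).1 hyr _ (pt_mem hk one (sgn_eq (n k)))
      rw [inner_pt, inner_pt, mul_sgn] at this
      linarith
    have hq0 : n q ≠ 0 := by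
      intro h
      have := hk j h0j
      rw [h, zero_mul] at this
      exact hj (abs_nonpos_iff.1 this)
    have hb' : b = sgn (n q) := eq_sgn hq0 (le_antisymm (mul_sign_le hb) (hk q hq))
    have hσq : σ q = sgn (n q) := if_neg hq.symm
    rw [sum_mul_pt, hσ0, hσq, hb', sgn_mul_self]
    norm_num
  have h2 : cellRidge σ ⊆ cellFacetA 0 1 :=
    hsph.face_subset (exposed_cellRidge hσ) (exposed_cellA one) fun y hy hyr =>
      (mem_cellA one hy).2 ((mem_cellRidge hσ hy).1 hyr).1
  rcases hmax _ (exposed_cellRidge hσ) h1 h2 with h | h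
  · exact h.symm
  · exfalso
    have hm : pt 0 1 1 (-σ 1) ∈ cellVertices := pt_mem (by decide) one (by
      rcases hσ 1 with h | h <;> rw [h] <;> simp)
    have h3 : pt 0 1 1 (-σ 1) ∈ cellFacetA 0 1 := by
      rw [mem_cellA one hm, pt_apply]
      simp
    rw [← h, mem_cellRidge hσ hm, sum_mul_pt, hσ0] at h3
    have h4 := h3.2
    rcases hσ 1 with h | h <;> rw [h] at h4 <;> norm_num at h4

lemma signedPerm_cell {σ : Fin 4 → ℝ} (hσ : ∀ k, σ k = 1 ∨ σ k = -1) (hσ2 : ∀ k, σ k * σ k = 1)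
    (e : Equiv.Perm (Fin 4)) {x : E4} (hx : x ∈ cellVertices) :
    signedPerm σ hσ2 e x ∈ cellVertices ∧ (signedPerm σ hσ2 e).symm x ∈ cellVertices := by
  rw [mem_cellVertices_iff] at hx
  have hint : ∀ k l, ∃ z : ℤ, σ k * x l = z := by
    intro k l
    obtain ⟨z, hz⟩ := hx.1 l
    rcases hσ k with h | h
    · exact ⟨z, by rw [h, hz, one_mul]⟩
    · exact ⟨-z, by rw [h, hz]; simp⟩
  have hsq : ∀ k l, σ k * x l * (σ k * x l) = x l * x l := by
    intro k l
    linear_combination (x l * x l) * hσ2 k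
  constructor
  · rw [mem_cellVertices_iff]
    refine ⟨fun k => hint _ _, ?_⟩
    simp only [signedPerm_apply, hsq]
    rw [Equiv.sum_comp e fun k => x k * x k]
    exact hx.2
  · rw [mem_cellVertices_iff]
    refine ⟨fun k => hint _ _, ?_⟩
    simp only [signedPerm_symm_apply]
    have h1 : ∀ k, σ (e.symm k) * x (e.symm k) * (σ (e.symm k) * x (e.symm k)) =
        x (e.symm k) * x (e.symm k) := fun k => hsq _ _
    simp only [h1]
    rw [Equiv.sum_comp e.symm fun k => x k * x k]
    exact hx.2

/-- The reflection in the hyperplane orthogonal to `(1, -1, -1, -1)`. -/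
noncomputable def cellReflection : E4 ≃ₗ[ℝ] E4 :=
  LinearEquiv.ofInvolutive
    { toFun := fun x => x - ((x 0 - x 1 - x 2 - x 3) / 2) • vec fun k => if k = 0 then 1 else -1
      map_add' := fun x y => by
        ext k
        fin_cases k <;> simp [vec] <;> ring
      map_smul' := fun c x => by
        ext k
        fin_cases k <;> simp [vec] <;> ring }
    fun x => by
      ext k
      fin_cases k <;> simp [vec] <;> ring

lemma cellReflection_apply (x : E4) (k : Fin 4) : cellReflection x k =
    x k - (x 0 - x 1 - x 2 - x 3) / 2 * (if k = 0 then 1 else -1) := rfl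

lemma cellReflection_mem {x : E4} (hx : x ∈ cellVertices) : cellReflection x ∈ cellVertices := by
  rw [mem_cellVertices_iff] at hx ⊢
  obtain ⟨hint, hsum⟩ := hx
  constructor
  · choose z hz using hint
    rw [Fin.sum_univ_four] at hsum
    simp only [hz] at hsum
    have hsum' : z 0 * z 0 + z 1 * z 1 + z 2 * z 2 + z 3 * z 3 = 2 := by exact_mod_cast hsum
    -- Each integer has the parity of its square and the squares sum to `2`, so the reflection
    -- preserves integrality.
    obtain ⟨t, ht⟩ : ∃ t, z 0 - z 1 - z 2 - z 3 = 2 * t := by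
      obtain ⟨a, ha⟩ := Int.even_mul_pred_self (z 0)
      obtain ⟨b, hb⟩ := Int.even_mul_pred_self (z 1)
      obtain ⟨c, hc⟩ := Int.even_mul_pred_self (z 2)
      obtain ⟨d, hd⟩ := Int.even_mul_pred_self (z 3)
      refine ⟨1 - a - b - c - d - z 1 - z 2 - z 3, ?_⟩
      linear_combination hsum' - ha - hb - hc - hd
    have ht' : ((z 0 : ℝ) - z 1 - z 2 - z 3) / 2 = t := by
      rw [div_eq_iff two_ne_zero, mul_comm]
      exact_mod_cast ht
    intro k
    rw [cellReflection_apply, hz, hz, hz, hz, hz, ht']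
    split_ifs
    · exact ⟨z k - t, by push_cast; ring⟩
    · exact ⟨z k + t, by push_cast; ring⟩
  · rw [← hsum, Fin.sum_univ_four, Fin.sum_univ_four]
    simp [cellReflection_apply]
    ring

/-- Signed permutations act transitively within each of the two kinds of facets. The reflection
exchanges the kinds, because the coordinate sum of the image of `x` is `2 * x 0`. -/
lemma exists_cell_symmetry {f : Set E4} (hf : IsFacet (convexHull ℝ cellVertices) f) :
    ∃ T : E4 ≃ₗ[ℝ] E4, (∀ x ∈ cellVertices, T x ∈ cellVertices) ∧
      (∀ x ∈ cellVertices, T.symm x ∈ cellVertices) ∧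
      ∀ x ∈ cellVertices, T x ∈ f ↔ x ∈ cellFacetA 0 1 := by
  rcases cell_facet hf with ⟨i, s, hs, rfl⟩ | ⟨σ, hσ, rfl⟩
  · have hs2 : ∀ _ : Fin 4, s * s = 1 := fun _ => by rcases hs with h | h <;> rw [h] <;> simp
    refine ⟨signedPerm (fun _ => s) hs2 (Equiv.swap 0 i),
      fun x hx => (signedPerm_cell (fun _ => hs) hs2 _ hx).1,
      fun x hx => (signedPerm_cell (fun _ => hs) hs2 _ hx).2, fun x hx => ?_⟩
    rw [mem_cellA hs (signedPerm_cell (fun _ => hs) hs2 _ hx).1, mem_cellA (Or.inl rfl) hx,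
      signedPerm_apply, Equiv.swap_apply_right]
    rcases hs with rfl | rfl
    · rw [one_mul]
    · constructor <;> intro h <;> linarith
  · have hσ2 : ∀ k, σ k * σ k = 1 := fun k => by rcases hσ k with h | h <;> rw [h] <;> simp
    have hT := fun {x : E4} (hx : x ∈ cellVertices) =>
      signedPerm_cell hσ hσ2 (Equiv.refl _) hx
    refine ⟨cellReflection.trans (signedPerm σ hσ2 (Equiv.refl _)),
      fun x hx => (hT (cellReflection_mem hx)).1,
      fun x hx => cellReflection_mem (hT hx).2, fun x hx => ?_⟩
    rw [LinearEquiv.trans_apply, mem_cellB (hT (cellReflection_mem hx)).1,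
      mem_cellA (Or.inl rfl) hx]
    simp only [signedPerm_apply, ← mul_assoc, hσ2, one_mul, Equiv.refl_apply]
    rw [Fin.sum_univ_four]
    simp [cellReflection_apply]
    constructor <;> intro h <;> linarith

/-- A symmetry first carries the fixed facet to `f`; the pulled back ridge is then one of the
triangles of the fixed facet, and sign changes of the coordinates other than `0` permute these
triangles transitively. -/
lemma cell_flag (f s : FaceLattice (convexHull ℝ cellVertices))
    (hf : IsFacet (convexHull ℝ cellVertices) f.1)
    (hs : IsRidgeOf (convexHull ℝ cellVertices) f.1 s.1) :
    ∃ Θ : FaceLattice (convexHull ℝ cellVertices) ≃o FaceLattice (convexHull ℝ cellVertices),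
      Θ ⟨cellRidge fun _ => 1, exposed_cellRidge fun _ => Or.inl rfl⟩ = s ∧
        Θ ⟨cellFacetA 0 1, exposed_cellA (Or.inl rfl)⟩ = f := by
  have hsph := isSpherical_cell
  obtain ⟨T, hT, hT', hTf⟩ := exists_cell_symmetry hf
  let F : FaceLattice (convexHull ℝ cellVertices) :=
    ⟨cellFacetA 0 1, exposed_cellA (Or.inl rfl)⟩
  obtain ⟨Θ, -, hΘ⟩ := exists_automorphism hsph T hT hT' F F f f hTf hTf
  have hr := IsRidgeOf.map Θ.symm hs
  rw [← hΘ, Θ.symm_apply_apply] at hr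
  obtain ⟨σ, hσ, hσ0, he⟩ := cell_ridge hr
  have hσ2 : ∀ k, σ k * σ k = 1 := fun k => by rcases hσ k with h | h <;> rw [h] <;> simp
  have hS := fun {x : E4} (hx : x ∈ cellVertices) => signedPerm_cell hσ hσ2 (Equiv.refl _) hx
  obtain ⟨Θ', hΘ', hΘ''⟩ := exists_automorphism hsph (signedPerm σ hσ2 (Equiv.refl _))
    (fun x hx => (hS hx).1) (fun x hx => (hS hx).2)
    ⟨cellRidge fun _ => 1, exposed_cellRidge fun _ => Or.inl rfl⟩ F
    (Θ.symm s) F (fun x hx => by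
      rw [he, mem_cellRidge hσ (hS hx).1, mem_cellRidge (fun _ => Or.inl rfl) hx]
      simp only [signedPerm_apply, ← mul_assoc, hσ2, one_mul, Equiv.refl_apply, hσ0])
    (fun x hx => by
      change _ ∈ cellFacetA 0 1 ↔ _ ∈ cellFacetA 0 1
      rw [mem_cellA (Or.inl rfl) (hS hx).1, mem_cellA (Or.inl rfl) hx, signedPerm_apply, hσ0,
        one_mul, Equiv.refl_apply])
  refine ⟨Θ'.trans Θ, ?_, ?_⟩
  · rw [OrderIso.trans_apply, hΘ', OrderIso.apply_symm_apply]
  · rw [OrderIso.trans_apply, hΘ'', hΘ]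

lemma cell_other {f : Set E4} (hf : IsFacet (convexHull ℝ cellVertices) f)
    (hrf : (cellRidge fun _ => 1) ⊆ f) : f = cellFacetA 0 1 ∨ f = cellFacetB fun _ => 1 := by
  have one : (1 : ℝ) = 1 ∨ (1 : ℝ) = -1 := Or.inl rfl
  have hm : ∀ {j : Fin 4}, 0 ≠ j → pt 0 j 1 1 ∈ cellVertices := fun hj => pt_mem hj one one
  have hmem : ∀ {j : Fin 4}, 0 ≠ j → pt 0 j 1 1 ∈ f := fun {j} hj => hrf (by
    rw [mem_cellRidge (fun _ => one) (hm hj), sum_mul_pt, pt_apply]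
    norm_num [hj])
  rcases cell_facet hf with ⟨i, s, hs, rfl⟩ | ⟨σ, hσ, rfl⟩
  · left
    have key : ∀ {j : Fin 4}, 0 ≠ j → pt 0 j 1 1 i = s := fun hj =>
      (mem_cellA hs (hm hj)).1 (hmem hj)
    obtain rfl : i = 0 := by
      by_contra hi
      obtain ⟨j, hj, hij⟩ : ∃ j : Fin 4, 0 ≠ j ∧ i ≠ j := by
        clear hrf hmem key hf; revert i; decide
      have := key hj
      rw [pt_apply, if_neg hi, if_neg hij] at this
      rcases hs with h | h <;> rw [h] at this <;> norm_num at this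
    have := key (j := 1) (by decide)
    rw [pt_apply] at this
    rw [← this]
    norm_num
  · right
    have key : ∀ {j : Fin 4}, 0 ≠ j → σ 0 + σ j = 2 := fun hj => by
      have := (mem_cellB (hm hj)).1 (hmem hj)
      rw [sum_mul_pt] at this
      linarith
    have h0 : σ 0 = 1 := by
      have := key (j := 1) (by decide)
      rcases hσ 0 with h | h
      · exact h
      · rcases hσ 1 with h' | h' <;> rw [h, h'] at this <;> norm_num at this
    congr 1
    ext k
    by_cases hk : 0 = k
    · rw [← hk, h0]
    · have := key hk
      linarith

/-- The scribings of the 24-cell considered here ignore two adjacent facets. -/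
abbrev IsCellScribing (W : E4 → M5) : Prop :=
  IsPartialScribing cellVertices (cellFacetA 0 1) (cellFacetB fun _ => 1) W

lemma sign_mul_self {a : ℝ} (ha : a = 1 ∨ a = -1) : a * a = 1 := by
  rcases ha with h | h <;> rw [h] <;> simp

lemma pt_mem_cellA {j : Fin 4} {b : ℝ} (hj : 0 ≠ j) (hb : b = 1 ∨ b = -1) :
    pt 0 j 1 b ∈ cellFacetA 0 1 := by
  rw [mem_cellA (Or.inl rfl) (pt_mem hj (Or.inl rfl) hb), pt_apply]
  simp [hj]

lemma pt_mem_cellB {i j : Fin 4} (hij : i ≠ j) : pt i j 1 1 ∈ cellFacetB fun _ => 1 := by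
  rw [mem_cellB (pt_mem hij (Or.inl rfl) (Or.inl rfl)), sum_mul_pt]
  norm_num

lemma pt_mem_cellRidge {j : Fin 4} (hj : 0 ≠ j) : pt 0 j 1 1 ∈ cellRidge fun _ => 1 := by
  have h := pt_mem hj (a := 1) (b := 1) (Or.inl rfl) (Or.inl rfl)
  rw [mem_cellRidge (fun _ => Or.inl rfl) h, ← mem_cellA (Or.inl rfl) h, ← mem_cellB h]
  exact ⟨pt_mem_cellA hj (Or.inl rfl), pt_mem_cellB hj⟩

section Scribing

variable {W : E4 → M5} (hW : IsCellScribing W)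
include hW

lemma cell_norm {x : E4} (hx : x ∈ cellVertices) : lor (W x) (W x) = 1 := by
  obtain ⟨i, j, a, b, hij, ha, hb, rfl⟩ := hx
  obtain ⟨k, hik, hjk⟩ : ∃ k, i ≠ k ∧ j ≠ k := by
    clear hij; revert i j; decide
  have ha' := sign_mul_self ha
  have hb' := sign_mul_self hb
  have one : (1 : ℝ) = 1 ∨ (1 : ℝ) = -1 := Or.inl rfl
  refine hW.norm_of_triangle isSpherical_cell (u := pt i j a b) (pt_mem hij ha hb)
    (pt_mem hik ha one) (pt_mem hjk hb one) ?_ ?_ ?_ <;>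
  simp [inner_pt, pt_apply, hij, hij.symm, hik.symm, hjk, hjk.symm, ha', hb']

lemma cell_edge {u v : E4} (hu : u ∈ cellVertices) (hv : v ∈ cellVertices)
    (huv : inner ℝ u v = 1) : lor (W u) (W v) = -1 := by
  rw [(hW.edge isSpherical_cell hu hv huv).2, cell_norm hW hu, cell_norm hW hv, one_mul]

/-- The diagonals of an octahedral facet have the same sum of end points. -/
lemma cell_octahedron {n a a' b b' c c' : E4} (hn : ∀ x ∈ cellVertices, inner ℝ n x ≤ 1)
    (hF : ∃ x ∈ cellVertices, x ∈ cellFacetA 0 1 ∧ inner ℝ n x ≠ 1)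
    (hG : ∃ x ∈ cellVertices, (x ∈ cellFacetB fun _ => 1) ∧ inner ℝ n x ≠ 1)
    (ha : a ∈ cellVertices) (ha' : a' ∈ cellVertices) (hb : b ∈ cellVertices)
    (hb' : b' ∈ cellVertices) (hc : c ∈ cellVertices) (hc' : c' ∈ cellVertices)
    (na : inner ℝ n a = 1) (na' : inner ℝ n a' = 1) (nb : inner ℝ n b = 1)
    (nb' : inner ℝ n b' = 1) (nc : inner ℝ n c = 1) (nc' : inner ℝ n c' = 1)
    (haa : inner ℝ a a' = 0) (hbb : inner ℝ b b' = 0) (hcc : inner ℝ c c' = 0)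
    (hab : inner ℝ a b = 1) (hab' : inner ℝ a b' = 1) (ha'b : inner ℝ a' b = 1)
    (ha'b' : inner ℝ a' b' = 1) (hac : inner ℝ a c = 1) (hac' : inner ℝ a c' = 1)
    (ha'c : inner ℝ a' c = 1) (ha'c' : inner ℝ a' c' = 1) (hbc : inner ℝ b c = 1)
    (hbc' : inner ℝ b c' = 1) (hb'c : inner ℝ b' c = 1) (hb'c' : inner ℝ b' c' = 1) :
    W a + W a' = W b + W b' := by
  have hsph := isSpherical_cell
  obtain ⟨L, hL⟩ := hW.functional hsph hn ⟨a, ha, na⟩ hF hG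
  have hne : ∀ {u v : E4}, u ∈ cellVertices → v ∈ cellVertices → inner ℝ u v = 0 →
      W u ≠ W v := fun hu hv h0 => hW.ne hsph hu hv (by
    rintro rfl
    rw [hsph.norm _ hu] at h0
    norm_num at h0)
  have hzero := fun {x : E4} (hx : x ∈ cellVertices) (h : inner ℝ n x = 1) => (hL x hx).2.2 h
  refine octahedron_rigid (cell_norm hW ha) (cell_norm hW ha') (cell_norm hW hb)
    (cell_norm hW hb') (cell_norm hW hc) (cell_norm hW hc') (cell_edge hW ha hb hab)
    (cell_edge hW ha hb' hab') (cell_edge hW ha' hb ha'b) (cell_edge hW ha' hb' ha'b')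
    (cell_edge hW ha hc hac) (cell_edge hW ha hc' hac') (cell_edge hW ha' hc ha'c)
    (cell_edge hW ha' hc' ha'c') (cell_edge hW hb hc hbc) (cell_edge hW hb hc' hbc')
    (cell_edge hW hb' hc hb'c) (cell_edge hW hb' hc' hb'c') (hW.pos hsph ha) (hW.pos hsph hb)
    (hW.pos hsph hc) (hne ha ha' haa) (hne hb hb' hbb) (hne hc hc' hcc) (hzero ha na)
    (hzero ha' na') (hzero hb nb) (hzero hb' nb') (hzero hc nc) (hzero hc' nc')
    (y := W (-a)) fun h => ?_
  have := (hL _ (neg_mem_cell ha)).2.1 h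
  rw [inner_neg_right, na] at this
  norm_num at this

/-- This is the octahedron with signs `γ`, `δ` at `k`, `l` and plus signs at `0`, `j`. The condition
`hγδ` keeps it different from the ignored facet. -/
lemma cell_relation_B {j k l : Fin 4} (h0j : 0 ≠ j) (h0k : 0 ≠ k) (h0l : 0 ≠ l) (hjk : j ≠ k)
    (hjl : j ≠ l) (hkl : k ≠ l) {γ δ : ℝ} (hγ : γ = 1 ∨ γ = -1) (hδ : δ = 1 ∨ δ = -1)
    (hγδ : γ = -1 ∨ δ = -1) :
    W (pt 0 j 1 1) + W (pt k l γ δ) = W (pt 0 k 1 γ) + W (pt j l 1 δ) := by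
  have one : (1 : ℝ) = 1 ∨ (1 : ℝ) = -1 := Or.inl rfl
  have neg : (-1 : ℝ) = 1 ∨ (-1 : ℝ) = -1 := Or.inr rfl
  have hγ' := sign_mul_self hγ
  have hδ' := sign_mul_self hδ
  let σ : Fin 4 → ℝ := fun i => if i = k then γ else if i = l then δ else 1
  have hσ : ∀ i, σ i = 1 ∨ σ i = -1 := by
    intro i
    simp only [σ]
    split_ifs
    exacts [hγ, hδ, one]
  have σ0 : σ 0 = 1 := by simp [σ, h0k, h0l]
  have σj : σ j = 1 := by simp [σ, hjk, hjl]
  have σk : σ k = γ := by simp [σ]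
  have σl : σ l = δ := by simp [σ, hkl.symm]
  have hn : ∀ p q a b, inner ℝ (vec fun i => σ i / 2) (pt p q a b) = (σ p * a + σ q * b) / 2 :=
    fun p q a b => by rw [inner_half, sum_mul_pt]
  refine cell_octahedron hW (c := pt 0 l 1 δ) (c' := pt j k 1 γ) (cellB_le hσ)
    ⟨_, pt_mem h0j one neg, pt_mem_cellA h0j neg, by rw [hn, σ0, σj]; norm_num⟩ ?_
    (pt_mem h0j one one) (pt_mem hkl hγ hδ) (pt_mem h0k one hγ) (pt_mem hjl one hδ)
    (pt_mem h0l one hδ) (pt_mem hjk one hγ) ?_ ?_ ?_ ?_ ?_ ?_ ?_ ?_ ?_ ?_ ?_ ?_ ?_ ?_ ?_ ?_ ?_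
    ?_ ?_ ?_ ?_
  · rcases hγδ with h | h
    · exact ⟨_, pt_mem hjk one one, pt_mem_cellB hjk, by rw [hn, σj, σk, h]; norm_num⟩
    · exact ⟨_, pt_mem hjl one one, pt_mem_cellB hjl, by rw [hn, σj, σl, h]; norm_num⟩
  iterate 6 rw [hn]; simp only [σ0, σj, σk, σl, hγ', hδ']; norm_num
  all_goals
    simp [inner_pt, pt_apply, h0j, h0k, h0l, hjk, hjl, hkl, h0j.symm, h0k.symm, h0l.symm,
      hjk.symm, hjl.symm, hkl.symm, hγ', hδ']

lemma cell_relation_A {j k l : Fin 4} (h0j : 0 ≠ j) (h0k : 0 ≠ k) (h0l : 0 ≠ l) (hjk : j ≠ k)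
    (hjl : j ≠ l) (hkl : k ≠ l) :
    W (pt j k 1 1) + W (pt j k 1 (-1)) = W (pt j l 1 1) + W (pt j l 1 (-1)) := by
  have one : (1 : ℝ) = 1 ∨ (1 : ℝ) = -1 := Or.inl rfl
  have neg : (-1 : ℝ) = 1 ∨ (-1 : ℝ) = -1 := Or.inr rfl
  refine cell_octahedron hW (n := EuclideanSpace.single j 1) (c := pt j 0 1 1)
    (c' := pt j 0 1 (-1)) (cellA_le one)
    ⟨_, pt_mem h0j one neg, pt_mem_cellA h0j neg, ?_⟩ ⟨_, pt_mem hkl one one, pt_mem_cellB hkl, ?_⟩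
    (pt_mem hjk one one) (pt_mem hjk one neg) (pt_mem hjl one one) (pt_mem hjl one neg)
    (pt_mem h0j.symm one one) (pt_mem h0j.symm one neg) ?_ ?_ ?_ ?_ ?_ ?_ ?_ ?_ ?_ ?_ ?_ ?_ ?_ ?_
    ?_ ?_ ?_ ?_ ?_ ?_ ?_
  all_goals
    norm_num [inner_pt, pt_apply, h0j, h0k, h0l, hjk, hjl, h0j.symm, hjk.symm, hjl.symm, hkl.symm]

/-- These are diagonal relations in the two ignored octahedra, where flatness cannot be used. They
follow by adding the relations of unignored octahedra around the ridge. -/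
lemma cell_star {j k l : Fin 4} (h0j : 0 ≠ j) (h0k : 0 ≠ k) (h0l : 0 ≠ l) (hjk : j ≠ k)
    (hjl : j ≠ l) (hkl : k ≠ l) :
    W (pt 0 k 1 1) + W (pt 0 k 1 (-1)) = W (pt 0 l 1 1) + W (pt 0 l 1 (-1)) ∧
      W (pt 0 k 1 1) + W (pt j l 1 1) = W (pt 0 l 1 1) + W (pt j k 1 1) := by
  have key : ∀ {s t : ℝ}, (s = 1 ∨ s = -1) → (t = 1 ∨ t = -1) → (s = -1 ∨ t = -1) →
      W (pt 0 k 1 s) + W (pt j l 1 t) = W (pt 0 l 1 t) + W (pt j k 1 s) := fun {s t} hs ht h => by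
    rw [← cell_relation_B hW h0j h0k h0l hjk hjl hkl hs ht h,
      ← cell_relation_B hW h0j h0l h0k hjl hjk hkl.symm ht hs h.symm, pt_comm k l]
  have h1 := key (Or.inl rfl) (Or.inr rfl) (Or.inr rfl)
  have h2 := key (Or.inr rfl) (Or.inl rfl) (Or.inl rfl)
  have h3 := key (Or.inr rfl) (Or.inr rfl) (Or.inr rfl)
  have h4 := cell_relation_A hW h0j h0k h0l hjk hjl hkl
  constructor
  · linear_combination (norm := module) h1 + h2 + h4
  · linear_combination (norm := module) h1 + h2 - h3

end Scribing

/-- Let `S` and `T` be the common sums of opposite vertices in the two facets and `R` the sum of the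
ridge triangle. A ridge vertex has product `-2` with `S` and `T` and `-1` with `R`, so the normals
are `S - 2 • R` and `T - 2 • R`; their products are those of `S` and `T` plus `12`, namely `-4 + 12
= 8` and `-8 + 12 = 4`. -/
lemma cell_hinge {W : E4 → M5}
    (hS : Scribing (convexHull ℝ cellVertices)
      {convexHull ℝ cellVertices, cellFacetA 0 1, cellFacetB fun _ => 1} W) :
    IsHinge cellVertices W (cellRidge fun _ => 1) (cellFacetA 0 1) (cellFacetB fun _ => 1) 8 4 := by
  have hsph := isSpherical_cell
  have one : (1 : ℝ) = 1 ∨ (1 : ℝ) = -1 := Or.inl rfl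
  have neg : (-1 : ℝ) = 1 ∨ (-1 : ℝ) = -1 := Or.inr rfl
  have hne : ∀ {j k : Fin 4}, 0 ≠ j → j ≠ k → pt 0 j 1 1 ≠ pt 0 k 1 1 := by
    intro j k hj hjk h
    have := congrArg (fun x : E4 => x j) h
    simp [pt_apply, hj.symm, hjk] at this
  have h01 : (0 : Fin 4) ≠ 1 := by decide
  have h02 : (0 : Fin 4) ≠ 2 := by decide
  have h03 : (0 : Fin 4) ≠ 3 := by decide
  have h12 : (1 : Fin 4) ≠ 2 := by decide
  have h13 : (1 : Fin 4) ≠ 3 := by decide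
  have h23 : (2 : Fin 4) ≠ 3 := by decide
  have hm := fun {j : Fin 4} (hj : 0 ≠ j) => pt_mem hj one one
  have hm' := fun {j : Fin 4} (hj : 0 ≠ j) => pt_mem hj one neg
  have hW : IsCellScribing W := ⟨hS,
    exists_ne_ne (hm h01) (hm h02) (hm h03) (pt_mem_cellA h01 one) (pt_mem_cellA h02 one)
      (pt_mem_cellA h03 one) (hne h01 h12) (hne h01 h13) (hne h02 h23),
    exists_ne_ne (hm h01) (hm h02) (hm h03) (pt_mem_cellB h01) (pt_mem_cellB h02)
      (pt_mem_cellB h03) (hne h01 h12) (hne h01 h13) (hne h02 h23)⟩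
  obtain ⟨A, hA⟩ : ∃ A : Fin 4 → M5, ∀ j, A j = W (pt 0 j 1 1) := ⟨_, fun _ => rfl⟩
  obtain ⟨S, hS⟩ : ∃ S : M5, ∀ j, 0 ≠ j → W (pt 0 j 1 (-1)) = S - A j := by
    refine ⟨A 1 + W (pt 0 1 1 (-1)), fun j hj => ?_⟩
    rw [eq_sub_iff_add_eq', hA, hA]
    by_cases h : j = 1
    · rw [h]
    obtain ⟨i, hi0, hij, hi1⟩ : ∃ i : Fin 4, 0 ≠ i ∧ i ≠ j ∧ i ≠ 1 := by
      clear h hj; revert j; decide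
    exact (cell_star hW hi0 hj h01 hij hi1 h).1
  obtain ⟨T, hT⟩ : ∃ T : M5, ∀ j k l, 0 ≠ j → 0 ≠ k → 0 ≠ l → j ≠ k → j ≠ l → k ≠ l →
      W (pt k l 1 1) = T - A j := by
    refine ⟨A 1 + W (pt 2 3 1 1), fun j k l hj hk hl hjk hjl hkl => ?_⟩
    rw [eq_sub_iff_add_eq', hA, hA]
    have e1 := (cell_star hW h03 h01 h02 h13.symm h23.symm h12).2
    have e2 := (cell_star hW h02 h01 h03 h12.symm h23 h13).2
    simp only [pt_comm 3] at e1
    rw [pt_comm 2 1] at e2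
    fin_cases j <;> fin_cases k <;> fin_cases l <;>
    simp at hj hk hl hjk hjl hkl ⊢
    · rw [pt_comm 3 2]
    · exact e1.symm
    · rw [pt_comm 3 1]
      exact e1.symm
    · exact e2.symm
    · rw [pt_comm 2 1]
      exact e2.symm
  have hAA : ∀ j, 0 ≠ j → lor (A j) (A j) = 1 := fun j hj => by
    rw [hA]
    exact cell_norm hW (hm hj)
  have hAB : ∀ j k, 0 ≠ j → 0 ≠ k → j ≠ k → lor (A j) (A k) = -1 := fun j k hj hk hjk => by
    rw [hA, hA]
    refine cell_edge hW (hm hj) (hm hk) ?_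
    simp [inner_pt, pt_apply, hj, hk.symm, hjk.symm]
  have hSA : ∀ j, 0 ≠ j → lor S (A j) = -2 := fun j hj => by
    obtain ⟨k, hk, hjk⟩ : ∃ k : Fin 4, 0 ≠ k ∧ k ≠ j := by
      clear hj; revert j; decide
    have h1 : lor (S - A k) (A j) = -1 := by
      rw [← hS k hk, hA]
      refine cell_edge hW (hm' hk) (hm hj) ?_
      simp [inner_pt, pt_apply, hj.symm, hk, hjk.symm]
    rw [map_sub, LinearMap.sub_apply, hAB k j hk hj hjk] at h1
    linarith
  have hTA : ∀ j, 0 ≠ j → lor T (A j) = -2 := fun j hj => by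
    obtain ⟨k, l, hk, hl, hjk, hjl, hkl⟩ : ∃ k l : Fin 4, 0 ≠ k ∧ 0 ≠ l ∧ k ≠ j ∧ l ≠ j ∧
        k ≠ l := by
      clear hj; revert j; decide
    have h1 : lor (T - A k) (A j) = -1 := by
      rw [← hT k j l hk hj hl hjk hkl hjl.symm, hA]
      refine cell_edge hW (pt_mem hjl.symm one one) (hm hj) ?_
      simp [inner_pt, pt_apply, hj, hl, hjl.symm]
    rw [map_sub, LinearMap.sub_apply, hAB k j hk hj hjk] at h1
    linarith
  have hSS : lor S S = -4 := by
    have h1 : lor (S - A 1) (S - A 1) = 1 := by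
      rw [← hS 1 h01]
      exact cell_norm hW (hm' h01)
    simp only [map_sub, LinearMap.sub_apply, lor_comm (A 1) S, hSA 1 h01, hAA 1 h01] at h1
    linarith
  have hTT : lor T T = -4 := by
    have h1 : lor (T - A 1) (T - A 1) = 1 := by
      rw [← hT 1 2 3 h01 h02 h03 h12 h13 h23]
      exact cell_norm hW (pt_mem h23 one one)
    simp only [map_sub, LinearMap.sub_apply, lor_comm (A 1) T, hTA 1 h01, hAA 1 h01] at h1
    linarith
  have hST : lor S T = -8 := by
    -- The octahedron with a minus sign at coordinate `1` has as opposite vertices one vertex from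
    -- each facet at the ridge, off the ridge. It ties `S` to `T`.
    have e := cell_relation_B hW h02 h01 h03 h12.symm h23 h13 neg one (Or.inl rfl)
    have h1 : lor (W (pt 0 1 1 (-1))) (W (pt 0 2 1 1)) = -1 :=
      cell_edge hW (hm' h01) (hm h02) (by simp [inner_pt, pt_apply, h02.symm, h12.symm])
    have h2 : lor (W (pt 0 1 1 (-1))) (W (pt 1 3 (-1) 1)) = -1 :=
      cell_edge hW (hm' h01) (pt_mem h13 neg one)
        (by simp [inner_pt, pt_apply, h03.symm, h13.symm])
    have h3 := cell_norm hW (hm' h01)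
    have h4 := congrArg (lor (W (pt 0 1 1 (-1)))) e
    rw [map_add, map_add, h1, h2, h3, hS 1 h01, hT 1 2 3 h01 h02 h03 h12 h13 h23] at h4
    simp only [map_sub, LinearMap.sub_apply, lor_comm (A 1) T, hSA 1 h01, hTA 1 h01,
      hAA 1 h01] at h4
    linarith
  set R := A 1 + A 2 + A 3 with hR
  have cases3 : ∀ j : Fin 4, 0 ≠ j → j = 1 ∨ j = 2 ∨ j = 3 := by decide
  have hRA : ∀ j, 0 ≠ j → lor R (A j) = -1 := fun j hj => by
    rcases cases3 j hj with rfl | rfl | rfl <;>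
    simp only [hR, map_add, LinearMap.add_apply, hAA 1 h01, hAA 2 h02, hAA 3 h03,
      hAB 1 2 h01 h02 h12, hAB 2 1 h02 h01 h12.symm, hAB 1 3 h01 h03 h13,
      hAB 3 1 h03 h01 h13.symm, hAB 2 3 h02 h03 h23, hAB 3 2 h03 h02 h23.symm] <;>
    norm_num
  have hSR : lor S R = -6 := by
    rw [hR, map_add, map_add, hSA 1 h01, hSA 2 h02, hSA 3 h03]
    norm_num
  have hTR : lor T R = -6 := by
    rw [hR, map_add, map_add, hTA 1 h01, hTA 2 h02, hTA 3 h03]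
    norm_num
  have hRR : lor R R = -3 := by
    nth_rewrite 2 [hR]
    rw [map_add, map_add, hRA 1 h01, hRA 2 h02, hRA 3 h03]
    norm_num
  have r_cases : ∀ x ∈ cellVertices, x ∈ (cellRidge fun _ => 1) →
      ∃ j, 0 ≠ j ∧ W x = A j := by
    intro x hx hxr
    obtain ⟨h0, h1⟩ := (mem_cellRidge (fun _ => one) hx).1 hxr
    obtain ⟨q, b, hq, hb, rfl⟩ := cell_eq_pt hx h0
    rw [sum_mul_pt] at h1
    obtain rfl : b = 1 := by linarith
    exact ⟨q, hq, (hA q).symm⟩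
  have mem_span : ∀ j, 0 ≠ j →
      A j ∈ Submodule.span ℝ (W '' (cellVertices ∩ cellRidge fun _ => 1)) := fun j hj =>
    Submodule.subset_span ⟨_, ⟨hm hj, pt_mem_cellRidge hj⟩, (hA j).symm⟩
  have hspan : ∀ j, 0 ≠ j → ∀ X : M5, X - A j - (X - (2 : ℝ) • R) ∈
      Submodule.span ℝ (W '' (cellVertices ∩ cellRidge fun _ => 1)) := fun j hj X => by
    have e : X - A j - (X - (2 : ℝ) • R) = (2 : ℝ) • R - A j := by abel
    rw [e]
    exact Submodule.sub_mem _ (Submodule.smul_mem _ _ (Submodule.add_mem _ (Submodule.add_mem _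
      (mem_span 1 h01) (mem_span 2 h02)) (mem_span 3 h03))) (mem_span j hj)
  have perp : ∀ X : M5, (∀ j, 0 ≠ j → lor X (A j) = -2) → ∀ x ∈ cellVertices,
      x ∈ (cellRidge fun _ => 1) → lor (X - (2 : ℝ) • R) (W x) = 0 := by
    intro X hX x hx hxr
    obtain ⟨j, hj, e⟩ := r_cases x hx hxr
    rw [e, map_sub, map_smul, LinearMap.sub_apply, LinearMap.smul_apply, hX j hj, hRA j hj]
    norm_num
  have products : ∀ X Y : M5, lor X R = -6 → lor Y R = -6 →
      lor (X - (2 : ℝ) • R) (Y - (2 : ℝ) • R) = lor X Y + 12 := by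
    intro X Y hX hY
    simp only [map_sub, map_smul, LinearMap.sub_apply, LinearMap.smul_apply, hX, hRR,
      lor_comm R Y, hY, smul_eq_mul]
    ring
  refine ⟨⟨_, hm h01, _, hm h02, _, hm h03, pt_mem_cellRidge h01, pt_mem_cellRidge h02,
    pt_mem_cellRidge h03, ?_⟩, S - (2 : ℝ) • R, T - (2 : ℝ) • R, ⟨perp S hSA, ?_, ?_⟩,
    ⟨perp T hTA, ?_, ?_⟩, ?_⟩
  · have posA := fun {j : Fin 4} (hj : 0 ≠ j) => hW.pos hsph (hm hj)
    rw [← hA, ← hA, ← hA]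
    exact ⟨hAA 1 h01, hAA 2 h02, hAA 3 h03, hAB 1 2 h01 h02 h12, hAB 2 3 h02 h03 h23,
      (hAB 1 3 h01 h03 h13).le, by rw [hA]; exact posA h01, by rw [hA]; exact posA h02⟩
  · rw [products S S hSR hSR, hSS]
    norm_num
  · intro x hx hxF hxr
    obtain ⟨q, b, hq, rfl | rfl, rfl⟩ := cell_eq_pt hx ((mem_cellA one hx).1 hxF)
    · exact absurd (pt_mem_cellRidge hq) hxr
    · rw [hS q hq]
      exact hspan q hq S
  · rw [products T T hTR hTR, hTT]
    norm_num
  · intro x hx hxG hxr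
    obtain ⟨p, q, a, b, hpq, ha, hb, rfl⟩ := hx
    change pt p q a b ∈ _ at hxG
    change pt p q a b ∉ _ at hxr
    change W (pt p q a b) - _ ∈ _
    rw [mem_cellB (pt_mem hpq ha hb), sum_mul_pt] at hxG
    obtain rfl : a = 1 := by rcases ha with rfl | rfl <;> rcases hb with rfl | rfl <;> linarith
    obtain rfl : b = 1 := by linarith
    have hp : 0 ≠ p := by
      rintro rfl
      exact hxr (pt_mem_cellRidge hpq)
    have hq : 0 ≠ q := by
      rintro rfl
      rw [pt_comm] at hxr
      exact hxr (pt_mem_cellRidge hpq.symm)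
    obtain ⟨j, hj, hjp, hjq⟩ : ∃ j : Fin 4, 0 ≠ j ∧ j ≠ p ∧ j ≠ q := by
      clear hxr hxG hpq hp hq; revert p q; decide
    rw [hT j p q hj hp hq hjp hjq hpq]
    exact hspan j hj T
  · rw [products S T hSR hTR, hST]
    norm_num

lemma isModel_cell : IsModel cellVertices (cellRidge fun _ => 1) (cellFacetA 0 1)
    (cellFacetB fun _ => 1) 8 4 := by
  have hsph := isSpherical_cell
  have one : (1 : ℝ) = 1 ∨ (1 : ℝ) = -1 := Or.inl rfl
  have neg : (-1 : ℝ) = 1 ∨ (-1 : ℝ) = -1 := Or.inr rfl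
  have mem_r := fun {x : E4} (hx : x ∈ cellVertices) => mem_cellRidge (fun _ => one) hx
  have er := exposed_cellRidge (σ := fun _ => 1) fun _ => one
  have eF := exposed_cellA (i := 0) one
  have eG := exposed_cellB (σ := fun _ => 1) fun _ => one
  refine ⟨hsph.finite, hsph.vertices_eq, er, eF, eG, ?_, ?_, ?_, ?_, ?_, cell_flag,
    fun _ => cell_other, fun W hW => cell_hinge hW⟩
  · exact hsph.face_subset er eF fun x hx hxr => (mem_cellA one hx).2 ((mem_r hx).1 hxr).1
  · exact hsph.face_subset er eG fun x hx hxr => (mem_cellB hx).2 ((mem_r hx).1 hxr).2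
  · exact fun x hx hF hG => (mem_r hx).2 ⟨(mem_cellA one hx).1 hF, (mem_cellB hx).1 hG⟩
  · have hm := pt_mem (i := 0) (j := 1) (by decide) one neg
    refine ⟨_, hm, pt_mem_cellA (by decide) neg, fun h => ?_⟩
    have := ((mem_r hm).1 h).2
    rw [sum_mul_pt] at this
    norm_num at this
  · have h12 : (1 : Fin 4) ≠ 2 := by decide
    have hm := pt_mem h12 one one
    refine ⟨_, hm, pt_mem_cellB h12, fun h => ?_⟩
    have := ((mem_r hm).1 h).1
    simp [pt_apply] at this

end Cell24

end EdgeScribe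

theorem mainTheorem5 :
    (∀ P P' f Q : Set (EuclideanSpace ℝ (Fin 4)),
      IsOrthoplex P → IsOrthoplex P' → IsConnectedSum P P' f Q → ¬ IsEdgeScribable Q) ∧
    (∀ P₁ P₂ P₃ Q : Set (EuclideanSpace ℝ (Fin 4)),
      IsHypercube P₁ → IsHypercube P₂ → IsHypercube P₃ →
        IsTripleSumSharingRidge P₁ P₂ P₃ Q → ¬ IsEdgeScribable Q) ∧
    (∀ P₁ P₂ P₃ Q : Set (EuclideanSpace ℝ (Fin 4)),
      Is24Cell P₁ → Is24Cell P₂ → Is24Cell P₃ →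
        IsTripleSumSharingRidge P₁ P₂ P₃ Q → ¬ IsEdgeScribable Q) := by
  exact ⟨fun _ _ _ _ hP hP' h =>
      isModel_orthoplex.not_isEdgeScribable_sum (by norm_num) hP.2 hP'.2 h,
    fun _ _ _ _ h₁ h₂ h₃ h =>
      isModel_cube.not_isEdgeScribable_triple (by norm_num) (by norm_num) h₁.2 h₂.2 h₃.2 h,
    fun _ _ _ _ h₁ h₂ h₃ h =>
      isModel_cell.not_isEdgeScribable_triple (by norm_num) (by norm_num) h₁.2 h₂.2 h₃.2 h⟩
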